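/- **Setting.** Let $k$ be a finite field, $H$ a finite abelian group with $\mathrm{char}\,k\nmid|H|$, and $J$ a finite-dimensional nilpotent associative $k$-algebra with commuting $k$-linear left and right actions of $H$ such that $h(xy)=(hx)y$, $(xy)h=x(yh)$ and $x(hy)=(xh)y$. The set $G=H+J$ of formal sums $h+x$, with the product $(h_1+x_1)(h_2+x_2)=h_1h_2+(h_1x_2+x_1h_2+x_1x_2)$, is a finite group, called a *finite group of triangular type*; put $N=1+J$. If $H'\le H$ is a subgroup and $J'\subseteq J$ is a subalgebra stable under the left and right actions of $H'$, then $G'=H'+J'$ is called a *subgroup of triangular type*; it is itself a finite group of triangular type over $k$. **Supercharacters.** Let $\tilde G$ be the group of triples $\tau=(t,a,b)$ with $t\in H$, $a,b\in N$ and product $(t_1,a_1,b_1)(t_2,a_2,b_2)=(t_1t_2,\,t_2^{-1}a_1t_2a_2,\,t_2^{-1}b_1t_2b_2)$. It acts on $J$ by $\rho_\tau(x)=taxb^{-1}t^{-1}$, on the dual space $J^*$ by $(\rho^*_\tau\lambda)(x)=\lambda(\rho_{\tau^{-1}}(x))$, and on $G$ by $R_\tau(g)=1+ta(g-1)b^{-1}t^{-1}$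 (computed in the algebra $kH\oplus J$). For an idempotent $e\in kH$ put $J_e=eJe$, $J_e^*=\{\lambda\in J^*:\lambda(x)=\lambda(exe)\text{ for all }x\in J\}$ and $H(e)=\{h\in H: he=e\}$. Let $\tilde G_e$ be the group of triples of $G_e=eGe=He+J_e$; it acts on $J_e^*$, and its orbits there are the sets $\{\rho^*_{(t,a,b)}\lambda : t\in H,\ a,b\in 1+J_e\}$. Such an orbit is *regular* if it meets $J_f^*$ for no idempotent $f\ne e$ of $e\,kH$. Let $\mathcal A(G)$ be the set of triples $\alpha=(e,\theta,\omega)$ with $e\in kH$ an idempotent, $\theta$ a linear (complex) character of $H(e)$, and $\omega$ a regular $\tilde G_e$-orbit in $J_e^*$. Fix a nontrivial character $t\mapsto\varepsilon^t$ of the additive group of $k$ with values in $\mathbb C^*$. For $\alpha\in\mathcal A(G)$ and any $\lambda\in\omega$, $G_\alpha=H(e)+\{x\in J:\lambda(xJ)=0\}$ is a subgroup of $G$ with linear character $\xi_{\theta,\lambda}(h+x)=\theta(h)\varepsilon^{\lambda(x)}$, and the *supercharacter* of $\alpha$ is $\chi_\alpha=\mathrm{Ind}(\xi_{\theta,\lambda},G_\alpha,G)$.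 Write $\phi_\eta$, $\eta\in\mathcal A(G')$, for the supercharacters of $G'$, formed in the same way with the same $k$ and $\varepsilon$. **Superinduction.** For a function $\phi$ on $G'$ let $\dot\phi$ be its extension by zero to $G$, and put $$\mathrm{SInd}\,\phi(g)=\frac{|H|}{|G|\,|G'|}\sum_{\tau\in\tilde G}\dot\phi(R_\tau(g)).$$ Let $(f_1,f_2)=\frac1{|\Gamma|}\sum_{g\in\Gamma}f_1(g)\overline{f_2(g)}$ for functions on a finite group $\Gamma$. **Statement.** Whichever representatives $\lambda\in\omega$ are chosen, the families $(\chi_\alpha)_{\alpha\in\mathcal A(G)}$ and $(\phi_\eta)_{\eta\in\mathcal A(G')}$ are linearly independent over $\mathbb C$, and there are (therefore unique) coefficients $m_{\alpha,\eta}\in\mathbb Z_{\ge0}$ and $a_{\eta,\alpha}\in\mathbb Q_{\ge0}$ such that $$\mathrm{Res}_{G'}\,\chi_\alpha=\sum_{\eta}m_{\alpha,\eta}\,\phi_\eta\quad(\alpha\in\mathcal A(G)),\qquad \mathrm{SInd}\,\phi_\eta=\sum_{\alpha}a_{\eta,\alpha}\,\chi_\alpha\quad(\eta\in\mathcal A(G')),$$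 and $$a_{\eta,\alpha}=\frac{m_{\alpha,\eta}\,(\phi_\eta,\phi_\eta)}{(\chi_\alpha,\chi_\alpha)} .$$ In particular, the superinduction of any supercharacter of $G'$ is a sum of supercharacters of $G$ with nonnegative rational coefficients. -/

import Mathlib

/-- The data defining a finite group of triangular type `G = H + J`: commuting left and right
`k`-linear actions of the abelian group `H` on the nilpotent associative `k`-algebra `J`,
compatible with the product of `J`, where `char k` does not divide `|H|`.  `l h x` is `hx` and
`r h x` is `xh`; since `H` is abelian, a right action is a homomorphism from `H`. -/
structure TriangularType (k H J : Type*) [Field k] [CommGroup H] [NonUnitalRing J] [Module k J]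
    [IsScalarTower k J J] [SMulCommClass k J J] where
  /-- the left action `x ↦ hx` -/
  l : H →* Module.End k J
  /-- the right action `x ↦ xh` -/
  r : H →* Module.End k J
  l_r : ∀ (g h : H) (x : J), l g (r h x) = r h (l g x)
  l_mul : ∀ (h : H) (x y : J), l h (x * y) = l h x * y
  r_mul : ∀ (h : H) (x y : J), r h (x * y) = x * r h y
  mul_l : ∀ (h : H) (x y : J), x * l h y = r h x * y
  /-- `J` is nilpotent: `J ^ (n + 1) = 0` for some `n`. -/
  nilpotent : ∃ n : ℕ, ∀ (x : J) (s : List J), s.length = n → s.foldl (· * ·) x = 0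
  char_not_dvd : ¬ ringChar k ∣ Nat.card H

namespace TriangularType

section

variable {k H J : Type*} [Field k] [CommGroup H] [NonUnitalRing J] [Module k J]
  [IsScalarTower k J J] [SMulCommClass k J J]

/-- The set `G = H + J`; the pair `⟨h, x⟩` is the formal sum `h + x`. -/
@[ext] structure G (D : TriangularType k H J) where
  h : H
  x : J

variable (D : TriangularType k H J)

/-- `(h₁ + x₁)(h₂ + x₂) = h₁h₂ + (h₁x₂ + x₁h₂ + x₁x₂)`. -/
instance : Mul D.G := ⟨fun g g' => ⟨g.h * g'.h, D.l g.h g'.x + D.r g'.h g.x + g.x * g'.x⟩⟩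

instance : One D.G := ⟨⟨1, 0⟩⟩

@[simp] theorem mul_h (g g' : D.G) : (g * g').h = g.h * g'.h := rfl

@[simp] theorem mul_x (g g' : D.G) :
    (g * g').x = D.l g.h g'.x + D.r g'.h g.x + g.x * g'.x := rfl

@[simp] theorem one_h : (1 : D.G).h = 1 := rfl

@[simp] theorem one_x : (1 : D.G).x = 0 := rfl

theorem r_r (g h : H) (x : J) : D.r g (D.r h x) = D.r h (D.r g x) := by
  rw [← Module.End.mul_apply, ← map_mul, mul_comm, map_mul, Module.End.mul_apply]

theorem G_mul_assoc (a b c : D.G) : a * b * c = a * (b * c) := by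
  ext
  · simp [mul_assoc]
  · simp only [mul_x, mul_h, map_add, map_mul, Module.End.mul_apply, mul_add, add_mul,
      D.l_r, D.l_mul, D.r_mul, D.mul_l, mul_assoc]
    rw [D.r_r c.h b.h]
    abel

theorem G_one_mul (a : D.G) : 1 * a = a := by
  ext <;> simp

theorem exists_quasi_inv (D : TriangularType k H J) (y : J) : ∃ z : J, z + y + z * y = 0 := by
  obtain ⟨n, hn⟩ := D.nilpotent
  have key : ∀ m : ℕ, ∃ z : J,
      z + y + z * y = (List.replicate m (-y)).foldl (· * ·) y := by
    intro m
    induction m with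
    | zero => exact ⟨0, by simp⟩
    | succ m ih =>
      obtain ⟨z, hz⟩ := ih
      refine ⟨z - (List.replicate m (-y)).foldl (· * ·) y, ?_⟩
      rw [List.replicate_succ', List.foldl_append, List.foldl_cons, List.foldl_nil, ← hz]
      noncomm_ring
  obtain ⟨z, hz⟩ := key n
  exact ⟨z, by rw [hz]; exact hn y _ (by simp)⟩

theorem exists_left_inv (g : D.G) : ∃ g' : D.G, g' * g = 1 := by
  obtain ⟨z, hz⟩ := D.exists_quasi_inv (D.l g.h⁻¹ g.x)
  refine ⟨⟨g.h⁻¹, D.r g.h⁻¹ z⟩, ?_⟩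
  ext
  · simp
  · rw [mul_x, ← D.mul_l, ← Module.End.mul_apply, ← map_mul, mul_inv_cancel, map_one,
      Module.End.one_apply, one_x, ← hz]
    abel

noncomputable instance : Inv D.G := ⟨fun g => (D.exists_left_inv g).choose⟩

noncomputable instance : Group D.G :=
  Group.ofLeftAxioms D.G_mul_assoc D.G_one_mul fun g => (D.exists_left_inv g).choose_spec

instance [Finite H] [Finite J] : Finite D.G :=
  Finite.of_injective (fun g : D.G => (g.h, g.x)) fun _ _ hab =>
    TriangularType.G.ext (congrArg Prod.fst hab) (congrArg Prod.snd hab)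

noncomputable instance [Finite H] [Finite J] : Fintype D.G := Fintype.ofFinite _

/-- The projection `h + x ↦ h` of `G` onto `H`. -/
noncomputable def proj : D.G →* H where
  toFun g := g.h
  map_one' := rfl
  map_mul' _ _ := rfl

/-- The inclusion `h ↦ h + 0` of `H` into `G`. -/
noncomputable def ofH : H →* D.G where
  toFun h := ⟨h, 0⟩
  map_one' := rfl
  map_mul' g h := by ext <;> simp

/-- The normal subgroup `N = 1 + J` of `G`. -/
noncomputable def N : Subgroup D.G := D.proj.ker

/-- The left action of `G` on `J`: `(h + x) z = hz + xz`. -/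
noncomputable def lact : D.G →* Module.End k J where
  toFun g := D.l g.h + LinearMap.mulLeft k g.x
  map_one' := by ext; simp
  map_mul' a b := by
    ext z
    simp only [mul_h, mul_x, map_mul, LinearMap.add_apply, Module.End.mul_apply,
      LinearMap.mulLeft_apply, add_mul, mul_add, D.l_mul, D.mul_l, mul_assoc]
    abel

/-- The right action of `G` on `J`: `z (h + x) = zh + zx`. -/
def ract (g : D.G) : Module.End k J := D.r g.h + LinearMap.mulRight k g.x

theorem ract_mul (a b : D.G) : D.ract (a * b) = D.ract b * D.ract a := by
  ext z
  simp only [ract, mul_h, mul_x, map_mul, LinearMap.add_apply, Module.End.mul_apply,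
    LinearMap.mulRight_apply, add_mul, mul_add, D.r_mul, D.mul_l, mul_assoc]
  rw [D.r_r]
  abel

theorem ract_one : D.ract 1 = 1 := by
  ext z; simp [ract]

theorem lact_ract (a b : D.G) : D.lact a * D.ract b = D.ract b * D.lact a := by
  ext z
  simp only [lact, ract, MonoidHom.coe_mk, OneHom.coe_mk, LinearMap.add_apply,
    Module.End.mul_apply, LinearMap.mulRight_apply, LinearMap.mulLeft_apply, add_mul, mul_add,
    D.l_mul, D.r_mul, D.l_r, mul_assoc]
  abel

/-- The group of triples `τ = (t, a, b)` with `t ∈ H` and `a, b ∈ N`. -/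
@[ext] structure Gt where
  t : H
  a : D.N
  b : D.N

/-- `t⁻¹ a t` as an element of `N`. -/
noncomputable def conjN (t : H) (a : D.N) : D.N :=
  ⟨(D.ofH t)⁻¹ * a * D.ofH t, by
    have := (inferInstance : D.proj.ker.Normal).conj_mem a a.2 (D.ofH t)⁻¹
    rwa [inv_inv] at this⟩

/-- `(t₁, a₁, b₁)(t₂, a₂, b₂) = (t₁t₂, t₂⁻¹a₁t₂a₂, t₂⁻¹b₁t₂b₂)`. -/
noncomputable instance : Mul D.Gt :=
  ⟨fun p q => ⟨p.t * q.t, D.conjN q.t p.a * q.a, D.conjN q.t p.b * q.b⟩⟩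

noncomputable instance : One D.Gt := ⟨⟨1, 1, 1⟩⟩

noncomputable instance : Inv D.Gt :=
  ⟨fun p => ⟨p.t⁻¹, D.conjN p.t⁻¹ p.a⁻¹, D.conjN p.t⁻¹ p.b⁻¹⟩⟩

noncomputable instance : Group D.Gt :=
  Group.ofLeftAxioms
    (fun p q s => by
      apply Gt.ext
      · exact mul_assoc _ _ _
      · apply Subtype.ext
        change (D.ofH s.t)⁻¹ * ((D.ofH q.t)⁻¹ * p.a * D.ofH q.t * q.a) * D.ofH s.t * s.a =
          (D.ofH (q.t * s.t))⁻¹ * p.a * D.ofH (q.t * s.t) *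
            ((D.ofH s.t)⁻¹ * q.a * D.ofH s.t * s.a)
        rw [map_mul]; group
      · apply Subtype.ext
        change (D.ofH s.t)⁻¹ * ((D.ofH q.t)⁻¹ * p.b * D.ofH q.t * q.b) * D.ofH s.t * s.b =
          (D.ofH (q.t * s.t))⁻¹ * p.b * D.ofH (q.t * s.t) *
            ((D.ofH s.t)⁻¹ * q.b * D.ofH s.t * s.b)
        rw [map_mul]; group)
    (fun p => by
      apply Gt.ext
      · exact one_mul _
      · apply Subtype.ext
        change (D.ofH p.t)⁻¹ * 1 * D.ofH p.t * p.a = p.a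
        group
      · apply Subtype.ext
        change (D.ofH p.t)⁻¹ * 1 * D.ofH p.t * p.b = p.b
        group)
    (fun p => by
      apply Gt.ext
      · exact inv_mul_cancel _
      · apply Subtype.ext
        change (D.ofH p.t)⁻¹ * ((D.ofH p.t⁻¹)⁻¹ * (p.a : D.G)⁻¹ * D.ofH p.t⁻¹) * D.ofH p.t * p.a = 1
        rw [map_inv]; group
      · apply Subtype.ext
        change (D.ofH p.t)⁻¹ * ((D.ofH p.t⁻¹)⁻¹ * (p.b : D.G)⁻¹ * D.ofH p.t⁻¹) * D.ofH p.t * p.b = 1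
        rw [map_inv]; group)

instance [Finite H] [Finite J] : Finite D.Gt :=
  Finite.of_injective (fun p : D.Gt => (p.t, p.a, p.b)) fun p q h => by
    simp only [Prod.mk.injEq] at h
    exact Gt.ext h.1 h.2.1 h.2.2

noncomputable instance [Finite H] [Finite J] : Fintype D.Gt := Fintype.ofFinite _

/-- The representation `ρ_τ(x) = t a x b⁻¹ t⁻¹` on `J`. -/
noncomputable def rho : Representation k D.Gt J where
  toFun τ := D.lact (D.ofH τ.t * τ.a) * D.ract ((τ.b : D.G)⁻¹ * (D.ofH τ.t)⁻¹)
  map_one' := by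
    change D.lact (D.ofH 1 * 1) * D.ract ((1 : D.G)⁻¹ * (D.ofH 1)⁻¹) = 1
    simp [ract_one]
  map_mul' p q := by
    change D.lact (D.ofH (p.t * q.t) * ((D.ofH q.t)⁻¹ * p.a * D.ofH q.t * q.a)) *
      D.ract (((D.ofH q.t)⁻¹ * p.b * D.ofH q.t * q.b : D.G)⁻¹ * (D.ofH (p.t * q.t))⁻¹) = _
    have h1 : D.ofH (p.t * q.t) * ((D.ofH q.t)⁻¹ * p.a * D.ofH q.t * q.a) =
        (D.ofH p.t * p.a) * (D.ofH q.t * q.a) := by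
      rw [map_mul]; group
    have h2 : ((D.ofH q.t)⁻¹ * p.b * D.ofH q.t * q.b : D.G)⁻¹ * (D.ofH (p.t * q.t))⁻¹ =
        ((q.b : D.G)⁻¹ * (D.ofH q.t)⁻¹) * ((p.b : D.G)⁻¹ * (D.ofH p.t)⁻¹) := by
      rw [map_mul]; group
    rw [h1, h2, map_mul, ract_mul, mul_assoc, mul_assoc, ← mul_assoc (D.lact (_ * _)) (D.ract _),
      lact_ract, mul_assoc]

/-- The dual representation on `J*`: `(ρ*_τ λ)(x) = λ(ρ_{τ⁻¹}(x))`. -/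
noncomputable def rhoDual : Representation k D.Gt (Module.Dual k J) := D.rho.dual

/-- The action of `τ` on `G`, `R_τ(g) = 1 + t a (g - 1) b⁻¹ t⁻¹`.  For `g = h + x`, the element
`t a g b⁻¹ t⁻¹` of `G` is `h + y`, the element `t a b⁻¹ t⁻¹` of `G` is `1 + z`, and so
`R_τ(g) = 1 + (h + y) - (1 + z) = h + (y - z)`. -/
noncomputable def R (τ : D.Gt) (g : D.G) : D.G :=
  ⟨g.h, (D.ofH τ.t * τ.a * g * (τ.b : D.G)⁻¹ * (D.ofH τ.t)⁻¹).x -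
    (D.ofH τ.t * τ.a * (τ.b : D.G)⁻¹ * (D.ofH τ.t)⁻¹).x⟩

/-- The left action of the group algebra `kH` on `J`. -/
noncomputable def L : MonoidAlgebra k H →ₐ[k] Module.End k J := MonoidAlgebra.lift k _ H D.l

/-- The right action of the (commutative) group algebra `kH` on `J`. -/
noncomputable def Rt : MonoidAlgebra k H →ₐ[k] Module.End k J := MonoidAlgebra.lift k _ H D.r

/-- `(ex)e` for `e ∈ kH` and `x ∈ J`. -/
noncomputable def corner (e : MonoidAlgebra k H) : Module.End k J := D.Rt e * D.L e

/-- `J_e = eJe`. -/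
noncomputable def Je (e : MonoidAlgebra k H) : Submodule k J := LinearMap.range (D.corner e)

/-- `J_e*`, as the subspace of the `λ ∈ J*` that vanish on the Peirce components other than `eJe`,
that is, `λ(x) = λ(exe)` for all `x`. -/
def JeDual (e : MonoidAlgebra k H) : Set (Module.Dual k J) :=
  {lam | ∀ x, lam (D.corner e x) = lam x}

/-- `H(e) = {h : he = e}`, the product being taken in `kH`. -/
def Hfix (_ : TriangularType k H J) (e : MonoidAlgebra k H) : Subgroup H where
  carrier := {h | MonoidAlgebra.of k H h * e = e}
  one_mem' := by
    change MonoidAlgebra.of k H 1 * e = e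
    rw [map_one, one_mul]
  mul_mem' {a b} ha hb := by
    change MonoidAlgebra.of k H (a * b) * e = e
    rw [map_mul, mul_assoc, show MonoidAlgebra.of k H b * e = e from hb]
    exact ha
  inv_mem' {a} ha := by
    change MonoidAlgebra.of k H a⁻¹ * e = e
    have ha' : MonoidAlgebra.of k H a * e = e := ha
    nth_rewrite 1 [← ha']
    rw [← mul_assoc, ← map_mul, inv_mul_cancel, map_one, one_mul]

/-- The `τ = (t, a, b)` with `a, b ∈ 1 + J_e`.  On `J_e`, the elements `1 + x`, `x ∈ J_e`, act as
the elements `e + x` of `e + J_e`, and `t` acts as `te`; so these `τ` act on `J_e` and on `J_e*` as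
the group of triples belonging to `G_e = eGe = H_e + J_e`. -/
def GtCorner (e : MonoidAlgebra k H) : Set D.Gt :=
  {τ | (τ.a : D.G).x ∈ D.Je e ∧ (τ.b : D.G).x ∈ D.Je e}

/-- The triples `α = (e, θ, ω)`: `e` is an idempotent of `kH`, `θ` is a linear character of `H(e)`,
and `ω` is an orbit in `J_e*`, for the group of triples of `G_e`, that is regular with respect to
`H_e`: it does not meet `J_f*` for any idempotent `f ≠ e` of `e(kH)`. -/
@[ext] structure Index where
  e : MonoidAlgebra k H
  idem : IsIdempotentElem e
  θ : D.Hfix e →* ℂˣ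
  ω : Set (Module.Dual k J)
  subset : ω ⊆ D.JeDual e
  orbit : ∃ lam ∈ D.JeDual e, ω = {mu | ∃ τ ∈ D.GtCorner e, mu = D.rhoDual τ lam}
  regular : ∀ f : MonoidAlgebra k H, IsIdempotentElem f → e * f = f → f ≠ e →
    Disjoint ω (D.JeDual f)

instance [Finite k] [Finite H] [Finite J] : Finite D.Index := by
  have : Finite (MonoidAlgebra k H) := Module.finite_of_finite k
  have : Finite (Module.Dual k J) := DFunLike.finite _
  refine Finite.of_injective
    (fun α : D.Index => (⟨α.e, α.θ, α.ω⟩ :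
      Σ e : MonoidAlgebra k H, (D.Hfix e →* ℂˣ) × Set (Module.Dual k J))) ?_
  rintro ⟨e, _, θ, ω, _, _, _⟩ ⟨e', _, θ', ω', _, _, _⟩ h
  obtain ⟨rfl, h⟩ := Sigma.mk.inj h
  obtain ⟨rfl, rfl⟩ := Prod.mk.inj (eq_of_heq h)
  rfl

noncomputable instance [Finite k] [Finite H] [Finite J] : Fintype D.Index := Fintype.ofFinite _

theorem L_of (h : H) : D.L (MonoidAlgebra.of k H h) = D.l h := by simp [L]

theorem Rt_of (h : H) : D.Rt (MonoidAlgebra.of k H h) = D.r h := by simp [Rt]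

theorem Rt_L (e f : MonoidAlgebra k H) : D.Rt e * D.L f = D.L f * D.Rt e := by
  induction e using MonoidAlgebra.induction_linear with
  | zero => simp
  | add a b ha hb => rw [map_add, add_mul, mul_add, ha, hb]
  | single g c =>
    induction f using MonoidAlgebra.induction_linear with
    | zero => simp
    | add a b ha hb => rw [map_add, add_mul, mul_add, ha, hb]
    | single h d =>
      ext x
      simp [L, Rt, D.l_r, smul_comm c d]

variable {D}

theorem JeDual_l {e : MonoidAlgebra k H} {lam : Module.Dual k J} (hlam : lam ∈ D.JeDual e) {h : H}
    (hh : h ∈ D.Hfix e) (x : J) : lam (D.l h x) = lam x := by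
  have hh' : e * MonoidAlgebra.of k H h = e := by rw [mul_comm]; exact hh
  have hc : D.corner e * D.l h = D.corner e := by
    rw [corner, ← D.L_of h, mul_assoc, ← map_mul, hh']
  rw [← hlam, ← hlam x, ← Module.End.mul_apply, hc]

theorem JeDual_r {e : MonoidAlgebra k H} {lam : Module.Dual k J} (hlam : lam ∈ D.JeDual e) {h : H}
    (hh : h ∈ D.Hfix e) (x : J) : lam (D.r h x) = lam x := by
  have hh' : e * MonoidAlgebra.of k H h = e := by rw [mul_comm]; exact hh
  have hc : D.corner e * D.r h = D.corner e := by
    rw [corner, Rt_L, ← D.Rt_of h, mul_assoc, ← map_mul, hh']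
  rw [← hlam, ← hlam x, ← Module.End.mul_apply, hc]

/-- The subgroup `G_α = H(e) + {x : λ(xJ) = 0}` of `G`, for `λ ∈ ω`. -/
def Galpha (α : D.Index) (lam : α.ω) : Subgroup D.G where
  carrier := {g | g.h ∈ D.Hfix α.e ∧ ∀ z, lam.1 (g.x * z) = 0}
  one_mem' := ⟨one_mem _, by simp⟩
  mul_mem' {a b} ha hb := by
    refine ⟨mul_mem ha.1 hb.1, fun z => ?_⟩
    have hl := α.subset lam.2
    rw [mul_x, add_mul, add_mul, map_add, map_add, ← D.l_mul, JeDual_l hl ha.1, hb.2,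
      ← D.mul_l, ha.2, mul_assoc, ha.2]
    simp
  inv_mem' {a} ha := by
    have hl := α.subset lam.2
    have hh : a⁻¹.h = a.h⁻¹ := map_inv D.proj a
    have h1 : a⁻¹.h ∈ D.Hfix α.e := by rw [hh]; exact inv_mem ha.1
    refine ⟨h1, fun z => ?_⟩
    have h2 : (a * a⁻¹).x = 0 := by rw [mul_inv_cancel]; rfl
    rw [mul_x] at h2
    have h3 := congrArg (fun y => lam.1 (y * z)) h2
    simp only [add_mul, map_add, zero_mul, map_zero] at h3
    rwa [← D.l_mul, JeDual_l hl ha.1, ← D.mul_l, ha.2, mul_assoc, ha.2, add_zero, add_zero] at h3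

/-- The linear character `ξ_{θ,λ}(h + x) = θ(h) ε^{λ(x)}` of `G_α`. -/
noncomputable def xi (ε : AddChar k ℂ) (α : D.Index) (lam : α.ω) : Galpha α lam →* ℂ where
  toFun g := (α.θ ⟨g.1.h, g.2.1⟩ : ℂ) * ε (lam.1 g.1.x)
  map_one' := by
    have : (⟨(1 : D.G).h, (1 : Galpha α lam).2.1⟩ : D.Hfix α.e) = 1 := rfl
    simp only [Subgroup.coe_one, one_x, map_zero, AddChar.map_zero_eq_one, mul_one]
    rw [this, map_one, Units.val_one]
  map_mul' a b := by
    have hl := α.subset lam.2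
    have h1 : (⟨(a * b : Galpha α lam).1.h, (a * b).2.1⟩ : D.Hfix α.e) =
        ⟨a.1.h, a.2.1⟩ * ⟨b.1.h, b.2.1⟩ := rfl
    have h2 : lam.1 (a * b : Galpha α lam).1.x = lam.1 b.1.x + lam.1 a.1.x := by
      rw [Subgroup.coe_mul, mul_x, map_add, map_add]
      have h3 : lam.1 (a.1.x * b.1.x) = 0 := a.2.2 _
      rw [h3, JeDual_l hl a.2.1, JeDual_r hl b.2.1, add_zero]
    rw [h1, h2, map_mul, Units.val_mul, AddChar.map_add_eq_mul]
    ring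

open Classical in
/-- The character of `Γ` induced from a character `f` of a subgroup `K`:
`Ind f (g) = |K|⁻¹ ∑_{s ∈ Γ} f(s⁻¹ g s)`, the sum being over the `s` with `s⁻¹ g s ∈ K`. -/
noncomputable def inducedChar {Γ : Type*} [Group Γ] [Fintype Γ] (K : Subgroup Γ) (f : K → ℂ)
    (g : Γ) : ℂ :=
  (Nat.card K : ℂ)⁻¹ * ∑ s : Γ, if hs : s⁻¹ * g * s ∈ K then f ⟨s⁻¹ * g * s, hs⟩ else 0

/-- The supercharacter `χ_α = Ind(ξ_{θ,λ}, G_α, G)`, formed with a representative `λ ∈ ω`. -/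
noncomputable def superchar [Finite H] [Finite J] (ε : AddChar k ℂ) (α : D.Index) (lam : α.ω) :
    D.G → ℂ :=
  inducedChar (Galpha α lam) (xi ε α lam)

/-- `(f₁, f₂) = |Γ|⁻¹ ∑_{g ∈ Γ} f₁(g) \overline{f₂(g)}`. -/
noncomputable def scalarProduct {Γ : Type*} [Fintype Γ] (f₁ f₂ : Γ → ℂ) : ℂ :=
  (Nat.card Γ : ℂ)⁻¹ * ∑ g : Γ, f₁ g * starRingEnd ℂ (f₂ g)

variable (D)

/-- The data `(H', J')` of the subgroup of triangular type `G' = H' + J'`, where `H'` is a subgroup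
of `H` and `J'` is a subalgebra of `J` stable under the left and right actions of `H'`. -/
def restrict (H' : Subgroup H) (J' : NonUnitalSubalgebra k J)
    (hl : ∀ h ∈ H', ∀ x ∈ J', D.l h x ∈ J') (hr : ∀ h ∈ H', ∀ x ∈ J', D.r h x ∈ J') :
    TriangularType k H' J' where
  l :=
    { toFun := fun h => (D.l h).restrict (p := J'.toSubmodule) (q := J'.toSubmodule) (hl h h.2)
      map_one' := by ext; simp
      map_mul' := fun a b => by ext; simp }
  r :=
    { toFun := fun h => (D.r h).restrict (p := J'.toSubmodule) (q := J'.toSubmodule) (hr h h.2)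
      map_one' := by ext; simp
      map_mul' := fun a b => by ext; simp }
  l_r g h x := Subtype.ext (D.l_r g h x)
  l_mul h x y := Subtype.ext (D.l_mul h x y)
  r_mul h x y := Subtype.ext (D.r_mul h x y)
  mul_l h x y := Subtype.ext (D.mul_l h x y)
  nilpotent := by
    obtain ⟨n, hn⟩ := D.nilpotent
    refine ⟨n, fun x s hs => ?_⟩
    have key : ∀ (s : List J') (x : J'),
        ((s.foldl (· * ·) x : J') : J) = (s.map Subtype.val).foldl (· * ·) (x : J) := by
      intro s
      induction s with
      | nil => simp
      | cons a s ih => intro x; simp [ih]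
    apply Subtype.ext
    rw [key]
    exact hn _ _ (by simpa using hs)
  char_not_dvd h := D.char_not_dvd (h.trans (Subgroup.card_subgroup_dvd_card H'))

variable {D}

/-- The inclusion `h + x ↦ h + x` of `G'` into `G`. -/
def incl {H' : Subgroup H} {J' : NonUnitalSubalgebra k J}
    {hl : ∀ h ∈ H', ∀ x ∈ J', D.l h x ∈ J'} {hr : ∀ h ∈ H', ∀ x ∈ J', D.r h x ∈ J'} :
    (D.restrict H' J' hl hr).G →* D.G where
  toFun g := ⟨g.h, g.x⟩
  map_one' := rfl
  map_mul' _ _ := rfl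

/-- The superinduction
`SInd φ (g) = |H| / (|G| |G'|) ∑_τ φ̇(R_τ(g))`, where `φ̇` is `φ` on `G'` and zero outside `G'`. -/
noncomputable def superInd [Finite H] [Finite J] {H' : Subgroup H} {J' : NonUnitalSubalgebra k J}
    {hl : ∀ h ∈ H', ∀ x ∈ J', D.l h x ∈ J'} {hr : ∀ h ∈ H', ∀ x ∈ J', D.r h x ∈ J'}
    (φ : (D.restrict H' J' hl hr).G → ℂ) (g : D.G) : ℂ :=
  (Nat.card H : ℂ) / (Nat.card D.G * Nat.card (D.restrict H' J' hl hr).G) *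
    ∑ τ : D.Gt, Function.extend (incl (D := D)) φ 0 (D.R τ g)

end

end TriangularType

/-!
Supercharacters of a group `G = H + J` of triangular type form an orthogonal basis of the space of
superclass functions, the functions that are invariant under all the maps `R_τ`. Restriction to a
subgroup of triangular type preserves superclass functions, and superinduction is its adjoint.
Hence restricted and superinduced supercharacters expand in supercharacters, with coefficients
given by scalar products, and everything reduces to showing that
`(Res χ_α, φ_η) / (φ_η, φ_η)` is a natural number.

All computations take place in the ring `kH ⊕ J` (`Amb`), where a triple `τ = (t, a, b)` becomes
the pair `(ta, tb)` (`pL`, `pR`), with `ρ_τ(x) = (ta) x (tb)⁻¹` and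
`R_τ(g) = 1 + (ta)(g - 1)(tb)⁻¹`.

*Orthogonality.* A supercharacter is a multiple of `∑_τ θ(h) ε^{λ(R_τ(g) - h)}`
(`superchar_eq_orbitSum`). The map `R_τ` is affine on `h + J` with linear part `ρ_τ`, and its
translation part is killed by `λ` when `h ∈ H(e)` and both `λ` and `λ ∘ ρ_τ` lie in `J_e*`
(`apply_R_ofH_eq_zero`). Two regular forms in one orbit under all triples have the same idempotent
(`RegularAt.idempotent_unique`), since otherwise part of `e` could be removed by a triple of
`G_e` (`exists_comp_rho_mem_JeDual`), and they are then conjugate under the triples of `G_e`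
(`exists_mem_GtCorner_comp_eq`). So distinct indices give orthogonal supercharacters
(`Index.scalarProduct_superchar`).

*Spanning.* Fourier inversion writes a superclass function as a combination of orbit sums
restricted to cosets of `J`. Each form can be moved to a regular one by minimality of `e`
(`exists_regularAt_comp_rho`), and the orbit sum of a regular form vanishes on `h + J` unless
`h ∈ H(e)` (`RegularAt.mem_Hfix_of_cosetOrbitSum_ne_zero`); Fourier inversion on `H(e)` then gives
`IsSuperclassFunction.mem_span`.

*Integrality.* By Mackey's formula, `(Res χ_α, φ_η)` is a sum of `|G' ∩ s G_α s⁻¹ ∩ G'_η|` over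
the `s ∈ G` for which the conjugate of `ξ_{θ,λ}` by `s` agrees with `ξ_η` on this intersection
(`scalarProduct_superchar_comp_incl`). Let `μ` be the linear form chosen for `η`. The group
`Stab(μ) × G_α` acts on the set of these `s` by `((t, a, b), q) • s = (ta) s q⁻¹`. Linear characters
invariant under `1 + y ↦ 1 + yb` are rigid: such agreement forces `μ` to be invariant under left
multiplication by `G' ∩ s G_α s⁻¹` (`IsRightInvariantCharacter.apply_lact`). This makes the order
of the stabilizer of `s` proportional to the term of `s`, so that the quotient in question is the
number of orbits (`exists_multiplicity`).
-/

namespace TriangularType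

/-! ### The ambient algebra -/

section Ambient

variable {k H J : Type*} [Field k] [CommGroup H] [NonUnitalRing J] [Module k J]
  [IsScalarTower k J J] [SMulCommClass k J J] (D : TriangularType k H J)

theorem L_mul (c : MonoidAlgebra k H) (x y : J) : D.L c (x * y) = D.L c x * y := by
  induction c using MonoidAlgebra.induction_linear with
  | zero => simp
  | add a b ha hb => simp only [map_add, LinearMap.add_apply, ha, hb, add_mul]
  | single g c => simp [L, D.l_mul, smul_mul_assoc]

theorem Rt_mul (c : MonoidAlgebra k H) (x y : J) : D.Rt c (x * y) = x * D.Rt c y := by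
  induction c using MonoidAlgebra.induction_linear with
  | zero => simp
  | add a b ha hb => simp only [map_add, LinearMap.add_apply, ha, hb, mul_add]
  | single g c => simp [Rt, D.r_mul, mul_smul_comm]

theorem mul_L (c : MonoidAlgebra k H) (x y : J) : x * D.L c y = D.Rt c x * y := by
  induction c using MonoidAlgebra.induction_linear with
  | zero => simp
  | add a b ha hb => simp only [map_add, LinearMap.add_apply, ha, hb, mul_add, add_mul]
  | single g c => simp [L, Rt, D.mul_l, mul_smul_comm, smul_mul_assoc]

theorem Rt_L_apply (c d : MonoidAlgebra k H) (x : J) : D.Rt c (D.L d x) = D.L d (D.Rt c x) :=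
  congrArg (fun T : Module.End k J => T x) (D.Rt_L c d)

/-- The ambient algebra `kH ⊕ J`, in which `G`, the group algebra `kH` and the ideal `J` all live.
Only its ring structure is recorded. -/
@[ext] structure Amb (_ : TriangularType k H J) where
  /-- the component in `kH` -/
  fst : MonoidAlgebra k H
  /-- the component in `J` -/
  snd : J

/-- The additive structure of `kH ⊕ J` is that of a product. -/
def ambEquiv : D.Amb ≃ MonoidAlgebra k H × J where
  toFun a := (a.fst, a.snd)
  invFun a := ⟨a.1, a.2⟩
  left_inv _ := rfl
  right_inv _ := rfl

noncomputable instance : AddCommGroup D.Amb := D.ambEquiv.addCommGroup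

noncomputable instance : Mul D.Amb :=
  ⟨fun a b => ⟨a.1 * b.1, D.L a.1 b.2 + D.Rt b.1 a.2 + a.2 * b.2⟩⟩

noncomputable instance : One D.Amb := ⟨⟨1, 0⟩⟩

namespace Amb

variable {D}

@[simp] theorem mul_fst (a b : D.Amb) : (a * b).1 = a.1 * b.1 := rfl

@[simp] theorem mul_snd (a b : D.Amb) :
    (a * b).2 = D.L a.1 b.2 + D.Rt b.1 a.2 + a.2 * b.2 := rfl

@[simp] theorem one_fst : (1 : D.Amb).1 = 1 := rfl

@[simp] theorem one_snd : (1 : D.Amb).2 = 0 := rfl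

@[simp] theorem add_fst (a b : D.Amb) : (a + b).1 = a.1 + b.1 := rfl

@[simp] theorem add_snd (a b : D.Amb) : (a + b).2 = a.2 + b.2 := rfl

@[simp] theorem zero_fst : (0 : D.Amb).1 = 0 := rfl

@[simp] theorem zero_snd : (0 : D.Amb).2 = 0 := rfl

end Amb

noncomputable instance : Ring D.Amb :=
  { (inferInstance : AddCommGroup D.Amb) with
    mul := (· * ·)
    one := 1
    left_distrib := fun a b c => by
      ext1 <;> simp only [Amb.mul_fst, Amb.mul_snd, Amb.add_fst, Amb.add_snd, mul_add, map_add,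
        LinearMap.add_apply]
      abel
    right_distrib := fun a b c => by
      ext1 <;> simp only [Amb.mul_fst, Amb.mul_snd, Amb.add_fst, Amb.add_snd, add_mul, map_add,
        LinearMap.add_apply]
      abel
    zero_mul := fun a => by
      ext1 <;> simp
    mul_zero := fun a => by
      ext1 <;> simp
    mul_assoc := fun a b c => by
      ext1
      · simp only [Amb.mul_fst, mul_assoc]
      · simp only [Amb.mul_fst, Amb.mul_snd, map_add, map_mul, Module.End.mul_apply, mul_add,
          add_mul, D.Rt_L_apply, D.L_mul, D.Rt_mul, D.mul_L, mul_assoc]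
        rw [← Module.End.mul_apply (D.Rt c.1) (D.Rt b.1), ← map_mul, mul_comm c.1, map_mul,
          Module.End.mul_apply]
        abel
    one_mul := fun a => by
      ext1 <;> simp
    mul_one := fun a => by
      ext1 <;> simp }

/-- The projection of `kH ⊕ J` onto `kH`; its kernel is the ideal `J`. -/
noncomputable def pr : D.Amb →+* MonoidAlgebra k H where
  toFun a := a.1
  map_one' := rfl
  map_mul' _ _ := rfl
  map_zero' := rfl
  map_add' _ _ := rfl

/-- The inclusion of `kH` into `kH ⊕ J`. -/
noncomputable def ofAlg : MonoidAlgebra k H →+* D.Amb where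
  toFun c := ⟨c, 0⟩
  map_one' := rfl
  map_mul' _ _ := by ext1 <;> simp
  map_zero' := rfl
  map_add' _ _ := by ext1 <;> simp

/-- The inclusion of `J` into `kH ⊕ J`. -/
noncomputable def ofJ : J →+ D.Amb where
  toFun x := ⟨0, x⟩
  map_zero' := rfl
  map_add' _ _ := by ext1 <;> simp

/-- The inclusion of `G = H + J` into the multiplicative monoid of `kH ⊕ J`. -/
noncomputable def ofG : D.G →* D.Amb where
  toFun g := ⟨MonoidAlgebra.of k H g.h, g.x⟩
  map_one' := rfl
  map_mul' a b := by
    ext1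
    · simp
    · simp [L, Rt]

/-- The extension by zero of a linear form on `J` to `kH ⊕ J`. -/
noncomputable def ev (lam : Module.Dual k J) : D.Amb →+ k where
  toFun a := lam a.2
  map_zero' := map_zero lam
  map_add' _ _ := map_add lam _ _

@[simp] theorem ofJ_fst (x : J) : (D.ofJ x).fst = 0 := rfl

@[simp] theorem ofJ_snd (x : J) : (D.ofJ x).snd = x := rfl

@[simp] theorem ofAlg_fst (c : MonoidAlgebra k H) : (D.ofAlg c).fst = c := rfl

@[simp] theorem ofAlg_snd (c : MonoidAlgebra k H) : (D.ofAlg c).snd = 0 := rfl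

@[simp] theorem ofG_fst (g : D.G) : (D.ofG g).fst = MonoidAlgebra.of k H g.h := rfl

@[simp] theorem ofG_snd (g : D.G) : (D.ofG g).snd = g.x := rfl

@[simp] theorem pr_ofJ (x : J) : D.pr (D.ofJ x) = 0 := rfl

@[simp] theorem pr_ofAlg (c : MonoidAlgebra k H) : D.pr (D.ofAlg c) = c := rfl

@[simp] theorem pr_ofG (g : D.G) : D.pr (D.ofG g) = MonoidAlgebra.of k H g.h := rfl

@[simp] theorem ev_ofJ (lam : Module.Dual k J) (x : J) : D.ev lam (D.ofJ x) = lam x := rfl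

@[simp] theorem ev_ofAlg (lam : Module.Dual k J) (c : MonoidAlgebra k H) :
    D.ev lam (D.ofAlg c) = 0 := map_zero lam

@[simp] theorem ev_ofG (lam : Module.Dual k J) (g : D.G) : D.ev lam (D.ofG g) = lam g.x := rfl

theorem ofG_injective : Function.Injective D.ofG := fun g g' h => by
  ext
  · exact MonoidAlgebra.of_injective (congrArg Amb.fst h)
  · exact congrArg Amb.snd h

theorem ofJ_injective : Function.Injective D.ofJ := fun _ _ h => congrArg Amb.snd h

theorem ofJ_mul (x y : J) : D.ofJ (x * y) = D.ofJ x * D.ofJ y := by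
  ext1 <;> simp

variable {D} in
theorem exists_ofJ {a : D.Amb} (ha : D.pr a = 0) : ∃ x, D.ofJ x = a :=
  ⟨a.2, by ext1; exacts [ha.symm, rfl]⟩

theorem ofG_eq (g : D.G) : D.ofG g = D.ofAlg (MonoidAlgebra.of k H g.h) + D.ofJ g.x := by
  ext1 <;> simp

theorem ofG_ofH (h : H) : D.ofG (D.ofH h) = D.ofAlg (MonoidAlgebra.of k H h) := rfl

theorem ofAlg_mul_ofJ (c : MonoidAlgebra k H) (x : J) :
    D.ofAlg c * D.ofJ x = D.ofJ (D.L c x) := by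
  ext1 <;> simp

theorem ofJ_mul_ofAlg (c : MonoidAlgebra k H) (x : J) :
    D.ofJ x * D.ofAlg c = D.ofJ (D.Rt c x) := by
  ext1 <;> simp

theorem ofJ_corner (e : MonoidAlgebra k H) (x : J) :
    D.ofJ (D.corner e x) = D.ofAlg e * D.ofJ x * D.ofAlg e := by
  rw [ofAlg_mul_ofJ, ofJ_mul_ofAlg]; rfl

theorem ofAlg_comm (c d : MonoidAlgebra k H) :
    D.ofAlg c * D.ofAlg d = D.ofAlg d * D.ofAlg c := by
  rw [← map_mul, mul_comm, map_mul]

@[simp] theorem ofG_mul_inv (g : D.G) : D.ofG g * D.ofG g⁻¹ = 1 := by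
  rw [← map_mul, mul_inv_cancel, map_one]

@[simp] theorem ofG_inv_mul (g : D.G) : D.ofG g⁻¹ * D.ofG g = 1 := by
  rw [← map_mul, inv_mul_cancel, map_one]

@[simp] theorem ofG_mul_inv_assoc (g : D.G) (a : D.Amb) : D.ofG g * (D.ofG g⁻¹ * a) = a := by
  rw [← mul_assoc, ofG_mul_inv, one_mul]

@[simp] theorem ofG_inv_mul_assoc (g : D.G) (a : D.Amb) : D.ofG g⁻¹ * (D.ofG g * a) = a := by
  rw [← mul_assoc, ofG_inv_mul, one_mul]

theorem inv_h (g : D.G) : g⁻¹.h = g.h⁻¹ := map_inv D.proj g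

theorem lact_eq (g : D.G) (x : J) : D.ofJ (D.lact g x) = D.ofG g * D.ofJ x := by
  rw [ofG_eq, add_mul, ofAlg_mul_ofJ, ← ofJ_mul, ← map_add, L_of]; rfl

theorem ract_eq (g : D.G) (x : J) : D.ofJ (D.ract g x) = D.ofJ x * D.ofG g := by
  rw [ofG_eq, mul_add, ofJ_mul_ofAlg, ← ofJ_mul, ← map_add, Rt_of]; rfl

/-! ### Triples as pairs of elements of `G` -/

/-- The homomorphism `(t, a, b) ↦ ta`. -/
noncomputable def pL : D.Gt →* D.G where
  toFun τ := D.ofH τ.t * τ.a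
  map_one' := by change D.ofH 1 * 1 = 1; simp
  map_mul' p q := by
    change D.ofH (p.t * q.t) * ((D.ofH q.t)⁻¹ * p.a * D.ofH q.t * q.a) = _
    rw [map_mul]; group

/-- The homomorphism `(t, a, b) ↦ tb`. -/
noncomputable def pR : D.Gt →* D.G where
  toFun τ := D.ofH τ.t * τ.b
  map_one' := by change D.ofH 1 * 1 = 1; simp
  map_mul' p q := by
    change D.ofH (p.t * q.t) * ((D.ofH q.t)⁻¹ * p.b * D.ofH q.t * q.b) = _
    rw [map_mul]; group

theorem pL_h (τ : D.Gt) : (D.pL τ).h = τ.t := by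
  have h : (τ.a : D.G).h = 1 := τ.a.2
  change τ.t * (τ.a : D.G).h = _
  rw [h, mul_one]

theorem pR_h (τ : D.Gt) : (D.pR τ).h = τ.t := by
  have h : (τ.b : D.G).h = 1 := τ.b.2
  change τ.t * (τ.b : D.G).h = _
  rw [h, mul_one]

variable {D} in
theorem Gt_ext {σ τ : D.Gt} (h₁ : D.pL σ = D.pL τ) (h₂ : D.pR σ = D.pR τ) : σ = τ := by
  have ht : σ.t = τ.t := by rw [← D.pL_h, h₁, D.pL_h]
  change D.ofH σ.t * σ.a = D.ofH τ.t * τ.a at h₁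
  change D.ofH σ.t * σ.b = D.ofH τ.t * τ.b at h₂
  rw [ht] at h₁ h₂
  exact Gt.ext ht (Subtype.ext (mul_left_cancel h₁)) (Subtype.ext (mul_left_cancel h₂))

/-- The triple `(t, a, b)` with `ta = p` and `tb = q`. -/
noncomputable def mkGt (p q : D.G) (h : p.h = q.h) : D.Gt where
  t := p.h
  a := ⟨(D.ofH p.h)⁻¹ * p, by
    change D.proj _ = 1
    rw [map_mul, map_inv]; exact inv_mul_cancel _⟩
  b := ⟨(D.ofH p.h)⁻¹ * q, by
    change D.proj _ = 1
    rw [map_mul, map_inv, h]; exact inv_mul_cancel _⟩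

@[simp] theorem pL_mkGt (p q : D.G) (h : p.h = q.h) : D.pL (D.mkGt p q h) = p :=
  mul_inv_cancel_left _ _

@[simp] theorem pR_mkGt (p q : D.G) (h : p.h = q.h) : D.pR (D.mkGt p q h) = q :=
  mul_inv_cancel_left _ _

theorem ofJ_rho (τ : D.Gt) (x : J) :
    D.ofJ (D.rho τ x) = D.ofG (D.pL τ) * D.ofJ x * D.ofG (D.pR τ)⁻¹ := by
  change D.ofJ (D.lact (D.pL τ) (D.ract ((τ.b : D.G)⁻¹ * (D.ofH τ.t)⁻¹) x)) = _
  rw [lact_eq, ract_eq, ← mul_inv_rev, mul_assoc]; rfl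

@[simp] theorem R_h (τ : D.Gt) (g : D.G) : (D.R τ g).h = g.h := rfl

theorem R_x (τ : D.Gt) (g : D.G) :
    (D.R τ g).x = (D.pL τ * g * (D.pR τ)⁻¹).x - (D.pL τ * (D.pR τ)⁻¹).x := by
  simp only [R, pL, pR, MonoidHom.coe_mk, OneHom.coe_mk, mul_inv_rev, mul_assoc]

theorem ofG_R (τ : D.Gt) (g : D.G) :
    D.ofG (D.R τ g) = 1 + D.ofG (D.pL τ) * (D.ofG g - 1) * D.ofG (D.pR τ)⁻¹ := by
  have h : D.ofG (D.pL τ) * (D.ofG g - 1) * D.ofG (D.pR τ)⁻¹ =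
      D.ofG (D.pL τ * g * (D.pR τ)⁻¹) - D.ofG (D.pL τ * (D.pR τ)⁻¹) := by
    simp only [map_mul, mul_sub, sub_mul, mul_one]
  rw [h]
  ext1
  · change MonoidAlgebra.of k H g.h = 1 + (MonoidAlgebra.of k H (_ * _) -
      MonoidAlgebra.of k H (_ * _))
    simp [pL_h, pR_h, inv_h, MonoidAlgebra.one_def]
  · change (D.R τ g).x = 0 + (_ - _)
    rw [zero_add, R_x]; rfl

theorem R_one (g : D.G) : D.R 1 g = g := D.ofG_injective <| by simp [ofG_R]

theorem R_mul (σ τ : D.Gt) (g : D.G) : D.R (σ * τ) g = D.R σ (D.R τ g) := D.ofG_injective <| by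
  simp only [ofG_R, map_mul, mul_inv_rev, add_sub_cancel_left, mul_assoc]

/-- `R_τ (h + x) = R_τ (h) + ρ_τ (x)`. -/
theorem R_x_eq (τ : D.Gt) (g : D.G) :
    (D.R τ g).x = D.rho τ g.x + (D.R τ (D.ofH g.h)).x := by
  have h : D.ofG (D.R τ g) = D.ofJ (D.rho τ g.x) + D.ofG (D.R τ (D.ofH g.h)) := by
    rw [ofG_R, ofG_R, ofJ_rho, D.ofG_eq g, ofG_ofH]; noncomm_ring
  exact congrArg Amb.snd h

end Ambient


section Forms

variable {k H J : Type*} [Field k] [CommGroup H] [NonUnitalRing J] [Module k J]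
  [IsScalarTower k J J] [SMulCommClass k J J] {D : TriangularType k H J}

/-! ### Linear forms supported on a Peirce component -/

theorem ev_comp_rho (lam : Module.Dual k J) (τ : D.Gt) {j : D.Amb} (hj : D.pr j = 0) :
    D.ev (lam ∘ₗ D.rho τ) j = D.ev lam (D.ofG (D.pL τ) * j * D.ofG (D.pR τ)⁻¹) := by
  obtain ⟨x, rfl⟩ := exists_ofJ hj
  rw [← ofJ_rho]; rfl

theorem ofAlg_idem {e : MonoidAlgebra k H} (he : IsIdempotentElem e) :
    D.ofAlg e * D.ofAlg e = D.ofAlg e := by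
  rw [← map_mul, he.eq]

theorem ev_corner {e : MonoidAlgebra k H} {lam : Module.Dual k J} (hlam : lam ∈ D.JeDual e)
    {j : D.Amb} (hj : D.pr j = 0) : D.ev lam (D.ofAlg e * j * D.ofAlg e) = D.ev lam j := by
  obtain ⟨x, rfl⟩ := exists_ofJ hj
  rw [← ofJ_corner]
  exact hlam x

theorem ev_ofAlg_mul {e : MonoidAlgebra k H} (he : IsIdempotentElem e) {lam : Module.Dual k J}
    (hlam : lam ∈ D.JeDual e) {j : D.Amb} (hj : D.pr j = 0) :
    D.ev lam (D.ofAlg e * j) = D.ev lam j := by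
  rw [← ev_corner hlam hj, ← ev_corner hlam (by simp [hj] : D.pr (D.ofAlg e * j) = 0),
    ← mul_assoc (D.ofAlg e), ofAlg_idem he]

theorem ev_mul_ofAlg {e : MonoidAlgebra k H} (he : IsIdempotentElem e) {lam : Module.Dual k J}
    (hlam : lam ∈ D.JeDual e) {j : D.Amb} (hj : D.pr j = 0) :
    D.ev lam (j * D.ofAlg e) = D.ev lam j := by
  rw [← ev_corner hlam hj, ← ev_corner hlam (by simp [hj] : D.pr (j * D.ofAlg e) = 0),
    mul_assoc, mul_assoc, ofAlg_idem he, mul_assoc]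

theorem mem_JeDual_of {e : MonoidAlgebra k H} {lam : Module.Dual k J}
    (hl : ∀ j, D.pr j = 0 → D.ev lam (D.ofAlg e * j) = D.ev lam j)
    (hr : ∀ j, D.pr j = 0 → D.ev lam (j * D.ofAlg e) = D.ev lam j) : lam ∈ D.JeDual e := by
  intro x
  rw [← D.ev_ofJ lam, ofJ_corner, hr _ (by simp), hl _ (by simp), ev_ofJ]

theorem ev_sub_one_mul {e : MonoidAlgebra k H} {lam : Module.Dual k J} (hlam : lam ∈ D.JeDual e)
    {h : H} (hh : h ∈ D.Hfix e) {j : D.Amb} (hj : D.pr j = 0) :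
    D.ev lam (D.ofAlg (MonoidAlgebra.of k H h - 1) * j) = 0 := by
  obtain ⟨x, rfl⟩ := exists_ofJ hj
  rw [map_sub, map_one, sub_mul, one_mul, ofAlg_mul_ofJ, L_of, map_sub, ev_ofJ, ev_ofJ,
    JeDual_l hlam hh, sub_self]

theorem ev_mul_sub_one {e : MonoidAlgebra k H} {lam : Module.Dual k J} (hlam : lam ∈ D.JeDual e)
    {h : H} (hh : h ∈ D.Hfix e) {j : D.Amb} (hj : D.pr j = 0) :
    D.ev lam (j * D.ofAlg (MonoidAlgebra.of k H h - 1)) = 0 := by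
  obtain ⟨x, rfl⟩ := exists_ofJ hj
  rw [map_sub, map_one, mul_sub, mul_one, ofJ_mul_ofAlg, Rt_of, map_sub, ev_ofJ, ev_ofJ,
    JeDual_r hlam hh, sub_self]

theorem ev_R_ofH (lam : Module.Dual k J) (τ : D.Gt) (h : H) :
    lam (D.R τ (D.ofH h)).x = D.ev lam
      (D.ofG (D.pL τ) * D.ofAlg (MonoidAlgebra.of k H h - 1) * D.ofG (D.pR τ)⁻¹) := by
  rw [← ev_ofG, ofG_R, ofG_ofH, map_add, map_sub D.ofAlg, map_one D.ofAlg]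
  rw [show D.ev lam 1 = 0 from map_zero lam, zero_add]

/-- If `λ` and `λ' = λ ∘ ρ_τ` both lie in `J_e*`, then `λ` vanishes on the translation part
`R_τ(h) - h` of `R_τ` on `h + J`, for every `h ∈ H(e)`.  This makes the phases in the orbit sums
of supercharacters trivial. -/
theorem apply_R_ofH_eq_zero {e : MonoidAlgebra k H} {lam : Module.Dual k J} {τ : D.Gt}
    (hlam : lam ∈ D.JeDual e) (hlam' : lam ∘ₗ D.rho τ ∈ D.JeDual e) {h : H}
    (hh : h ∈ D.Hfix e) : lam (D.R τ (D.ofH h)).x = 0 := by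
  rw [ev_R_ofH]
  have key (j : D.Amb) (hj : D.pr j = 0) : D.ev lam j =
      D.ev (lam ∘ₗ D.rho τ) (D.ofG (D.pL τ)⁻¹ * j * D.ofG (D.pR τ)) := by
    rw [ev_comp_rho _ _ (by simp [hj])]
    simp [mul_assoc]
  have hl := fun j (hj : D.pr j = 0) => ev_sub_one_mul hlam' hh hj
  have hr := fun j (hj : D.pr j = 0) => ev_mul_sub_one hlam' hh hj
  have hl0 := fun j (hj : D.pr j = 0) => ev_sub_one_mul hlam hh hj
  set c := MonoidAlgebra.of k H h - 1
  set mu := lam ∘ₗ D.rho τ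
  clear_value c
  obtain ⟨s, u, hP⟩ : ∃ s u, D.ofG (D.pL τ)⁻¹ = D.ofAlg s + D.ofJ u := ⟨_, _, D.ofG_eq _⟩
  obtain ⟨t, v, hq⟩ : ∃ t v, D.ofG (D.pR τ) = D.ofAlg t + D.ofJ v := ⟨_, _, D.ofG_eq _⟩
  -- the component of the mixed term `u c v` vanishes
  have huv : D.ev mu (D.ofJ u * D.ofAlg c * D.ofJ v) = 0 := by
    have h0 := hl0 (D.ofJ v * D.ofG (D.pR τ)⁻¹) (by simp)
    rw [key _ (by simp)] at h0
    simp only [mul_assoc, ofG_inv_mul, mul_one] at h0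
    rw [hP, add_mul, map_add, ← mul_assoc (D.ofAlg s), ofAlg_comm, mul_assoc, hl _ (by simp),
      zero_add] at h0
    rw [mul_assoc, h0]
  have hd : D.ofG (D.pL τ) * D.ofAlg c * D.ofG (D.pR τ)⁻¹ =
      (D.ofG (D.pL τ) * D.ofAlg c * D.ofG (D.pR τ)⁻¹ - D.ofAlg c) + D.ofAlg c := by abel
  have hpr : D.pr (D.ofG (D.pL τ) * D.ofAlg c * D.ofG (D.pR τ)⁻¹ - D.ofAlg c) = 0 := by
    have hu : MonoidAlgebra.of k H (D.pL τ).h * MonoidAlgebra.of k H (D.pR τ)⁻¹.h = 1 := by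
      rw [← map_mul, pL_h, inv_h, pR_h, mul_inv_cancel, map_one]
    simp only [map_sub, map_mul, pr_ofG, pr_ofAlg]
    rw [mul_right_comm, hu, one_mul, sub_self]
  rw [hd, map_add, ev_ofAlg, add_zero, key _ hpr]
  have : D.ofG (D.pL τ)⁻¹ * (D.ofG (D.pL τ) * D.ofAlg c * D.ofG (D.pR τ)⁻¹ - D.ofAlg c) *
      D.ofG (D.pR τ) = D.ofAlg (c - s * c * t) - (D.ofAlg c * (D.ofAlg s * D.ofJ v) +
        (D.ofJ u * D.ofAlg t) * D.ofAlg c + D.ofJ u * D.ofAlg c * D.ofJ v) := by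
    rw [mul_sub, sub_mul]
    simp only [mul_assoc, ofG_inv_mul, ofG_inv_mul_assoc, mul_one]
    rw [hP, hq, ← mul_assoc (D.ofAlg c) (D.ofAlg s), D.ofAlg_comm c s, D.ofAlg_comm t c, map_sub,
      map_mul, map_mul]
    noncomm_ring
  rw [this, map_sub, map_add, map_add, ev_ofAlg, hl _ (by simp), hr _ (by simp), huv]
  simp

/-! ### Triples of a Peirce corner -/

theorem mem_Je_iff {e : MonoidAlgebra k H} (he : IsIdempotentElem e) {x : J} :
    x ∈ D.Je e ↔ D.ofAlg e * D.ofJ x = D.ofJ x ∧ D.ofJ x * D.ofAlg e = D.ofJ x := by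
  constructor
  · rintro ⟨y, rfl⟩
    rw [ofJ_corner]
    refine ⟨?_, ?_⟩
    · rw [← mul_assoc, ← mul_assoc, ofAlg_idem he]
    · rw [mul_assoc, ofAlg_idem he]
  · rintro ⟨h₁, h₂⟩
    exact ⟨x, D.ofJ_injective (by rw [ofJ_corner, h₁, h₂])⟩

/-- The subgroup `1 + J_e` of `N`. -/
noncomputable def cornerN (D : TriangularType k H J) {e : MonoidAlgebra k H}
    (he : IsIdempotentElem e) : Subgroup D.G where
  carrier := {g | g.h = 1 ∧ g.x ∈ D.Je e}
  one_mem' := ⟨rfl, zero_mem _⟩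
  mul_mem' {a b} ha hb := by
    refine ⟨by simp [ha.1, hb.1], ?_⟩
    have h₁ := (mem_Je_iff he).1 ha.2
    have h₂ := (mem_Je_iff he).1 hb.2
    rw [mul_x, ha.1, hb.1, map_one, map_one]
    refine add_mem (add_mem hb.2 ha.2) ((mem_Je_iff he).2 ⟨?_, ?_⟩)
    · rw [ofJ_mul, ← mul_assoc, h₁.1]
    · rw [ofJ_mul, mul_assoc, h₂.2]
  inv_mem' {g} hg := by
    have hh : g⁻¹.h = 1 := by rw [inv_h, hg.1, inv_one]
    refine ⟨hh, ?_⟩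
    obtain ⟨h₁, h₂⟩ := (mem_Je_iff he).1 hg.2
    have hg' : D.ofG g = 1 + D.ofJ g.x := by rw [ofG_eq, hg.1, map_one, map_one]
    have hi : D.ofG g⁻¹ = 1 + D.ofJ g⁻¹.x := by rw [ofG_eq, hh, map_one, map_one]
    have e₁ := D.ofG_inv_mul g
    have e₂ := D.ofG_mul_inv g
    rw [hg', hi] at e₁ e₂
    set y := D.ofJ g.x
    set y' := D.ofJ g⁻¹.x
    have e₁' : y' = -(y + y' * y) := by
      rw [← sub_eq_zero, ← sub_eq_zero.2 e₁]; noncomm_ring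
    have e₂' : y' = -(y + y * y') := by
      rw [← sub_eq_zero, ← sub_eq_zero.2 e₂]; noncomm_ring
    refine (mem_Je_iff he).2 ⟨?_, ?_⟩
    · change D.ofAlg e * y' = y'
      rw [e₂', mul_neg, mul_add, ← mul_assoc, h₁]
    · change y' * D.ofAlg e = y'
      rw [e₁', neg_mul, add_mul, mul_assoc, h₂]

theorem mem_GtCorner_iff {e : MonoidAlgebra k H} (he : IsIdempotentElem e) {τ : D.Gt} :
    τ ∈ D.GtCorner e ↔ (τ.a : D.G) ∈ D.cornerN he ∧ (τ.b : D.G) ∈ D.cornerN he :=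
  ⟨fun h => ⟨⟨τ.a.2, h.1⟩, ⟨τ.b.2, h.2⟩⟩, fun h => ⟨h.1.2, h.2.2⟩⟩

theorem conj_mem_cornerN {e : MonoidAlgebra k H} (he : IsIdempotentElem e) (t : H) {g : D.G}
    (hg : g ∈ D.cornerN he) : (D.ofH t)⁻¹ * g * D.ofH t ∈ D.cornerN he := by
  obtain ⟨h₁, h₂⟩ := (mem_Je_iff he).1 hg.2
  rw [← map_inv]
  refine ⟨by simp [ofH, hg.1], (mem_Je_iff he).2 ?_⟩
  have : D.ofJ (D.ofH t⁻¹ * g * D.ofH t).x =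
      D.ofAlg (MonoidAlgebra.of k H t⁻¹) * D.ofJ g.x * D.ofAlg (MonoidAlgebra.of k H t) := by
    rw [ofAlg_mul_ofJ, ofJ_mul_ofAlg, L_of, Rt_of]
    simp [ofH]
  rw [this]
  constructor
  · rw [← mul_assoc, ← mul_assoc, ofAlg_comm, mul_assoc _ (D.ofAlg e), h₁]
  · rw [mul_assoc, D.ofAlg_comm _ e, ← mul_assoc, mul_assoc _ (D.ofJ g.x), h₂]

theorem GtCorner_mul {e : MonoidAlgebra k H} (he : IsIdempotentElem e) {σ τ : D.Gt}
    (hσ : σ ∈ D.GtCorner e) (hτ : τ ∈ D.GtCorner e) : σ * τ ∈ D.GtCorner e := by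
  rw [mem_GtCorner_iff he] at *
  exact ⟨mul_mem (conj_mem_cornerN he _ hσ.1) hτ.1, mul_mem (conj_mem_cornerN he _ hσ.2) hτ.2⟩

theorem GtCorner_inv {e : MonoidAlgebra k H} (he : IsIdempotentElem e) {τ : D.Gt}
    (hτ : τ ∈ D.GtCorner e) : τ⁻¹ ∈ D.GtCorner e := by
  rw [mem_GtCorner_iff he] at *
  exact ⟨conj_mem_cornerN he _ (inv_mem hτ.1), conj_mem_cornerN he _ (inv_mem hτ.2)⟩

theorem one_mem_GtCorner (e : MonoidAlgebra k H) : (1 : D.Gt) ∈ D.GtCorner e :=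
  ⟨zero_mem _, zero_mem _⟩

/-- If `λ ∈ J_e*` and, for an idempotent `f` of `e(kH)`, right and left multiplication by `e - f`
agree under `λ` with multiplication by elements of `J`, then the orbit of `λ` meets `J_f*`. -/
theorem exists_comp_rho_mem_JeDual {e f : MonoidAlgebra k H} (he : IsIdempotentElem e)
    (hf : IsIdempotentElem f) (hef : e * f = f) {lam : Module.Dual k J} (hlam : lam ∈ D.JeDual e)
    {z z' : D.Amb} (hz0 : D.pr z = 0) (hz0' : D.pr z' = 0)
    (hz : ∀ j, D.pr j = 0 → D.ev lam (j * D.ofAlg (e - f)) = D.ev lam (j * z))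
    (hz' : ∀ j, D.pr j = 0 → D.ev lam (D.ofAlg (e - f) * j) = D.ev lam (z' * j)) :
    ∃ σ ∈ D.GtCorner e, lam ∘ₗ D.rho σ ∈ D.JeDual f := by
  have hd : IsIdempotentElem (e - f) := by
    change (e - f) * (e - f) = e - f
    rw [mul_sub, sub_mul, sub_mul, he.eq, hef, mul_comm f e, hef, hf.eq]; ring
  have hed : e * (e - f) = e - f := by rw [mul_sub, he.eq, hef]
  have hfd : f * (e - f) = 0 := by rw [mul_sub, mul_comm f e, hef, hf.eq, sub_self]
  have E1 : D.ofAlg e * D.ofAlg e = D.ofAlg e := ofAlg_idem he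
  have E2 : D.ofAlg (e - f) * D.ofAlg (e - f) = D.ofAlg (e - f) := ofAlg_idem hd
  have E3 : D.ofAlg e * D.ofAlg (e - f) = D.ofAlg (e - f) := by rw [← map_mul, hed]
  have E4 : D.ofAlg (e - f) * D.ofAlg e = D.ofAlg (e - f) := by rw [ofAlg_comm, E3]
  have E5 : D.ofAlg f = D.ofAlg e - D.ofAlg (e - f) := by rw [← map_sub]; congr 1; ring
  have hle := fun j (hj : D.pr j = 0) => ev_ofAlg_mul he hlam hj
  have hre := fun j (hj : D.pr j = 0) => ev_mul_ofAlg he hlam hj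
  set d := D.ofAlg (e - f)
  set E := D.ofAlg e
  obtain ⟨w, hw⟩ := exists_ofJ (show D.pr (d * z * E) = 0 by simp [hz0])
  obtain ⟨w', hw'⟩ := exists_ofJ (show D.pr (E * z' * d) = 0 by simp [hz0'])
  have hwe : (⟨1, -w⟩ : D.G) ∈ D.cornerN he := by
    refine ⟨rfl, neg_mem ((mem_Je_iff he).2 ?_)⟩
    change E * _ = _ ∧ _ * E = _
    rw [hw, mul_assoc _ E E, E1, ← mul_assoc, ← mul_assoc, E3]; exact ⟨rfl, rfl⟩
  have hwe' : (⟨1, -w'⟩ : D.G) ∈ D.cornerN he := by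
    refine ⟨rfl, neg_mem ((mem_Je_iff he).2 ?_)⟩
    change E * _ = _ ∧ _ * E = _
    rw [hw', mul_assoc _ d E, E4, ← mul_assoc, ← mul_assoc, E1]; exact ⟨rfl, rfl⟩
  refine ⟨⟨1, ⟨⟨1, -w'⟩, rfl⟩, ⟨⟨1, -w⟩⁻¹, (inv_mem hwe).1⟩⟩,
    (mem_GtCorner_iff he).2 ⟨hwe', inv_mem hwe⟩, ?_⟩
  set σ : D.Gt := ⟨1, ⟨⟨1, -w'⟩, rfl⟩, ⟨⟨1, -w⟩⁻¹, (inv_mem hwe).1⟩⟩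
  have hL : D.ofG (D.pL σ) = 1 - D.ofJ w' := by
    have : D.pL σ = ⟨1, -w'⟩ := by change D.ofH 1 * _ = _; simp [σ]
    rw [this, ofG_eq, map_one, map_one, map_neg, sub_eq_add_neg]
  have hR : D.ofG (D.pR σ)⁻¹ = 1 - D.ofJ w := by
    have : (D.pR σ)⁻¹ = ⟨1, -w⟩ := by change (D.ofH 1 * _)⁻¹ = _; simp [σ]
    rw [this, ofG_eq, map_one, map_one, map_neg, sub_eq_add_neg]
  -- `λ(j z)` only depends on the corner part of `z`
  have hwr (j : D.Amb) (hj : D.pr j = 0) : D.ev lam (j * d) = D.ev lam (j * D.ofJ w) := by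
    have h1 := hz (j * d) (by simp [hj])
    rw [mul_assoc, E2] at h1
    rw [h1, hw, ← mul_assoc, hre _ (by simp [hj]), ← mul_assoc]
  have hwl (j : D.Amb) (hj : D.pr j = 0) : D.ev lam (d * j) = D.ev lam (D.ofJ w' * j) := by
    have h1 := hz' (d * j) (by simp [hj])
    rw [← mul_assoc, E2] at h1
    rw [h1, hw', mul_assoc, mul_assoc, hle _ (by simp [hj])]
  have hwd : (d * D.ofJ w) = D.ofJ w := by rw [hw, ← mul_assoc, ← mul_assoc, E2]
  have hwE : (D.ofJ w * E) = D.ofJ w := by rw [hw, mul_assoc, E1]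
  have hwd' : (D.ofJ w' * d) = D.ofJ w' := by rw [hw', mul_assoc, E2]
  have hwE' : (E * D.ofJ w') = D.ofJ w' := by rw [hw', ← mul_assoc, ← mul_assoc, E1]
  have hzr (j : D.Amb) (hj : D.pr j = 0) : D.ev (lam ∘ₗ D.rho σ) (j * d) = 0 := by
    rw [ev_comp_rho _ _ (by simp [hj]), hL, hR, mul_assoc, mul_assoc, mul_sub d, mul_one, hwd,
      ← mul_assoc, mul_sub, map_sub, hwr _ (by simp [hj]), sub_self]
  have hzl (j : D.Amb) (hj : D.pr j = 0) : D.ev (lam ∘ₗ D.rho σ) (d * j) = 0 := by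
    rw [ev_comp_rho _ _ (by simp [hj]), hL, hR, ← mul_assoc, sub_mul 1 _ d, one_mul, hwd',
      mul_assoc, sub_mul, map_sub, hwl _ (by simp [hj]), sub_self]
  refine mem_JeDual_of (fun j hj => ?_) fun j hj => ?_
  · rw [E5, sub_mul, map_sub, hzl _ hj, sub_zero, ev_comp_rho _ _ (by simp [hj]),
      ev_comp_rho _ _ hj, hL, hR]
    have h1 : (1 - D.ofJ w') * (E * j) * (1 - D.ofJ w) = E * (j * (1 - D.ofJ w)) -
      D.ofJ w' * (E * j) * (1 - D.ofJ w) := by noncomm_ring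
    have h2 : (1 - D.ofJ w') * j * (1 - D.ofJ w) = j * (1 - D.ofJ w) -
      D.ofJ w' * j * (1 - D.ofJ w) := by noncomm_ring
    have h3 : D.ofJ w' * E = D.ofJ w' := by rw [← hwd', mul_assoc, E4]
    rw [h1, h2, map_sub, map_sub, hle _ (by simp [hj]), ← mul_assoc (D.ofJ w'), h3]
  · rw [E5, mul_sub, map_sub, hzr _ hj, sub_zero, ev_comp_rho _ _ (by simp [hj]),
      ev_comp_rho _ _ hj, hL, hR]
    have h1 : (1 - D.ofJ w') * (j * E) * (1 - D.ofJ w) = (1 - D.ofJ w') * j * E -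
      (1 - D.ofJ w') * j * (E * D.ofJ w) := by noncomm_ring
    have h2 : (1 - D.ofJ w') * j * (1 - D.ofJ w) = (1 - D.ofJ w') * j -
      (1 - D.ofJ w') * j * D.ofJ w := by noncomm_ring
    have h3 : E * D.ofJ w = D.ofJ w := by rw [← hwd, ← mul_assoc, E3]
    rw [h1, h2, map_sub, map_sub, hre _ (by simp [hj]), h3]

end Forms


/-- A linear form vanishing on the left kernel of a bilinear form `B` is of the form `B · z`. -/
theorem exists_eq_flip_of_vanish {k V : Type*} [Field k] [AddCommGroup V] [Module k V]
    [FiniteDimensional k V] (B : V →ₗ[k] V →ₗ[k] k) (φ : Module.Dual k V)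
    (h : ∀ u, (∀ x, B u x = 0) → φ u = 0) : ∃ z, ∀ u, φ u = B u z := by
  have h1 : φ ∈ (LinearMap.ker B).dualAnnihilator := by
    rw [Submodule.mem_dualAnnihilator]
    intro u hu
    exact h u fun x => by rw [LinearMap.mem_ker.1 hu]; rfl
  rw [← LinearMap.range_dualMap_eq_dualAnnihilator_ker] at h1
  obtain ⟨ψ, rfl⟩ := h1
  refine ⟨(Module.evalEquiv k V).symm ψ, fun u => ?_⟩
  rw [LinearMap.dualMap_apply, ← Module.apply_evalEquiv_symm_apply]

section Regular

variable {k H J : Type*} [Field k] [CommGroup H] [NonUnitalRing J] [Module k J]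
  [IsScalarTower k J J] [SMulCommClass k J J] {D : TriangularType k H J}

/-! ### Regular linear forms -/

/-- `λ ∈ J_e*` and its orbit under the triples of `G_e` is regular. -/
def RegularAt (D : TriangularType k H J) (e : MonoidAlgebra k H) (lam : Module.Dual k J) : Prop :=
  lam ∈ D.JeDual e ∧ ∀ f, IsIdempotentElem f → e * f = f →
    ∀ σ ∈ D.GtCorner e, lam ∘ₗ D.rho σ ∈ D.JeDual f → f = e

theorem card_ne_zero (D : TriangularType k H J) : (Nat.card H : k) ≠ 0 := fun h =>
  D.char_not_dvd ((ringChar.spec k _).1 h)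

/-- For `h ∈ H`, an idempotent `e` splits as `f + (e - f)`, where `h` fixes `f` and `h - 1` is
invertible on `e - f`; the idempotent `f` is `e` times the average of the powers of `h`. -/
theorem exists_idempotent_split [Finite H] (D : TriangularType k H J) {e : MonoidAlgebra k H}
    (he : IsIdempotentElem e) (h : H) : ∃ f w : MonoidAlgebra k H, IsIdempotentElem f ∧
      e * f = f ∧ MonoidAlgebra.of k H h * f = f ∧ e - f = w * (MonoidAlgebra.of k H h - 1) := by
  set T := MonoidAlgebra.of k H h
  set n := Nat.card H
  have hn : (n : k) ≠ 0 := D.card_ne_zero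
  have hT : T ^ n = 1 := by rw [← map_pow, pow_card_eq_one', map_one]
  set S := ∑ i ∈ Finset.range n, T ^ i
  have hTS : T * S = S := by
    have h1 : (T - 1) * S = 0 := by rw [mul_geom_sum, hT, sub_self]
    rwa [sub_mul, one_mul, sub_eq_zero] at h1
  have hTiS (i : ℕ) : T ^ i * S = S := by
    induction i with
    | zero => simp
    | succ i ih => rw [pow_succ', mul_assoc, ih, hTS]
  have hSS : S * S = (n : k) • S := by
    conv_lhs => rw [show S = ∑ i ∈ Finset.range n, T ^ i from rfl, Finset.sum_mul]
    rw [Finset.sum_congr rfl fun i _ => hTiS i, Finset.sum_const, Finset.card_range,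
      Nat.cast_smul_eq_nsmul]
  set E := (n : k)⁻¹ • S
  have hTE : T * E = E := by rw [mul_smul_comm, hTS]
  have hEE : E * E = E := by
    rw [smul_mul_smul_comm, hSS, smul_smul, mul_assoc, inv_mul_cancel₀ hn, mul_one]
  obtain ⟨w, hw⟩ : T - 1 ∣ 1 - E := by
    have h1 : 1 - E = (n : k)⁻¹ • ∑ i ∈ Finset.range n, (1 - T ^ i) := by
      rw [Finset.sum_sub_distrib, smul_sub, Finset.sum_const, Finset.card_range,
        ← Nat.cast_smul_eq_nsmul k, smul_smul, inv_mul_cancel₀ hn, one_smul]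
    rw [h1]
    refine dvd_smul_of_dvd _ (Finset.dvd_sum fun i _ => ?_)
    rw [← dvd_neg, neg_sub]
    simpa using sub_dvd_pow_sub_pow T 1 i
  refine ⟨e * E, e * w, ?_, ?_, ?_, ?_⟩
  · change e * E * (e * E) = e * E
    rw [mul_mul_mul_comm, he.eq, hEE]
  · rw [← mul_assoc, he.eq]
  · rw [mul_left_comm, hTE]
  · rw [mul_assoc, mul_comm w, ← hw, mul_sub, mul_one]

/-- For a regular form, no proper part `e - f` of `e` can be absorbed into `J` on both sides. -/
theorem RegularAt.eq_of_absorb {e f : MonoidAlgebra k H} (he : IsIdempotentElem e)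
    {lam : Module.Dual k J} (hreg : D.RegularAt e lam) (hf : IsIdempotentElem f) (hef : e * f = f)
    {z z' : D.Amb} (hz0 : D.pr z = 0) (hz0' : D.pr z' = 0)
    (hz : ∀ j, D.pr j = 0 → D.ev lam (j * D.ofAlg (e - f)) = D.ev lam (j * z))
    (hz' : ∀ j, D.pr j = 0 → D.ev lam (D.ofAlg (e - f) * j) = D.ev lam (z' * j)) : f = e := by
  obtain ⟨σ, hσ, h⟩ := exists_comp_rho_mem_JeDual he hf hef hreg.1 hz0 hz0' hz hz'
  exact hreg.2 f hf hef σ hσ h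

/-- An element `h` whose two actions fix `λ` on the left and right kernels of the form
`(x, y) ↦ λ(xy)` lies in `H(e)` when the orbit of `λ` is regular. -/
theorem RegularAt.mem_Hfix [Finite H] [Finite J] {e : MonoidAlgebra k H}
    (he : IsIdempotentElem e) {lam : Module.Dual k J} (hreg : D.RegularAt e lam) {h : H}
    (hr : ∀ u, (∀ x, lam (u * x) = 0) → lam (D.r h u) = lam u)
    (hl : ∀ u, (∀ x, lam (x * u) = 0) → lam (D.l h u) = lam u) : h ∈ D.Hfix e := by
  have : Module.Finite k J := Module.Finite.of_finite
  obtain ⟨f, w, hf, hef, hhf, hw⟩ := D.exists_idempotent_split he h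
  obtain ⟨z, hz⟩ := exists_eq_flip_of_vanish ((LinearMap.mul k J).compr₂ lam)
    (lam ∘ₗ D.Rt (e - f)) (fun u hu => by
      have hu' : ∀ x, lam (D.Rt w u * x) = 0 := fun x => by rw [← D.mul_L]; exact hu _
      rw [hw, mul_comm, map_mul, LinearMap.comp_apply, Module.End.mul_apply, map_sub, map_one,
        LinearMap.sub_apply, map_sub, Rt_of, hr _ hu']
      exact sub_self _)
  obtain ⟨z', hz'⟩ := exists_eq_flip_of_vanish ((LinearMap.mul k J).compr₂ lam).flip
    (lam ∘ₗ D.L (e - f)) (fun u hu => by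
      have hu' : ∀ x, lam (x * D.L w u) = 0 := fun x => by rw [D.mul_L]; exact hu _
      rw [hw, mul_comm, map_mul, LinearMap.comp_apply, Module.End.mul_apply, map_sub, map_one,
        LinearMap.sub_apply, map_sub, L_of, hl _ hu']
      exact sub_self _)
  have hfe : f = e := hreg.eq_of_absorb he hf hef (D.pr_ofJ z) (D.pr_ofJ z')
    (fun j hj => by
      obtain ⟨x, rfl⟩ := exists_ofJ hj
      rw [ofJ_mul_ofAlg, ← ofJ_mul]; exact hz x)
    (fun j hj => by
      obtain ⟨x, rfl⟩ := exists_ofJ hj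
      rw [ofAlg_mul_ofJ, ← ofJ_mul]; exact hz' x)
  rw [hfe] at hhf
  exact hhf

/-- If `λ` is invariant under left multiplication by `g` and right multiplication by `g'`, where
`g` and `g'` have the same component `h ∈ H`, then `h ∈ H(e)`. -/
theorem RegularAt.mem_Hfix_of_invariant [Finite H] [Finite J] {e : MonoidAlgebra k H}
    (he : IsIdempotentElem e) {lam : Module.Dual k J} (hreg : D.RegularAt e lam) {g g' : D.G}
    (hgg : g.h = g'.h) (hl : ∀ x, lam (D.lact g x) = lam x)
    (hr : ∀ x, lam (D.ract g' x) = lam x) : g.h ∈ D.Hfix e := by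
  refine hreg.mem_Hfix he (fun u hu => ?_) fun u hu => ?_
  · rw [hgg, ← hr u]
    simp [ract, hu]
  · rw [← hl u]
    simp [lact, hu]

/-- If a regular form of `J_e*` is moved into `J_f*` by any triple, then `ef = e`: on the
complement `e - ef` the defining property of `J_f*` turns multiplication by `e - ef` into
multiplication by elements of `J`. -/
theorem RegularAt.mul_eq_left {e f : MonoidAlgebra k H} (he : IsIdempotentElem e)
    (hf : IsIdempotentElem f) {lam : Module.Dual k J} (hreg : D.RegularAt e lam) {τ : D.Gt}
    (hmu : lam ∘ₗ D.rho τ ∈ D.JeDual f) : e * f = e := by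
  have hQ : (D.pR τ)⁻¹.h = (D.pL τ).h⁻¹ := by rw [inv_h, pR_h, pL_h]
  obtain ⟨u, hP⟩ : ∃ u, D.ofG (D.pL τ) = D.ofAlg (MonoidAlgebra.of k H (D.pL τ).h) + D.ofJ u :=
    ⟨_, D.ofG_eq _⟩
  obtain ⟨v, hq⟩ : ∃ v, D.ofG (D.pR τ)⁻¹ =
      D.ofAlg (MonoidAlgebra.of k H (D.pL τ).h⁻¹) + D.ofJ v := ⟨_, hQ ▸ D.ofG_eq _⟩
  have hts : D.ofAlg (MonoidAlgebra.of k H (D.pL τ).h) *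
      D.ofAlg (MonoidAlgebra.of k H (D.pL τ).h⁻¹) = 1 := by
    rw [← map_mul, ← map_mul, mul_inv_cancel, map_one, map_one]
  set t := MonoidAlgebra.of k H (D.pL τ).h
  set s := MonoidAlgebra.of k H (D.pL τ).h⁻¹
  have hd : e - e * f = e * (1 - f) := by ring
  refine hreg.eq_of_absorb he (f := e * f)
    (z := D.ofAlg (e * t * (f - 1)) * D.ofJ v) (z' := D.ofJ u * D.ofAlg ((f - 1) * s * e))
    ?_ ?_ (by simp) (by simp) ?_ ?_
  · change e * f * (e * f) = e * f
    rw [mul_mul_mul_comm, he.eq, hf.eq]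
  · rw [← mul_assoc, he.eq]
  · intro j hj
    have h1 := ev_mul_ofAlg hf hmu (j := D.ofG (D.pL τ)⁻¹ * (j * D.ofAlg (e * t))) (by simp [hj])
    rw [ev_comp_rho _ _ (by simp [hj]), ev_comp_rho _ _ (by simp [hj])] at h1
    simp only [mul_assoc, ofG_mul_inv_assoc] at h1
    rw [hq, ← sub_eq_zero, ← map_sub] at h1
    rw [← sub_eq_zero, ← map_sub, ← neg_eq_zero, ← map_neg, ← h1]
    congr 1
    have h2 : D.ofAlg (e * t) * (D.ofAlg f * D.ofAlg s) = D.ofAlg (e * f) := by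
      rw [D.ofAlg_comm f s, ← mul_assoc, map_mul, mul_assoc (D.ofAlg e), hts, mul_one, ← map_mul]
    have h3 : D.ofAlg (e * t) * D.ofAlg s = D.ofAlg e := by
      rw [map_mul, mul_assoc (D.ofAlg e), hts, mul_one]
    rw [mul_add, mul_add, mul_add, mul_add, h2, h3, map_sub, map_mul D.ofAlg (e * t), map_sub,
      map_one]
    noncomm_ring
  · intro j hj
    have h1 := ev_ofAlg_mul hf hmu (j := D.ofAlg (s * e) * j * D.ofG (D.pR τ)) (by simp [hj])
    rw [ev_comp_rho _ _ (by simp [hj]), ev_comp_rho _ _ (by simp [hj])] at h1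
    simp only [mul_assoc, ofG_mul_inv, mul_one] at h1
    rw [hP, ← sub_eq_zero, ← map_sub] at h1
    rw [← sub_eq_zero, ← map_sub, ← neg_eq_zero, ← map_neg, ← h1]
    congr 1
    have h2 : D.ofAlg t * (D.ofAlg f * (D.ofAlg (s * e) * j)) = D.ofAlg (e * f) * j := by
      rw [← mul_assoc (D.ofAlg f), ← map_mul, ← mul_assoc (D.ofAlg t), ← map_mul,
        show t * (f * (s * e)) = t * s * (e * f) by ring, map_mul D.ofAlg (t * s),
        map_mul D.ofAlg t, hts, one_mul]
    have h3 : D.ofAlg t * (D.ofAlg (s * e) * j) = D.ofAlg e * j := by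
      rw [← mul_assoc, map_mul, ← mul_assoc, hts, one_mul]
    rw [add_mul, add_mul, h2, h3, map_sub, mul_assoc (f - 1), map_mul D.ofAlg (f - 1), map_sub,
      map_one]
    noncomm_ring

/-- The idempotent of a regular form is determined by its orbit under the full group of triples. -/
theorem RegularAt.idempotent_unique {e f : MonoidAlgebra k H} (he : IsIdempotentElem e)
    (hf : IsIdempotentElem f) {lam : Module.Dual k J} {τ : D.Gt} (hreg : D.RegularAt e lam)
    (hreg' : D.RegularAt f (lam ∘ₗ D.rho τ)) : e = f := by
  have h1 := hreg.mul_eq_left he hf hreg'.1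
  have h2 : (lam ∘ₗ D.rho τ) ∘ₗ D.rho τ⁻¹ = lam := by
    rw [LinearMap.comp_assoc, ← Module.End.mul_eq_comp, ← map_mul, mul_inv_cancel, map_one]; rfl
  have h3 := hreg'.mul_eq_left (τ := τ⁻¹) hf he (by rw [h2]; exact hreg.1)
  rw [← h1, mul_comm, h3]

theorem exists_corner_mem_cornerN {e : MonoidAlgebra k H} (he : IsIdempotentElem e) {u : D.Amb}
    (hu : D.pr u = 0) :
    ∃ w, D.ofJ w = D.ofAlg e * u * D.ofAlg e ∧ (⟨1, w⟩ : D.G) ∈ D.cornerN he := by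
  have E1 : D.ofAlg e * D.ofAlg e = D.ofAlg e := ofAlg_idem he
  obtain ⟨w, hw⟩ := exists_ofJ (show D.pr (D.ofAlg e * u * D.ofAlg e) = 0 by simp [hu])
  refine ⟨w, hw, rfl, (mem_Je_iff he).2 ?_⟩
  change _ * D.ofJ w = D.ofJ w ∧ _
  rw [hw, mul_assoc _ (D.ofAlg e) (D.ofAlg e), E1, ← mul_assoc, ← mul_assoc, E1]
  exact ⟨rfl, rfl⟩

theorem corner_compress_left {R : Type*} [Ring R] {E T : R} (hE : E * E = E)
    (hT : E * T = T * E) (a : R) : E * (T * (1 + a)) * E = E * (T * (1 + E * a * E)) := by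
  have h (b : R) : E * (T * b) = T * E * b := by rw [← mul_assoc, hT]
  rw [h, h, mul_assoc, mul_assoc T E ((1 + a) * E), mul_assoc T E (1 + E * a * E)]
  congr 1
  simp only [mul_add, add_mul, mul_one, one_mul, mul_assoc, hE]
  rw [← mul_assoc E E, hE]

theorem corner_compress_right {R : Type*} [Ring R] {E S : R} (hE : E * E = E)
    (hS : E * S = S * E) (b : R) : E * ((1 + b) * S) * E = (1 + E * b * E) * S * E := by
  rw [← mul_assoc, mul_assoc _ S E, mul_assoc _ S E, ← hS, ← mul_assoc, ← mul_assoc]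
  congr 1
  simp only [mul_add, add_mul, mul_one, one_mul, mul_assoc, hE]

/-- Fusion in a Peirce corner: two forms of `J_e*` in one orbit of the full group of triples lie in
one orbit of the triples of `G_e`, because `e(1 + u)e` acts on `J_e` as `1 + eue`. -/
theorem exists_mem_GtCorner_comp_eq {e : MonoidAlgebra k H} (he : IsIdempotentElem e)
    {lam : Module.Dual k J} (hlam : lam ∈ D.JeDual e) {τ : D.Gt}
    (hmu : lam ∘ₗ D.rho τ ∈ D.JeDual e) :
    ∃ σ ∈ D.GtCorner e, lam ∘ₗ D.rho σ = lam ∘ₗ D.rho τ := by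
  have E1 : D.ofAlg e * D.ofAlg e = D.ofAlg e := ofAlg_idem he
  obtain ⟨w, hw, hwe⟩ := exists_corner_mem_cornerN he (D.pr_ofJ (τ.a : D.G).x)
  obtain ⟨w', hw', hwe'⟩ := exists_corner_mem_cornerN he (D.pr_ofJ (τ.b : D.G)⁻¹.x)
  obtain ⟨σ, hσ, hPσ, hQσ⟩ : ∃ σ ∈ D.GtCorner e,
      D.ofG (D.pL σ) = D.ofAlg (MonoidAlgebra.of k H τ.t) * (1 + D.ofJ w) ∧
      D.ofG (D.pR σ)⁻¹ = (1 + D.ofJ w') * D.ofAlg (MonoidAlgebra.of k H τ.t⁻¹) := by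
    refine ⟨⟨τ.t, ⟨⟨1, w⟩, rfl⟩, ⟨⟨1, w'⟩⁻¹, (inv_mem hwe').1⟩⟩,
      (mem_GtCorner_iff he).2 ⟨hwe, inv_mem hwe'⟩, ?_, ?_⟩
    · change D.ofG (D.ofH τ.t * ⟨1, w⟩) = _
      rw [map_mul, ofG_ofH, ofG_eq, map_one, map_one]
    · change D.ofG (D.ofH τ.t * ⟨1, w'⟩⁻¹)⁻¹ = _
      rw [mul_inv_rev, inv_inv, map_mul, ← map_inv, ofG_ofH, D.ofG_eq ⟨1, w'⟩, map_one, map_one]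
  refine ⟨σ, hσ, ?_⟩
  have hτa : D.ofG (τ.a : D.G) = 1 + D.ofJ (τ.a : D.G).x := by
    rw [ofG_eq, show (τ.a : D.G).h = 1 from τ.a.2, map_one, map_one]
  have hτb : D.ofG (τ.b : D.G)⁻¹ = 1 + D.ofJ (τ.b : D.G)⁻¹.x := by
    rw [ofG_eq, show (τ.b : D.G)⁻¹.h = 1 from (inv_mem τ.b.2 : _ ∈ D.N), map_one, map_one]
  have hPτ : D.ofG (D.pL τ) = D.ofAlg (MonoidAlgebra.of k H τ.t) * (1 + D.ofJ (τ.a : D.G).x) := by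
    change D.ofG (D.ofH τ.t * τ.a) = _
    rw [map_mul, ofG_ofH, hτa]
  have hQτ : D.ofG (D.pR τ)⁻¹ =
      (1 + D.ofJ (τ.b : D.G)⁻¹.x) * D.ofAlg (MonoidAlgebra.of k H τ.t⁻¹) := by
    change D.ofG (D.ofH τ.t * τ.b)⁻¹ = _
    rw [mul_inv_rev, map_mul, ← map_inv, ofG_ofH, hτb]
  have hP : D.ofAlg e * D.ofG (D.pL τ) * D.ofAlg e = D.ofAlg e * D.ofG (D.pL σ) := by
    rw [hPτ, hPσ, hw]
    exact corner_compress_left E1 (D.ofAlg_comm _ _) _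
  have hQ : D.ofAlg e * D.ofG (D.pR τ)⁻¹ * D.ofAlg e = D.ofG (D.pR σ)⁻¹ * D.ofAlg e := by
    rw [hQτ, hQσ, hw']
    exact corner_compress_right E1 (D.ofAlg_comm _ _) _
  ext x
  have hx : D.pr (D.ofJ x) = 0 := D.pr_ofJ x
  have h1 : D.ofAlg e * (D.ofG (D.pL τ) * (D.ofAlg e * D.ofJ x * D.ofAlg e) *
      D.ofG (D.pR τ)⁻¹) * D.ofAlg e =
      D.ofAlg e * (D.ofG (D.pL σ) * D.ofJ x * D.ofG (D.pR σ)⁻¹) * D.ofAlg e := by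
    calc _ = (D.ofAlg e * D.ofG (D.pL τ) * D.ofAlg e) * D.ofJ x *
          (D.ofAlg e * D.ofG (D.pR τ)⁻¹ * D.ofAlg e) := by simp only [mul_assoc]
      _ = _ := by rw [hP, hQ]; simp only [mul_assoc]
  have h2 : D.ev (lam ∘ₗ D.rho σ) (D.ofJ x) = D.ev (lam ∘ₗ D.rho τ) (D.ofJ x) := by
    rw [← ev_corner hmu hx, ev_comp_rho _ _ hx, ev_comp_rho _ _ (by simp), ← ev_corner hlam,
      ← h1, ev_corner hlam]
    · simp
    · simp
  exact h2

theorem comp_rho_mul (lam : Module.Dual k J) (σ τ : D.Gt) :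
    (lam ∘ₗ D.rho σ) ∘ₗ D.rho τ = lam ∘ₗ D.rho (σ * τ) := by
  rw [map_mul]; rfl

theorem comp_rho_one (lam : Module.Dual k J) : lam ∘ₗ D.rho 1 = lam := by
  rw [map_one]; rfl

theorem rhoDual_eq (lam : Module.Dual k J) (τ : D.Gt) :
    D.rhoDual τ lam = lam ∘ₗ D.rho τ⁻¹ := rfl

theorem Index.eq_orbit (α : D.Index) {lam : Module.Dual k J} (hlam : lam ∈ α.ω) :
    α.ω = {mu | ∃ σ ∈ D.GtCorner α.e, mu = lam ∘ₗ D.rho σ} := by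
  obtain ⟨lam₀, -, hω⟩ := α.orbit
  rw [hω] at hlam
  obtain ⟨τ, hτ, rfl⟩ := hlam
  rw [hω, rhoDual_eq]
  ext mu
  constructor
  · rintro ⟨σ, hσ, rfl⟩
    refine ⟨τ * σ⁻¹, GtCorner_mul α.idem hτ (GtCorner_inv α.idem hσ), ?_⟩
    rw [comp_rho_mul, inv_mul_cancel_left, rhoDual_eq]
  · rintro ⟨σ, hσ, rfl⟩
    refine ⟨σ⁻¹ * τ, GtCorner_mul α.idem (GtCorner_inv α.idem hσ) hτ, ?_⟩
    rw [comp_rho_mul, rhoDual_eq, mul_inv_rev, inv_inv]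

theorem Index.regularAt (α : D.Index) {lam : Module.Dual k J} (hlam : lam ∈ α.ω) :
    D.RegularAt α.e lam := by
  refine ⟨α.subset hlam, fun f hf hef σ hσ h => ?_⟩
  by_contra hne
  refine Set.disjoint_left.1 (α.regular f hf hef hne) ?_ h
  rw [α.eq_orbit hlam]
  exact ⟨σ, hσ, rfl⟩

/-- Two indices whose forms lie in one orbit of the full group of triples share `e` and `ω`. -/
theorem Index.eq_of_comp_rho {α β : D.Index} {lam : Module.Dual k J} (hlam : lam ∈ α.ω)
    {τ : D.Gt} (hmu : lam ∘ₗ D.rho τ ∈ β.ω) : α.e = β.e ∧ α.ω = β.ω := by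
  have h1 := α.regularAt hlam
  have h2 := β.regularAt hmu
  have he : α.e = β.e := h1.idempotent_unique α.idem β.idem h2
  refine ⟨he, ?_⟩
  obtain ⟨σ, hσ, hστ⟩ := exists_mem_GtCorner_comp_eq α.idem h1.1 (τ := τ) (he ▸ h2.1)
  have h3 : lam ∘ₗ D.rho τ ∈ α.ω := by
    rw [α.eq_orbit hlam]; exact ⟨σ, hσ, hστ.symm⟩
  rw [α.eq_orbit h3, β.eq_orbit hmu, he]

end Regular


/-! ### Finite Fourier analysis -/

theorem sum_addChar_comp {k V : Type*} [Field k] [AddCommGroup V] [Module k V] [Fintype V]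
    {ε : AddChar k ℂ} (hε : ε ≠ 1) (φ : Module.Dual k V) [Decidable (φ = 0)] :
    ∑ x, ε (φ x) = if φ = 0 then (Nat.card V : ℂ) else 0 := by
  split_ifs with h
  · simp [h]
  · have hne : ε.compAddMonoidHom φ.toAddMonoidHom ≠ 0 := by
      intro h0
      apply hε
      ext c
      obtain ⟨x, hx⟩ := LinearMap.surjective h c
      have := DFunLike.congr_fun h0 x
      rw [← hx]
      simpa using this
    exact AddChar.sum_eq_zero_of_ne_one (ψ := ε.compAddMonoidHom φ.toAddMonoidHom) hne

theorem eq_zero_of_addChar_smul {k : Type*} [Field k] {ε : AddChar k ℂ} (hε : ε ≠ 1) {a : k}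
    (h : ∀ c, ε (c * a) = 1) : a = 0 := by
  by_contra ha
  apply hε
  ext c
  have := h (c * a⁻¹)
  rwa [inv_mul_cancel_right₀ ha] at this

theorem conj_monoidHom_eq_inv {Γ : Type*} [Group Γ] [Finite Γ] (f : Γ →* ℂ) (g : Γ) :
    starRingEnd ℂ (f g) = (f g)⁻¹ := by
  have h : ‖f g‖ = 1 := by
    refine Complex.norm_eq_one_of_pow_eq_one (n := Nat.card Γ) ?_ Nat.card_pos.ne'
    rw [← map_pow, pow_card_eq_one', map_one]
  rw [Complex.inv_def, Complex.normSq_eq_norm_sq, h]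
  simp

theorem conj_unit_eq_inv {Γ : Type*} [Group Γ] [Finite Γ] (θ : Γ →* ℂˣ) (g : Γ) :
    starRingEnd ℂ (θ g : ℂ) = (θ g : ℂ)⁻¹ := conj_monoidHom_eq_inv ((Units.coeHom ℂ).comp θ) g

theorem conj_addChar {k : Type*} [Field k] [Finite k] (ε : AddChar k ℂ) (c : k) :
    starRingEnd ℂ (ε c) = ε (-c) := (AddChar.map_neg_eq_conj ε c).symm

section ScalarProduct

variable {Γ ι : Type*} [Fintype Γ]

theorem scalarProduct_conj (f₁ f₂ : Γ → ℂ) :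
    starRingEnd ℂ (scalarProduct f₁ f₂) = scalarProduct f₂ f₁ := by
  simp [scalarProduct, map_sum, mul_comm]

theorem scalarProduct_sum_left (s : Finset ι) (c : ι → ℂ) (χ : ι → Γ → ℂ) (f : Γ → ℂ) :
    scalarProduct (∑ i ∈ s, c i • χ i) f = ∑ i ∈ s, c i * scalarProduct (χ i) f := by
  simp only [scalarProduct, Finset.sum_apply, Pi.smul_apply, smul_eq_mul, Finset.sum_mul,
    Finset.mul_sum]
  rw [Finset.sum_comm]
  exact Finset.sum_congr rfl fun i _ => Finset.sum_congr rfl fun g _ => by ring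

theorem scalarProduct_sum_of_orthogonal [Fintype ι] {χ : ι → Γ → ℂ}
    (h : ∀ i j, i ≠ j → scalarProduct (χ i) (χ j) = 0) (c : ι → ℂ) (j : ι) :
    scalarProduct (∑ i, c i • χ i) (χ j) = c j * scalarProduct (χ j) (χ j) := by
  rw [scalarProduct_sum_left, Finset.sum_eq_single j]
  · intro i _ hij
    rw [h i j hij, mul_zero]
  · simp

theorem linearIndependent_of_orthogonal [Fintype ι] {χ : ι → Γ → ℂ}
    (h : ∀ i j, i ≠ j → scalarProduct (χ i) (χ j) = 0)
    (h0 : ∀ i, scalarProduct (χ i) (χ i) ≠ 0) : LinearIndependent ℂ χ := by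
  rw [Fintype.linearIndependent_iff]
  intro c hc j
  have h1 := scalarProduct_sum_of_orthogonal h c j
  rw [hc] at h1
  have h2 : scalarProduct (0 : Γ → ℂ) (χ j) = 0 := by simp [scalarProduct]
  rw [h2, eq_comm, mul_eq_zero] at h1
  exact h1.resolve_right (h0 j)

end ScalarProduct

section Characters

variable {k H J : Type*} [Field k] [CommGroup H] [NonUnitalRing J] [Module k J]
  [IsScalarTower k J J] [SMulCommClass k J J] {D : TriangularType k H J}

/-! ### Supercharacters as orbit sums -/

open Classical in
/-- The character `θ` of `H(e)`, extended by zero to `H`. -/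
noncomputable def Index.thetaExt (α : D.Index) (h : H) : ℂ :=
  if hh : h ∈ D.Hfix α.e then (α.θ ⟨h, hh⟩ : ℂ) else 0

/-- The function `h + x ↦ θ(h) ε^{λ(x)}`, with `θ` extended by zero to `H`. -/
noncomputable def Index.base (ε : AddChar k ℂ) (α : D.Index) (lam : Module.Dual k J) (g : D.G) :
    ℂ :=
  α.thetaExt g.h * ε (lam g.x)

open Classical in
/-- The linear character `ξ_{θ,λ}` of `G_α`, extended by zero to `G`. -/
noncomputable def Index.xiExt (ε : AddChar k ℂ) (α : D.Index) (lam : Module.Dual k J) (g : D.G) :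
    ℂ :=
  if ∀ z, lam (g.x * z) = 0 then α.base ε lam g else 0

theorem Index.thetaExt_of_mem (α : D.Index) {h : H} (hh : h ∈ D.Hfix α.e) :
    α.thetaExt h = (α.θ ⟨h, hh⟩ : ℂ) := dif_pos hh

theorem Index.thetaExt_of_not_mem (α : D.Index) {h : H} (hh : h ∉ D.Hfix α.e) :
    α.thetaExt h = 0 := dif_neg hh

theorem Index.thetaExt_ne_zero_iff (α : D.Index) {h : H} :
    α.thetaExt h ≠ 0 ↔ h ∈ D.Hfix α.e := by
  by_cases hh : h ∈ D.Hfix α.e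
  · simp [hh, α.thetaExt_of_mem hh]
  · simp [hh, α.thetaExt_of_not_mem hh]

theorem addChar_ne_zero (ε : AddChar k ℂ) (c : k) : ε c ≠ 0 := by
  intro h
  have h1 : ε (c + -c) = 1 := by rw [add_neg_cancel, AddChar.map_zero_eq_one]
  rw [AddChar.map_add_eq_mul, h, zero_mul] at h1
  exact zero_ne_one h1

theorem Index.xiExt_of_mem (ε : AddChar k ℂ) (α : D.Index) (lam : α.ω) (g : Galpha α lam) :
    α.xiExt ε lam g = xi ε α lam g := by
  rw [xiExt, if_pos g.2.2, base, α.thetaExt_of_mem g.2.1]; rfl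

theorem Index.xiExt_ne_zero_iff (ε : AddChar k ℂ) (α : D.Index) (lam : α.ω) {g : D.G} :
    α.xiExt ε lam g ≠ 0 ↔ g ∈ Galpha α lam := by
  change _ ↔ g.h ∈ D.Hfix α.e ∧ ∀ z, lam.1 (g.x * z) = 0
  rw [xiExt]
  split_ifs with h
  · rw [base, mul_ne_zero_iff, α.thetaExt_ne_zero_iff]
    exact ⟨fun h' => ⟨h'.1, h⟩, fun h' => ⟨h'.1, addChar_ne_zero _ _⟩⟩
  · simp [h]

theorem Index.xiExt_mul (ε : AddChar k ℂ) (α : D.Index) (lam : α.ω) {g g' : D.G}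
    (hg : g ∈ Galpha α lam) (hg' : g' ∈ Galpha α lam) :
    α.xiExt ε lam (g * g') = α.xiExt ε lam g * α.xiExt ε lam g' := by
  have h := map_mul (xi ε α lam) ⟨g, hg⟩ ⟨g', hg'⟩
  rw [← xiExt_of_mem, ← xiExt_of_mem, ← xiExt_of_mem] at h
  exact h

theorem superchar_eq_sum_conj [Finite H] [Finite J] (ε : AddChar k ℂ) (α : D.Index) (lam : α.ω)
    (g : D.G) : superchar ε α lam g =
      (Nat.card (Galpha α lam) : ℂ)⁻¹ * ∑ s : D.G, α.xiExt ε lam (s⁻¹ * g * s) := by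
  rw [superchar, inducedChar]
  congr 1
  refine Finset.sum_congr rfl fun s _ => ?_
  split_ifs with h
  · exact (α.xiExt_of_mem ε lam ⟨_, h⟩).symm
  · rw [← α.xiExt_ne_zero_iff ε lam, not_not] at h
    exact h.symm

/-- `N = 1 + J` is in bijection with `J`. -/
noncomputable def equivN (D : TriangularType k H J) : J ≃ D.N where
  toFun x := ⟨⟨1, x⟩, rfl⟩
  invFun n := (n : D.G).x
  left_inv _ := rfl
  right_inv n := Subtype.ext (G.ext (show (1 : H) = (n : D.G).h from n.2.symm) rfl)

/-- `G = H + J` is in bijection with `H × J`. -/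
def equivG (D : TriangularType k H J) : H × J ≃ D.G where
  toFun p := ⟨p.1, p.2⟩
  invFun g := (g.h, g.x)
  left_inv _ := rfl
  right_inv _ := rfl

/-- The triple acting on `G` by `1 + y ↦ 1 + yb⁻¹`. -/
noncomputable def rightTriple (b : D.N) : D.Gt := ⟨1, 1, b⟩

@[simp] theorem pL_rightTriple (b : D.N) : D.pL (rightTriple b) = 1 := by
  change D.ofH 1 * 1 = 1
  simp

@[simp] theorem pR_rightTriple (b : D.N) : D.pR (rightTriple b) = b := by
  change D.ofH 1 * (b : D.G) = b
  simp

/-- Every triple is uniquely the product of a triple `(1, 1, n)` and a triple acting on `G` as a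
conjugation. -/
noncomputable def equivGt (D : TriangularType k H J) : D.N × D.G ≃ D.Gt where
  toFun p := rightTriple p.1 * D.mkGt p.2 p.2 rfl
  invFun τ := (⟨D.pR τ * (D.pL τ)⁻¹, by
    change D.proj _ = 1
    rw [map_mul, map_inv]
    change (D.pR τ).h * (D.pL τ).h⁻¹ = 1
    rw [pR_h, pL_h, mul_inv_cancel]⟩, D.pL τ)
  left_inv p := by simp
  right_inv τ := Gt_ext (by simp) (by simp)

theorem card_G (D : TriangularType k H J) : Nat.card D.G = Nat.card H * Nat.card J := by
  rw [← Nat.card_congr D.equivG, Nat.card_prod]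

theorem card_Gt (D : TriangularType k H J) :
    Nat.card D.Gt = Nat.card J * (Nat.card H * Nat.card J) := by
  rw [← Nat.card_congr D.equivGt, Nat.card_prod, ← Nat.card_congr D.equivN, card_G]

theorem R_conj (p g : D.G) : D.R (D.mkGt p p rfl) g = p * g * p⁻¹ := D.ofG_injective <| by
  rw [ofG_R, pL_mkGt, pR_mkGt, map_mul, map_mul, mul_sub, sub_mul, mul_one, ofG_mul_inv,
    add_sub_cancel]

theorem R_rightTriple (b : D.N) (g : D.G) :
    (D.R (rightTriple b) g).x = D.l g.h (b⁻¹ : D.N).1.x - (b⁻¹ : D.N).1.x + g.x +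
      g.x * (b⁻¹ : D.N).1.x := by
  rw [R_x, pL_rightTriple, pR_rightTriple, one_mul, one_mul, mul_x,
    show ((b : D.G)⁻¹).h = 1 from (b⁻¹ : D.N).2, map_one, Module.End.one_apply]
  change D.l g.h (b : D.G)⁻¹.x + g.x + g.x * (b : D.G)⁻¹.x - (b : D.G)⁻¹.x =
    D.l g.h (b : D.G)⁻¹.x - (b : D.G)⁻¹.x + g.x + g.x * (b : D.G)⁻¹.x
  abel

theorem Index.base_R_rightTriple (ε : AddChar k ℂ) (α : D.Index) {lam : Module.Dual k J}
    (hlam : lam ∈ D.JeDual α.e) (b : D.N) (g : D.G) :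
    α.base ε lam (D.R (rightTriple b) g) = α.base ε lam g * ε (lam (g.x * (b⁻¹ : D.N).1.x)) := by
  rw [base, base, R_h]
  by_cases hh : g.h ∈ D.Hfix α.e
  · rw [R_rightTriple, map_add lam, map_add lam, map_sub lam, JeDual_l hlam hh, sub_self,
      zero_add, AddChar.map_add_eq_mul, mul_assoc]
  · rw [α.thetaExt_of_not_mem hh]; simp

/-- Averaging over the triples `(1, 1, b)` cuts `h + x ↦ θ(h) ε^{λ(x)}` down to `G_α`. -/
theorem Index.sum_base_R_rightTriple [Finite J] {ε : AddChar k ℂ} (hε : ε ≠ 1) (α : D.Index)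
    {lam : Module.Dual k J} (hlam : lam ∈ D.JeDual α.e) (g : D.G) [Fintype D.N] :
    ∑ b, α.base ε lam (D.R (rightTriple b) g) = Nat.card J * α.xiExt ε lam g := by
  have : Fintype J := Fintype.ofFinite J
  classical
  simp only [α.base_R_rightTriple ε hlam, ← Finset.mul_sum]
  have h : ∑ b : D.N, ε (lam (g.x * (b⁻¹ : D.N).1.x)) =
      ∑ z : J, ε ((lam ∘ₗ LinearMap.mulLeft k g.x) z) := by
    rw [← Equiv.sum_comp (D.equivN.trans (Equiv.inv D.N))]
    refine Finset.sum_congr rfl fun z _ => ?_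
    change ε (lam (g.x * ((D.equivN z)⁻¹⁻¹ : D.N).1.x)) = _
    rw [inv_inv]; rfl
  rw [h, sum_addChar_comp hε, xiExt]
  have h' : lam ∘ₗ LinearMap.mulLeft k g.x = 0 ↔ ∀ z, lam (g.x * z) = 0 :=
    ⟨fun h z => LinearMap.congr_fun h z, fun h => LinearMap.ext h⟩
  simp only [h']
  split_ifs <;> ring

section

variable [Finite H] [Finite J]

/-- A supercharacter is a multiple of the orbit sum of `h + x ↦ θ(h) ε^{λ(x)}`: averaging over the
triples `(1, 1, b)` cuts this function down to `G_α`, and averaging over conjugations induces. -/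
theorem superchar_eq_orbitSum {ε : AddChar k ℂ} (hε : ε ≠ 1) (α : D.Index) (lam : α.ω) (g : D.G) :
    superchar ε α lam g = ((Nat.card (Galpha α lam) : ℂ) * Nat.card J)⁻¹ *
      ∑ τ : D.Gt, α.base ε lam (D.R τ g) := by
  have : Fintype D.N := Fintype.ofFinite _
  have hJ : (Nat.card J : ℂ) ≠ 0 := Nat.cast_ne_zero.2 Nat.card_pos.ne'
  rw [superchar_eq_sum_conj, ← Equiv.sum_comp D.equivGt, Fintype.sum_prod_type_right]
  have h (p : D.G) : ∑ n : D.N, α.base ε lam (D.R (D.equivGt (n, p)) g) =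
      Nat.card J * α.xiExt ε lam (p * g * p⁻¹) := by
    rw [← α.sum_base_R_rightTriple hε (α.subset lam.2), ← R_conj]
    exact Finset.sum_congr rfl fun n _ => by rw [← R_mul]; rfl
  rw [Finset.sum_congr rfl fun p _ => h p, ← Finset.mul_sum, ← Equiv.sum_comp (Equiv.inv D.G)]
  simp only [Equiv.inv_apply, inv_inv]
  field_simp

/-- A function on `G` that is constant on superclasses, the orbits of the action `R`. -/
def IsSuperclassFunction (D : TriangularType k H J) (f : D.G → ℂ) : Prop :=
  ∀ τ g, f (D.R τ g) = f g

theorem isSuperclassFunction_orbitSum (f : D.G → ℂ) (c : ℂ) :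
    D.IsSuperclassFunction fun g => c * ∑ τ : D.Gt, f (D.R τ g) := by
  intro σ g
  change c * _ = c * _
  rw [← Equiv.sum_comp (Equiv.mulRight σ) fun τ => f (D.R τ g)]
  simp only [Equiv.coe_mulRight, R_mul]

theorem isSuperclassFunction_superchar {ε : AddChar k ℂ} (hε : ε ≠ 1) (α : D.Index) (lam : α.ω) :
    D.IsSuperclassFunction (superchar ε α lam) := by
  rw [show superchar ε α lam = _ from funext (superchar_eq_orbitSum hε α lam)]
  exact isSuperclassFunction_orbitSum _ _

/-- The permutation `R_τ` of `G`. -/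
noncomputable def equivR (τ : D.Gt) : D.G ≃ D.G where
  toFun := D.R τ
  invFun := D.R τ⁻¹
  left_inv g := by rw [← R_mul, inv_mul_cancel, R_one]
  right_inv g := by rw [← R_mul, mul_inv_cancel, R_one]

theorem sum_orbitSum_mul_conj (f : D.G → ℂ) {F : D.G → ℂ} (hF : D.IsSuperclassFunction F) :
    ∑ g, (∑ τ, f (D.R τ g)) * starRingEnd ℂ (F g) =
      Nat.card D.Gt * ∑ g, f g * starRingEnd ℂ (F g) := by
  simp only [Finset.sum_mul]
  rw [Finset.sum_comm, Finset.sum_congr rfl (g := fun _ => ∑ g, f g * starRingEnd ℂ (F g))]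
  · simp
  · intro τ _
    rw [← Equiv.sum_comp (equivR τ) fun g => f g * starRingEnd ℂ (F g)]
    exact Finset.sum_congr rfl fun g _ => by
      change _ = f (D.R τ g) * starRingEnd ℂ (F (D.R τ g)); rw [hF]

end

/-! ### Orthogonality of supercharacters -/

/-- The stabilizer of `λ` in the group of triples. -/
noncomputable def stab (D : TriangularType k H J) (lam : Module.Dual k J) : Subgroup D.Gt where
  carrier := {τ | lam ∘ₗ D.rho τ = lam}
  one_mem' := comp_rho_one lam
  mul_mem' {σ τ} hσ hτ := by
    change lam ∘ₗ D.rho (σ * τ) = lam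
    rw [← comp_rho_mul, show lam ∘ₗ D.rho σ = lam from hσ]; exact hτ
  inv_mem' {σ} hσ := by
    change lam ∘ₗ D.rho σ⁻¹ = lam
    conv_lhs => rw [← show lam ∘ₗ D.rho σ = lam from hσ]
    rw [comp_rho_mul, mul_inv_cancel, comp_rho_one]

theorem mem_stab {lam : Module.Dual k J} {τ : D.Gt} : τ ∈ D.stab lam ↔ lam ∘ₗ D.rho τ = lam :=
  Iff.rfl

theorem sum_eq_sum_subgroup {Γ M : Type*} [Group Γ] [Fintype Γ] [AddCommMonoid M]
    (K : Subgroup Γ) [Fintype K] {f : Γ → M} (hf : ∀ g, g ∉ K → f g = 0) :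
    ∑ g, f g = ∑ g : K, f g := by
  classical
  rw [← Finset.sum_filter_of_ne (p := fun g => g ∈ K) fun g _ hg => by
    by_contra h; exact hg (hf g h)]
  exact Finset.sum_subtype _ (by simp) f

open Classical in
theorem sum_character_mul_conj {Γ : Type*} [Group Γ] [Fintype Γ] (θ θ' : Γ →* ℂˣ) :
    ∑ g, (θ g : ℂ) * starRingEnd ℂ (θ' g : ℂ) = if θ = θ' then (Nat.card Γ : ℂ) else 0 := by
  have h (g : Γ) : (θ g : ℂ) * starRingEnd ℂ (θ' g : ℂ) = (Units.coeHom ℂ).comp (θ * θ'⁻¹) g := by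
    rw [conj_unit_eq_inv]; simp
  rw [Finset.sum_congr rfl fun g _ => h g, sum_hom_units, Fintype.card_eq_nat_card, Nat.cast_ite,
    Nat.cast_zero]
  refine if_congr ?_ rfl rfl
  rw [← mul_inv_eq_one (a := θ)]
  refine ⟨fun h' => ?_, fun h' => by rw [h']; rfl⟩
  ext g
  exact DFunLike.congr_fun h' g

open Classical in
theorem Index.sum_thetaExt_mul_conj [Fintype H] {α β : D.Index} (he : α.e = β.e)
    (hω : α.ω = β.ω) : ∑ h, α.thetaExt h * starRingEnd ℂ (β.thetaExt h) =
      if α = β then (Nat.card (D.Hfix α.e) : ℂ) else 0 := by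
  have hle : D.Hfix α.e ≤ D.Hfix β.e := by rw [he]
  rw [sum_eq_sum_subgroup (D.Hfix α.e) fun h hh => by rw [thetaExt_of_not_mem _ hh, zero_mul]]
  have h1 (h : D.Hfix α.e) : α.thetaExt h * starRingEnd ℂ (β.thetaExt h) =
      (α.θ h : ℂ) * starRingEnd ℂ (β.θ.comp (Subgroup.inclusion hle) h : ℂ) := by
    rw [thetaExt_of_mem _ h.2, thetaExt_of_mem _ (hle h.2)]; rfl
  rw [Finset.sum_congr rfl fun h _ => h1 h, sum_character_mul_conj]
  refine if_congr ?_ rfl rfl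
  obtain ⟨e, hi, θ, ω, hs, ho, hr⟩ := α
  obtain ⟨e', hi', θ', ω', hs', ho', hr'⟩ := β
  obtain rfl : e = e' := he
  obtain rfl : ω = ω' := hω
  have h2 : θ'.comp (Subgroup.inclusion hle) = θ' := rfl
  rw [h2]
  simp

/-- `∑ ε^{λ(x)} \overline{ε^{μ(R_τ(h + x))}}` over a coset `h + J`: the two characters of `J` are
orthogonal unless `μ ∘ ρ_τ = λ`. -/
theorem sum_addChar_mul_conj_R [Finite k] [Fintype J] {ε : AddChar k ℂ} (hε : ε ≠ 1)
    (lam mu : Module.Dual k J) (τ : D.Gt) (h : H) [Decidable (mu ∘ₗ D.rho τ = lam)] :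
    ∑ x, ε (lam x) * starRingEnd ℂ (ε (mu (D.R τ ⟨h, x⟩).x)) =
      if mu ∘ₗ D.rho τ = lam then
        Nat.card J * starRingEnd ℂ (ε (mu (D.R τ (D.ofH h)).x)) else 0 := by
  classical
  have h1 (x : J) : ε (lam x) * starRingEnd ℂ (ε (mu (D.R τ ⟨h, x⟩).x)) =
      ε ((lam - mu ∘ₗ D.rho τ) x) * starRingEnd ℂ (ε (mu (D.R τ (D.ofH h)).x)) := by
    rw [R_x_eq, map_add mu, AddChar.map_add_eq_mul, map_mul, ← mul_assoc, LinearMap.sub_apply,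
      sub_eq_add_neg, AddChar.map_add_eq_mul, conj_addChar ε (mu (D.rho τ _))]
    rfl
  rw [Finset.sum_congr rfl fun x _ => h1 x, ← Finset.sum_mul, sum_addChar_comp hε, ite_mul,
    zero_mul]
  refine if_congr ?_ rfl rfl
  rw [sub_eq_zero, eq_comm]

section

variable [Finite k] [Finite H] [Finite J]

open Classical in
/-- Orthogonality of `θ(h) ε^{λ(x)}` and a translate of `θ'(h) ε^{μ(x)}`. If `μ ∘ ρ_τ = λ`, the two
indices share `e` and `ω`, the phase vanishes on `H(e)`, and the orthogonality of `θ` and `θ'`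
remains. -/
theorem Index.sum_base_mul_conj_base_R {ε : AddChar k ℂ} (hε : ε ≠ 1) {α β : D.Index}
    (lam : α.ω) (mu : β.ω) (τ : D.Gt) :
    ∑ g : D.G, α.base ε lam g * starRingEnd ℂ (β.base ε mu (D.R τ g)) =
      if α = β ∧ mu.1 ∘ₗ D.rho τ = lam then (Nat.card J : ℂ) * Nat.card (D.Hfix α.e) else 0 := by
  have : Fintype H := Fintype.ofFinite H
  have : Fintype J := Fintype.ofFinite J
  have h1 : ∑ g : D.G, α.base ε lam g * starRingEnd ℂ (β.base ε mu (D.R τ g)) =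
      ∑ h, α.thetaExt h * starRingEnd ℂ (β.thetaExt h) *
        ∑ x, ε (lam.1 x) * starRingEnd ℂ (ε (mu.1 (D.R τ ⟨h, x⟩).x)) := by
    rw [← Equiv.sum_comp D.equivG, Fintype.sum_prod_type]
    refine Finset.sum_congr rfl fun h _ => ?_
    rw [Finset.mul_sum]
    refine Finset.sum_congr rfl fun x _ => ?_
    change α.thetaExt h * ε (lam.1 x) *
      starRingEnd ℂ (β.thetaExt h * ε (mu.1 (D.R τ ⟨h, x⟩).x)) = _
    rw [map_mul]; ring
  rw [h1]
  by_cases hτ : mu.1 ∘ₗ D.rho τ = lam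
  · obtain ⟨he, hω⟩ := Index.eq_of_comp_rho mu.2 (τ := τ) (β := α) (by rw [hτ]; exact lam.2)
    have h2 (h : H) : α.thetaExt h * starRingEnd ℂ (β.thetaExt h) *
        ∑ x, ε (lam.1 x) * starRingEnd ℂ (ε (mu.1 (D.R τ ⟨h, x⟩).x)) =
        α.thetaExt h * starRingEnd ℂ (β.thetaExt h) * Nat.card J := by
      by_cases hh : h ∈ D.Hfix β.e
      · rw [sum_addChar_mul_conj_R hε, if_pos hτ, apply_R_ofH_eq_zero (β.subset mu.2) ?_ hh]
        · simp
        · rw [hτ, he]; exact α.subset lam.2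
      · rw [β.thetaExt_of_not_mem hh]; simp
    rw [Finset.sum_congr rfl fun h _ => h2 h, ← Finset.sum_mul,
      Index.sum_thetaExt_mul_conj he.symm hω.symm]
    simp only [hτ, and_true]
    split_ifs <;> ring
  · rw [if_neg fun h => hτ h.2]
    refine Finset.sum_eq_zero fun h _ => ?_
    rw [sum_addChar_mul_conj_R hε, if_neg hτ, mul_zero]

open Classical in
/-- The scalar product of two supercharacters counts the triples carrying one form to the other;
these exist only between equal indices. -/
theorem Index.scalarProduct_superchar {ε : AddChar k ℂ} (hε : ε ≠ 1) {α β : D.Index}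
    (lam : α.ω) (mu : β.ω) : scalarProduct (superchar ε α lam) (superchar ε β mu) =
      (Nat.card (Galpha α lam) * Nat.card (Galpha β mu) : ℂ)⁻¹ *
        ∑ τ : D.Gt, if α = β ∧ mu.1 ∘ₗ D.rho τ = lam then (Nat.card (D.Hfix α.e) : ℂ) else 0 := by
  have hJ : (Nat.card J : ℂ) ≠ 0 := Nat.cast_ne_zero.2 Nat.card_pos.ne'
  have hH : (Nat.card H : ℂ) ≠ 0 := Nat.cast_ne_zero.2 Nat.card_pos.ne'
  have h1 : ∑ g, superchar ε α lam g * starRingEnd ℂ (superchar ε β mu g) =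
      ((Nat.card (Galpha α lam) : ℂ) * Nat.card J)⁻¹ * (Nat.card D.Gt *
        ∑ g, α.base ε lam g * starRingEnd ℂ (superchar ε β mu g)) := by
    rw [← sum_orbitSum_mul_conj _ (isSuperclassFunction_superchar hε β mu), Finset.mul_sum]
    exact Finset.sum_congr rfl fun g _ => by rw [superchar_eq_orbitSum hε α lam g, mul_assoc]
  have h2 : ∑ g, α.base ε lam g * starRingEnd ℂ (superchar ε β mu g) =
      ((Nat.card (Galpha β mu) : ℂ) * Nat.card J)⁻¹ *
        ∑ τ : D.Gt, ∑ g, α.base ε lam g * starRingEnd ℂ (β.base ε mu (D.R τ g)) := by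
    rw [Finset.sum_comm, Finset.mul_sum]
    refine Finset.sum_congr rfl fun g _ => ?_
    rw [superchar_eq_orbitSum hε β mu g, map_mul, map_sum, ← Finset.mul_sum]
    simp only [map_inv₀, map_mul, map_natCast]
    ring
  have h3 (τ : D.Gt) : (if α = β ∧ mu.1 ∘ₗ D.rho τ = lam then
      (Nat.card J : ℂ) * Nat.card (D.Hfix α.e) else 0) = Nat.card J *
      if α = β ∧ mu.1 ∘ₗ D.rho τ = lam then (Nat.card (D.Hfix α.e) : ℂ) else 0 := by
    split_ifs <;> simp
  rw [scalarProduct, h1, h2]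
  simp only [Index.sum_base_mul_conj_base_R hε, h3, ← Finset.mul_sum, card_Gt, card_G,
    Nat.cast_mul, mul_inv]
  field_simp

theorem Index.scalarProduct_superchar_of_ne {ε : AddChar k ℂ} (hε : ε ≠ 1) {α β : D.Index}
    (h : α ≠ β) (lam : α.ω) (mu : β.ω) :
    scalarProduct (superchar ε α lam) (superchar ε β mu) = 0 := by
  classical
  rw [Index.scalarProduct_superchar hε]
  simp [h]

theorem Index.scalarProduct_superchar_self {ε : AddChar k ℂ} (hε : ε ≠ 1) (α : D.Index)
    (lam : α.ω) : scalarProduct (superchar ε α lam) (superchar ε α lam) =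
      Nat.card (D.Hfix α.e) * Nat.card (D.stab lam.1) / (Nat.card (Galpha α lam) : ℂ) ^ 2 := by
  classical
  have h : ∑ τ : D.Gt, (if lam.1 ∘ₗ D.rho τ = lam then (Nat.card (D.Hfix α.e) : ℂ) else 0) =
      Nat.card (D.stab lam.1) * Nat.card (D.Hfix α.e) := by
    rw [← Finset.sum_filter, Finset.sum_const, nsmul_eq_mul, ← Fintype.card_subtype,
      Fintype.card_eq_nat_card]
    rfl
  rw [Index.scalarProduct_superchar hε]
  simp only [true_and]
  rw [h]
  ring

end

end Characters


section Span

variable {k H J : Type*} [Field k] [CommGroup H] [NonUnitalRing J] [Module k J]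
  [IsScalarTower k J J] [SMulCommClass k J J] {D : TriangularType k H J}

/-! ### Supercharacters span the superclass functions -/

/-- The sum `∑_τ ε^{λ(R_τ(g) - h)}`, where `h` is the component of `g` in `H`. -/
noncomputable def orbitSum [Finite H] [Finite J] (ε : AddChar k ℂ) (lam : Module.Dual k J)
    (g : D.G) : ℂ :=
  ∑ τ : D.Gt, ε (lam (D.R τ g).x)

open Classical in
/-- The restriction of `orbitSum` to the coset `h + J`, extended by zero to `G`. -/
noncomputable def cosetOrbitSum [Finite H] [Finite J] (ε : AddChar k ℂ) (h : H)
    (lam : Module.Dual k J) (g : D.G) : ℂ :=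
  if g.h = h then orbitSum ε lam g else 0

theorem orbitSum_eq_mul_comp_rho [Finite H] [Finite J] (ε : AddChar k ℂ) (lam : Module.Dual k J)
    (σ : D.Gt) (g : D.G) : orbitSum ε lam g =
      ε (lam (D.R σ (D.ofH g.h)).x) * orbitSum ε (lam ∘ₗ D.rho σ) g := by
  rw [orbitSum, orbitSum, ← Equiv.sum_comp (Equiv.mulLeft σ), Finset.mul_sum]
  refine Finset.sum_congr rfl fun τ _ => ?_
  rw [Equiv.coe_mulLeft, R_mul, R_x_eq, R_h, map_add lam, AddChar.map_add_eq_mul, mul_comm]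
  rfl

/-- On a coset of `J`, moving the form along its orbit changes the orbit sum by a phase only. -/
theorem cosetOrbitSum_eq_smul_comp_rho [Finite H] [Finite J] (ε : AddChar k ℂ) (h : H)
    (lam : Module.Dual k J) (σ : D.Gt) : (cosetOrbitSum ε h lam : D.G → ℂ) =
      ε (lam (D.R σ (D.ofH h)).x) • cosetOrbitSum ε h (lam ∘ₗ D.rho σ) := by
  ext g
  simp only [cosetOrbitSum, Pi.smul_apply, smul_eq_mul]
  split_ifs with hg
  · rw [orbitSum_eq_mul_comp_rho ε lam σ, hg]
  · rw [mul_zero]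

theorem addChar_eq_one_of_cosetOrbitSum_ne_zero [Finite H] [Finite J] {ε : AddChar k ℂ} {h : H}
    {lam : Module.Dual k J} (h0 : (cosetOrbitSum ε h lam : D.G → ℂ) ≠ 0) {σ : D.Gt}
    (hσ : lam ∘ₗ D.rho σ = lam) : ε (lam (D.R σ (D.ofH h)).x) = 1 := by
  have h1 := cosetOrbitSum_eq_smul_comp_rho (D := D) ε h lam σ
  rw [hσ] at h1
  have h2 : (1 - ε (lam (D.R σ (D.ofH h)).x)) • (cosetOrbitSum ε h lam : D.G → ℂ) = 0 := by
    rw [sub_smul, one_smul, ← h1, sub_self]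
  exact (sub_eq_zero.1 ((smul_eq_zero.1 h2).resolve_right h0)).symm

/-- A coset `h + J` on which the orbit sum of a regular form does not vanish has `h ∈ H(e)`:
otherwise some element of the stabilizer of `λ` contributes a nontrivial phase. -/
theorem RegularAt.mem_Hfix_of_cosetOrbitSum_ne_zero [Finite H] [Finite J] {ε : AddChar k ℂ}
    (hε : ε ≠ 1) {e : MonoidAlgebra k H} (he : IsIdempotentElem e) {lam : Module.Dual k J}
    (hreg : D.RegularAt e lam) {h : H} (h0 : (cosetOrbitSum ε h lam : D.G → ℂ) ≠ 0) :
    h ∈ D.Hfix e := by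
  refine hreg.mem_Hfix he (fun u hu => ?_) fun v hv => ?_
  · rw [← sub_eq_zero]
    refine eq_zero_of_addChar_smul hε fun c => ?_
    have hσ : lam ∘ₗ D.rho (D.mkGt ⟨1, c • u⟩ 1 rfl) = lam := by
      ext x
      rw [← D.ev_ofJ, ev_comp_rho _ _ (by simp), pL_mkGt, pR_mkGt, inv_one, map_one, mul_one,
        ofG_eq, map_one, map_one, add_mul, one_mul, map_add, ← ofJ_mul, ev_ofJ, ev_ofJ,
        smul_mul_assoc, map_smul, hu, smul_zero, add_zero]
    have h1 := addChar_eq_one_of_cosetOrbitSum_ne_zero h0 hσ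
    rw [R_x, pL_mkGt, pR_mkGt] at h1
    simpa [ofH, mul_sub] using h1
  · rw [← sub_eq_zero]
    refine eq_zero_of_addChar_smul hε fun c => ?_
    have hσ : lam ∘ₗ D.rho (D.mkGt 1 ⟨1, c • v⟩⁻¹ (inv_h D _ ▸ inv_one.symm)) = lam := by
      ext x
      rw [← D.ev_ofJ, ev_comp_rho _ _ (by simp), pL_mkGt, pR_mkGt, inv_inv, map_one, one_mul,
        D.ofG_eq ⟨1, c • v⟩, map_one, map_one, mul_add, mul_one, map_add, ← ofJ_mul, ev_ofJ,
        ev_ofJ, mul_smul_comm, map_smul, hv, smul_zero, add_zero]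
    have h1 := addChar_eq_one_of_cosetOrbitSum_ne_zero h0 hσ
    rw [R_x, pL_mkGt, pR_mkGt] at h1
    simpa [ofH, mul_sub] using h1

/-- The triples of `G_e` preserve `J_e*`. -/
theorem comp_rho_mem_JeDual {e : MonoidAlgebra k H} (he : IsIdempotentElem e)
    {lam : Module.Dual k J} (hlam : lam ∈ D.JeDual e) {σ : D.Gt} (hσ : σ ∈ D.GtCorner e) :
    lam ∘ₗ D.rho σ ∈ D.JeDual e := by
  have hg (t : H) {n : D.G} (hn : n ∈ D.cornerN he) :
      D.ofAlg e * D.ofG (D.ofH t * n) = D.ofG (D.ofH t * n) * D.ofAlg e := by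
    obtain ⟨h₁, h₂⟩ := (mem_Je_iff he).1 hn.2
    rw [map_mul, ofG_ofH, D.ofG_eq n, hn.1, map_one, map_one, ← mul_assoc, ofAlg_comm, mul_assoc,
      mul_assoc, mul_add, add_mul, h₁, h₂, mul_one, one_mul]
  rw [mem_GtCorner_iff he] at hσ
  have hP : D.ofAlg e * D.ofG (D.pL σ) = D.ofG (D.pL σ) * D.ofAlg e := hg _ hσ.1
  have hQ : D.ofAlg e * D.ofG (D.pR σ)⁻¹ = D.ofG (D.pR σ)⁻¹ * D.ofAlg e := by
    have h1 : D.ofAlg e * D.ofG (D.pR σ) = D.ofG (D.pR σ) * D.ofAlg e := hg _ hσ.2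
    calc _ = D.ofG (D.pR σ)⁻¹ * (D.ofG (D.pR σ) * D.ofAlg e) * D.ofG (D.pR σ)⁻¹ := by simp
      _ = _ := by rw [← h1]; simp [mul_assoc]
  refine mem_JeDual_of (fun j hj => ?_) fun j hj => ?_
  · rw [ev_comp_rho _ _ (by simp [hj]), ev_comp_rho _ _ hj, ← mul_assoc, ← hP, mul_assoc,
      mul_assoc, ev_ofAlg_mul he hlam (by simp [hj]), ← mul_assoc]
  · rw [ev_comp_rho _ _ (by simp [hj]), ev_comp_rho _ _ hj, mul_assoc, mul_assoc j, hQ,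
      ← mul_assoc, ← mul_assoc, ev_mul_ofAlg he hlam (by simp [hj])]

/-- The index `(e, θ, ω)`, where `ω` is the orbit of a regular form. -/
noncomputable def RegularAt.index {e : MonoidAlgebra k H} (he : IsIdempotentElem e)
    {lam : Module.Dual k J} (hreg : D.RegularAt e lam) (θ : D.Hfix e →* ℂˣ) : D.Index where
  e := e
  idem := he
  θ := θ
  ω := {mu | ∃ τ ∈ D.GtCorner e, mu = D.rhoDual τ lam}
  subset := by
    rintro _ ⟨τ, hτ, rfl⟩
    exact comp_rho_mem_JeDual he hreg.1 (GtCorner_inv he hτ)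
  orbit := ⟨lam, hreg.1, rfl⟩
  regular f hf hef hne := by
    rw [Set.disjoint_left]
    rintro _ ⟨τ, hτ, rfl⟩ h
    exact hne (hreg.2 f hf hef _ (GtCorner_inv he hτ) h)

theorem sum_eval_character {K : Type*} [CommGroup K] [Finite K] [Fintype (K →* ℂˣ)] (g : K)
    [Decidable (g = 1)] :
    ∑ θ : K →* ℂˣ, (θ g : ℂ) = if g = 1 then (Nat.card (K →* ℂˣ) : ℂ) else 0 := by
  split_ifs with hg
  · simp [hg]
  · have : NeZero (Monoid.exponent K : ℂ) :=
      ⟨Nat.cast_ne_zero.2 (Monoid.exponent_ne_zero_of_finite)⟩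
    obtain ⟨θ, hθ⟩ := CommGroup.exists_apply_ne_one_of_hasEnoughRootsOfUnity K ℂ hg
    refine sum_hom_units_eq_zero ((Units.coeHom ℂ).comp (MonoidHom.eval g)) fun h => hθ ?_
    exact Units.ext (DFunLike.congr_fun h θ)

/-- The orbit sum in a supercharacter does not depend on the representative of the orbit: the phases
are trivial on `H(e)`, and elsewhere `θ` vanishes. -/
theorem superchar_eq_mul_orbitSum [Finite H] [Finite J] {ε : AddChar k ℂ} (hε : ε ≠ 1)
    (α : D.Index) (lam : α.ω) {mu : Module.Dual k J} (hmu : mu ∈ α.ω) (g : D.G) :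
    superchar ε α lam g =
      ((Nat.card (Galpha α lam) : ℂ) * Nat.card J)⁻¹ * (α.thetaExt g.h * orbitSum ε mu g) := by
  obtain ⟨σ, -, h⟩ : ∃ σ ∈ D.GtCorner α.e, lam.1 = mu ∘ₗ D.rho σ :=
    (Set.ext_iff.1 (α.eq_orbit hmu) _).1 lam.2
  rw [superchar_eq_orbitSum hε]
  congr 1
  simp only [Index.base, R_h, ← Finset.mul_sum]
  by_cases hh : g.h ∈ D.Hfix α.e
  · rw [orbitSum_eq_mul_comp_rho ε mu σ, ← h,
      apply_R_ofH_eq_zero (α.subset hmu) (h ▸ α.subset lam.2) hh, AddChar.map_zero_eq_one, one_mul]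
    rfl
  · rw [α.thetaExt_of_not_mem hh, zero_mul, zero_mul]

/-- Orbit sums of regular forms, cut off to one coset of `J`, are combinations of the
supercharacters with the same `e` and `ω` and all possible `θ`. -/
theorem RegularAt.cosetOrbitSum_mem_span [Finite H] [Finite J] {ε : AddChar k ℂ} (hε : ε ≠ 1)
    (rep : ∀ α : D.Index, α.ω) {e : MonoidAlgebra k H} (he : IsIdempotentElem e)
    {mu : Module.Dual k J} (hreg : D.RegularAt e mu) (h : H) :
    cosetOrbitSum ε h mu ∈ Submodule.span ℂ (Set.range fun α => superchar ε α (rep α)) := by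
  by_cases h0 : (cosetOrbitSum ε h mu : D.G → ℂ) = 0
  · rw [h0]; exact zero_mem _
  have hh := hreg.mem_Hfix_of_cosetOrbitSum_ne_zero hε he h0
  have : Fintype (D.Hfix e →* ℂˣ) := Fintype.ofFinite _
  have hJ : (Nat.card J : ℂ) ≠ 0 := Nat.cast_ne_zero.2 Nat.card_pos.ne'
  have hM : (Nat.card (D.Hfix e →* ℂˣ) : ℂ) ≠ 0 := Nat.cast_ne_zero.2 Nat.card_pos.ne'
  -- Fourier inversion on `H(e)` isolates the coset `h + J`
  have key : (cosetOrbitSum ε h mu : D.G → ℂ) = ∑ θ : D.Hfix e →* ℂˣ,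
      ((Nat.card (D.Hfix e →* ℂˣ) : ℂ)⁻¹ * ((θ ⟨h, hh⟩ : ℂ)⁻¹ *
        (Nat.card (Galpha (hreg.index he θ) (rep _)) * Nat.card J))) •
        superchar ε (hreg.index he θ) (rep _) := by
    ext g
    rw [Finset.sum_apply]
    have hmem (θ : D.Hfix e →* ℂˣ) : mu ∈ (hreg.index he θ).ω :=
      ⟨1, one_mem_GtCorner e, by rw [rhoDual_eq, inv_one, comp_rho_one]⟩
    have h1 (θ : D.Hfix e →* ℂˣ) : (((Nat.card (D.Hfix e →* ℂˣ) : ℂ)⁻¹ * ((θ ⟨h, hh⟩ : ℂ)⁻¹ *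
        (Nat.card (Galpha (hreg.index he θ) (rep _)) * Nat.card J))) •
        superchar ε (hreg.index he θ) (rep _)) g = (Nat.card (D.Hfix e →* ℂˣ) : ℂ)⁻¹ *
        ((hreg.index he θ).thetaExt g.h * (θ ⟨h, hh⟩ : ℂ)⁻¹) * orbitSum ε mu g := by
      have hG : (Nat.card (Galpha (hreg.index he θ) (rep _)) : ℂ) ≠ 0 :=
        Nat.cast_ne_zero.2 Nat.card_pos.ne'
      rw [Pi.smul_apply, superchar_eq_mul_orbitSum hε _ _ (hmem θ), smul_eq_mul]
      field_simp
    rw [Finset.sum_congr rfl fun θ _ => h1 θ, ← Finset.sum_mul, ← Finset.mul_sum]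
    rw [cosetOrbitSum]
    by_cases hg : g.h ∈ D.Hfix e
    · have h2 (θ : D.Hfix e →* ℂˣ) : (hreg.index he θ).thetaExt g.h * (θ ⟨h, hh⟩ : ℂ)⁻¹ =
          (θ (⟨g.h, hg⟩ * ⟨h, hh⟩⁻¹) : ℂ) := by
        rw [Index.thetaExt_of_mem (hreg.index he θ) hg, map_mul, map_inv, Units.val_mul,
          Units.val_inv_eq_inv_val]
        rfl
      classical
      rw [Finset.sum_congr rfl fun θ _ => h2 θ, sum_eval_character]
      have h3 : (⟨g.h, hg⟩ * ⟨h, hh⟩⁻¹ : D.Hfix e) = 1 ↔ g.h = h := by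
        rw [mul_inv_eq_one, Subtype.mk.injEq]
      by_cases h4 : g.h = h
      · rw [if_pos h4, if_pos (h3.2 h4), inv_mul_cancel₀ hM, one_mul]
      · rw [if_neg h4, if_neg (h3.not.2 h4), mul_zero, zero_mul]
    · rw [if_neg (fun h4 : g.h = h => hg (by rw [h4]; exact hh)), Finset.sum_eq_zero,
        mul_zero, zero_mul]
      intro θ _
      rw [Index.thetaExt_of_not_mem (hreg.index he θ) hg, zero_mul]
  rw [key]
  exact Submodule.sum_mem _ fun θ _ => Submodule.smul_mem _ _ (Submodule.subset_span ⟨_, rfl⟩)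

/-- Every orbit of linear forms contains a regular one: take `e` minimal among the idempotents such
that the orbit meets `J_e*`. -/
theorem exists_regularAt_comp_rho [Finite k] [Finite H] (lam : Module.Dual k J) :
    ∃ (e : MonoidAlgebra k H) (σ : D.Gt), IsIdempotentElem e ∧ D.RegularAt e (lam ∘ₗ D.rho σ) := by
  have : Finite (MonoidAlgebra k H) := Module.finite_of_finite k
  obtain ⟨e, ⟨he, σ, hσ⟩, hmin⟩ := Set.exists_min_image
    {e : MonoidAlgebra k H | IsIdempotentElem e ∧ ∃ σ : D.Gt, lam ∘ₗ D.rho σ ∈ D.JeDual e}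
    (fun e => {x | e * x = x}.ncard) (Set.toFinite _)
    ⟨1, IsIdempotentElem.one, 1, mem_JeDual_of (by simp) (by simp)⟩
  refine ⟨e, σ, he, hσ, fun f hf hef τ _ hτ => ?_⟩
  by_contra hne
  rw [comp_rho_mul] at hτ
  refine (hmin f ⟨hf, _, hτ⟩).not_gt (Set.ncard_lt_ncard ⟨fun x hx => ?_, fun hsub => hne ?_⟩)
  · rw [Set.mem_ofPred_eq] at hx ⊢
    rw [← hx, ← mul_assoc, hef]
  · have h1 : f * e = e := hsub he.eq
    rw [← hef, mul_comm, h1]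

variable [Finite k] [Finite H] [Finite J]

/-- Superclass functions are linear combinations of supercharacters: by Fourier inversion on `J`
they are combinations of orbit sums cut off to cosets of `J`, and each orbit of linear forms
contains a regular form. -/
theorem IsSuperclassFunction.mem_span {ε : AddChar k ℂ} (hε : ε ≠ 1) (rep : ∀ α : D.Index, α.ω)
    {f : D.G → ℂ} (hf : D.IsSuperclassFunction f) :
    f ∈ Submodule.span ℂ (Set.range fun α => superchar ε α (rep α)) := by
  have : Finite (Module.Dual k J) := DFunLike.finite _
  have : Fintype (Module.Dual k J) := Fintype.ofFinite _
  have hmem (h : H) (lam : Module.Dual k J) : cosetOrbitSum ε h lam ∈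
      Submodule.span ℂ (Set.range fun α : D.Index => superchar ε α (rep α)) := by
    obtain ⟨e, σ, he, hreg⟩ := exists_regularAt_comp_rho (D := D) lam
    rw [cosetOrbitSum_eq_smul_comp_rho ε h lam σ]
    exact Submodule.smul_mem _ _ (hreg.cosetOrbitSum_mem_span hε rep he h)
  have hJ : (Nat.card (Module.Dual k J) : ℂ) ≠ 0 := Nat.cast_ne_zero.2 Nat.card_pos.ne'
  have hG : (Nat.card D.Gt : ℂ) ≠ 0 := Nat.cast_ne_zero.2 Nat.card_pos.ne'
  -- Fourier inversion on `J`, averaged over the triples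
  have key : f = ((Nat.card (Module.Dual k J) : ℂ)⁻¹ * (Nat.card D.Gt : ℂ)⁻¹) •
      ∑ u : D.G, ∑ lam : Module.Dual k J,
        (f u * ε (-lam u.x)) • cosetOrbitSum ε u.h lam := by
    classical
    ext g
    have h1 (τ : D.Gt) : f g = ∑ u : D.G, (Nat.card (Module.Dual k J) : ℂ)⁻¹ *
        ∑ lam : Module.Dual k J, f u * ε (-lam u.x) *
          if g.h = u.h then ε (lam (D.R τ g).x) else 0 := by
      rw [Finset.sum_eq_single (D.R τ g), R_h, ← hf τ g]
      · have h2 (lam : Module.Dual k J) : f (D.R τ g) * ε (-lam (D.R τ g).x) *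
            (if g.h = g.h then ε (lam (D.R τ g).x) else 0) = f (D.R τ g) := by
          rw [if_pos rfl, mul_assoc, ← AddChar.map_add_eq_mul, neg_add_cancel,
            AddChar.map_zero_eq_one, mul_one]
        rw [Finset.sum_congr rfl fun lam _ => h2 lam, Finset.sum_const, nsmul_eq_mul,
          Finset.card_univ, Fintype.card_eq_nat_card, inv_mul_cancel_left₀ hJ]
      · intro u _ hu
        by_cases hgu : g.h = u.h
        · simp only [if_pos hgu]
          have h2 (lam : Module.Dual k J) : f u * ε (-lam u.x) * ε (lam (D.R τ g).x) =
              f u * ε (Module.Dual.eval k J ((D.R τ g).x - u.x) lam) := by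
            rw [Module.Dual.eval_apply, map_sub, sub_eq_neg_add, AddChar.map_add_eq_mul,
              mul_assoc]
          rw [Finset.sum_congr rfl fun lam _ => h2 lam, ← Finset.mul_sum, sum_addChar_comp hε,
            if_neg, mul_zero, mul_zero]
          rw [Module.eval_apply_eq_zero_iff, sub_eq_zero]
          exact fun h3 => hu (G.ext hgu.symm h3.symm)
        · simp [if_neg hgu]
      · simp
    have h2 : (Nat.card D.Gt : ℂ) * f g = ∑ τ : D.Gt, ∑ u : D.G,
        (Nat.card (Module.Dual k J) : ℂ)⁻¹ * ∑ lam : Module.Dual k J, f u * ε (-lam u.x) *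
          if g.h = u.h then ε (lam (D.R τ g).x) else 0 := by
      rw [← Finset.sum_congr rfl fun τ _ => h1 τ, Finset.sum_const, nsmul_eq_mul,
        Finset.card_univ, Fintype.card_eq_nat_card]
    rw [Pi.smul_apply, smul_eq_mul, mul_assoc, mul_comm, mul_assoc, eq_inv_mul_iff_mul_eq₀ hG, h2,
      Finset.sum_comm, Finset.sum_apply, Finset.sum_mul]
    refine Finset.sum_congr rfl fun u _ => ?_
    rw [← Finset.mul_sum, Finset.sum_comm, Finset.sum_apply, mul_comm]
    congr 1
    refine Finset.sum_congr rfl fun lam _ => ?_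
    rw [Pi.smul_apply, smul_eq_mul, cosetOrbitSum, orbitSum, ← Finset.mul_sum]
    congr 1
    split_ifs with h <;> simp
  rw [key]
  exact Submodule.smul_mem _ _ (Submodule.sum_mem _ fun u _ => Submodule.sum_mem _ fun lam _ =>
    Submodule.smul_mem _ _ (hmem _ _))

/-- The coefficients of a superclass function with respect to the supercharacters. -/
theorem IsSuperclassFunction.eq_sum {ε : AddChar k ℂ} (hε : ε ≠ 1) (rep : ∀ α : D.Index, α.ω)
    {f : D.G → ℂ} (hf : D.IsSuperclassFunction f) :
    f = ∑ α, (scalarProduct f (superchar ε α (rep α)) /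
      scalarProduct (superchar ε α (rep α)) (superchar ε α (rep α))) • superchar ε α (rep α) := by
  obtain ⟨c, hc⟩ := (Submodule.mem_span_range_iff_exists_fun ℂ).1 (hf.mem_span hε rep)
  conv_lhs => rw [← hc]
  refine Finset.sum_congr rfl fun α _ => ?_
  congr 1
  rw [← hc, scalarProduct_sum_of_orthogonal
    (χ := fun α : D.Index => superchar ε α (rep α))
    (fun i j hij => Index.scalarProduct_superchar_of_ne hε hij _ _), mul_div_cancel_right₀]
  rw [Index.scalarProduct_superchar_self hε]
  have h1 : (Nat.card (D.Hfix α.e) : ℂ) ≠ 0 := Nat.cast_ne_zero.2 Nat.card_pos.ne'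
  have h2 : (Nat.card (D.stab (rep α).1) : ℂ) ≠ 0 := Nat.cast_ne_zero.2 Nat.card_pos.ne'
  have h3 : (Nat.card (Galpha α (rep α)) : ℂ) ≠ 0 := Nat.cast_ne_zero.2 Nat.card_pos.ne'
  exact div_ne_zero (mul_ne_zero h1 h2) (pow_ne_zero 2 h3)

end Span


/-! ### Right invariant linear characters of subgroups -/

section Invariance

variable {k H J : Type*} [Field k] [CommGroup H] [NonUnitalRing J] [Module k J]
  [IsScalarTower k J J] [SMulCommClass k J J] {D : TriangularType k H J}

theorem rightTriple_mul (b b' : D.N) : rightTriple (b * b') = rightTriple b * rightTriple b' :=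
  Gt_ext (by simp) (by simp)

theorem Index.xiExt_R_rightTriple [Finite J] {ε : AddChar k ℂ} (hε : ε ≠ 1)
    (α : D.Index) (lam : α.ω) (b : D.N) (g : D.G) :
    α.xiExt ε lam (D.R (rightTriple b) g) = α.xiExt ε lam g := by
  have : Finite D.N := Finite.of_equiv _ D.equivN
  have : Fintype D.N := Fintype.ofFinite _
  have hJ : (Nat.card J : ℂ) ≠ 0 := Nat.cast_ne_zero.2 Nat.card_pos.ne'
  refine mul_left_cancel₀ hJ ?_
  rw [← α.sum_base_R_rightTriple hε (α.subset lam.2), ← α.sum_base_R_rightTriple hε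
    (α.subset lam.2), ← Equiv.sum_comp (Equiv.mulRight b) fun n => α.base ε lam (D.R _ g)]
  refine Finset.sum_congr rfl fun n _ => ?_
  rw [Equiv.coe_mulRight, rightTriple_mul, R_mul]

/-- The function `h + x ↦ θ(h) ε^{λ(x)}` is invariant under the stabilizer of `λ`. -/
theorem Index.base_R_of_mem_stab (ε : AddChar k ℂ) (α : D.Index) (lam : α.ω) {σ : D.Gt}
    (hσ : σ ∈ D.stab lam.1) (g : D.G) : α.base ε lam (D.R σ g) = α.base ε lam g := by
  rw [mem_stab] at hσ
  rw [base, base, R_h]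
  by_cases hh : g.h ∈ D.Hfix α.e
  · rw [R_x_eq, map_add lam.1,
      apply_R_ofH_eq_zero (α.subset lam.2) (by rw [hσ]; exact α.subset lam.2) hh, add_zero,
      ← LinearMap.comp_apply, hσ]
  · rw [α.thetaExt_of_not_mem hh, zero_mul, zero_mul]

/-- The character `ξ_{θ,λ}`, extended by zero, is invariant under conjugation by `ta` for every
triple `(t, a, b)` in the stabilizer of `λ`. -/
theorem Index.xiExt_conj_of_mem_stab [Finite J] {ε : AddChar k ℂ} (hε : ε ≠ 1)
    (α : D.Index) (lam : α.ω) {τ : D.Gt} (hτ : τ ∈ D.stab lam.1) (g : D.G) :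
    α.xiExt ε lam ((D.pL τ)⁻¹ * g * D.pL τ) = α.xiExt ε lam g := by
  have : Finite D.N := Finite.of_equiv _ D.equivN
  have : Fintype D.N := Fintype.ofFinite _
  have hJ : (Nat.card J : ℂ) ≠ 0 := Nat.cast_ne_zero.2 Nat.card_pos.ne'
  have hpq : D.proj (D.pL τ) = D.proj (D.pR τ) := (D.pL_h τ).trans (D.pR_h τ).symm
  refine mul_left_cancel₀ hJ ?_
  rw [← α.sum_base_R_rightTriple hε (α.subset lam.2), ← α.sum_base_R_rightTriple hε
    (α.subset lam.2)]
  let e : D.N ≃ D.N :=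
    { toFun := fun n => ⟨D.pR τ * n * (D.pL τ)⁻¹, by
        change D.proj _ = 1
        rw [map_mul, map_mul, map_inv, hpq, show D.proj n = 1 from n.2, mul_one, mul_inv_cancel]⟩
      invFun := fun n => ⟨(D.pR τ)⁻¹ * n * D.pL τ, by
        change D.proj _ = 1
        rw [map_mul, map_mul, map_inv, hpq, show D.proj n = 1 from n.2, mul_one, inv_mul_cancel]⟩
      left_inv := fun n => Subtype.ext (by simp [mul_assoc])
      right_inv := fun n => Subtype.ext (by simp [mul_assoc]) }
  rw [← Equiv.sum_comp e fun b => α.base ε lam (D.R (rightTriple b) g)]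
  refine Finset.sum_congr rfl fun n _ => ?_
  have h1 : D.R (rightTriple n) ((D.pL τ)⁻¹ * g * D.pL τ) =
      D.R τ⁻¹ (D.R (rightTriple (e n)) g) := by
    have h2 : (D.pL τ)⁻¹ * g * D.pL τ = D.R (D.mkGt (D.pL τ)⁻¹ (D.pL τ)⁻¹ rfl) g := by
      rw [R_conj, inv_inv]
    rw [h2, ← R_mul, ← R_mul]
    congr 1
    refine Gt_ext (by simp) ?_
    rw [map_mul, map_mul, map_inv, pR_rightTriple, pR_rightTriple, pR_mkGt]
    change _ = (D.pR τ)⁻¹ * (D.pR τ * n * (D.pL τ)⁻¹)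
    group
  rw [h1, α.base_R_of_mem_stab ε lam (inv_mem hτ)]

theorem Index.xiExt_conj_of_mem {ε : AddChar k ℂ} (α : D.Index) (lam : α.ω)
    {q : D.G} (hq : q ∈ Galpha α lam) (g : D.G) :
    α.xiExt ε lam (q * g * q⁻¹) = α.xiExt ε lam g := by
  by_cases hg : g ∈ Galpha α lam
  · have h1 : α.xiExt ε lam q * α.xiExt ε lam q⁻¹ = α.xiExt ε lam 1 := by
      rw [← α.xiExt_mul ε lam hq (inv_mem hq), mul_inv_cancel]
    have h2 : α.xiExt ε lam 1 * α.xiExt ε lam g = α.xiExt ε lam g := by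
      rw [← α.xiExt_mul ε lam (one_mem _) hg, one_mul]
    rw [α.xiExt_mul ε lam (mul_mem hq hg) (inv_mem hq), α.xiExt_mul ε lam hq hg, mul_right_comm,
      h1, h2]
  · have hg' : q * g * q⁻¹ ∉ Galpha α lam := fun h => hg (by
      have := mul_mem (mul_mem (inv_mem hq) h) hq
      simpa [mul_assoc] using this)
    rw [← α.xiExt_ne_zero_iff ε lam, not_not] at hg hg'
    rw [hg, hg']

/-- `ψ` is a linear character of the subgroup `S` of `G`, extended by zero, and is invariant under
the maps `1 + y ↦ 1 + yb` for `b ∈ N`. -/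
structure IsRightInvariantCharacter (S : Subgroup D.G) (ψ : D.G → ℂ) : Prop where
  ne_zero_iff : ∀ g, ψ g ≠ 0 ↔ g ∈ S
  map_mul : ∀ g ∈ S, ∀ g' ∈ S, ψ (g * g') = ψ g * ψ g'
  map_R : ∀ b g, ψ (D.R (rightTriple b) g) = ψ g

theorem Index.isRightInvariantCharacter_xiExt [Finite J] {ε : AddChar k ℂ} (hε : ε ≠ 1)
    (α : D.Index) (lam : α.ω) :
    IsRightInvariantCharacter (Galpha α lam) (α.xiExt ε lam) where
  ne_zero_iff _ := α.xiExt_ne_zero_iff ε lam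
  map_mul _ hg _ hg' := α.xiExt_mul ε lam hg hg'
  map_R b g := α.xiExt_R_rightTriple hε lam b g

namespace IsRightInvariantCharacter

variable {S : Subgroup D.G} {ψ : D.G → ℂ}

/-- `1 + (u - 1)v` lies in the kernel of `ψ` for `u ∈ S` and `v ∈ J`. -/
theorem apply_commutator (hψ : IsRightInvariantCharacter S ψ) {u : D.G} (hu : u ∈ S) (v : J) :
    (⟨1, D.lact u v - v⟩ : D.G) ∈ S ∧ ψ ⟨1, D.lact u v - v⟩ = 1 := by
  set w : D.G := ⟨1, D.lact u v - v⟩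
  have h1 : D.R (rightTriple (D.equivN (D.ract u v))⁻¹) u = w * u := D.ofG_injective <| by
    have h2 : D.ofG (D.equivN (D.ract u v)).1 = 1 + D.ofJ v * D.ofG u := by
      rw [← ract_eq, ofG_eq]
      change D.ofAlg (MonoidAlgebra.of k H 1) + _ = _
      rw [_root_.map_one, _root_.map_one]; rfl
    have h3 : D.ofG w = 1 + (D.ofG u * D.ofJ v - D.ofJ v) := by
      rw [ofG_eq, ← lact_eq, ← map_sub, _root_.map_one, _root_.map_one]
    rw [ofG_R, pL_rightTriple, pR_rightTriple, Subgroup.coe_inv, inv_inv, _root_.map_one, one_mul,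
      h2, _root_.map_mul, h3]
    noncomm_ring
  have h2 := hψ.map_R (D.equivN (D.ract u v))⁻¹ u
  rw [h1] at h2
  have hu0 : ψ u ≠ 0 := (hψ.ne_zero_iff u).2 hu
  have hwu : w * u ∈ S := (hψ.ne_zero_iff _).1 (h2 ▸ hu0)
  have hw : w ∈ S := by simpa using mul_mem hwu (inv_mem hu)
  refine ⟨hw, ?_⟩
  rw [hψ.map_mul w hw u hu] at h2
  exact mul_right_cancel₀ hu0 (by rw [h2, one_mul])

variable {ε : AddChar k ℂ} {η : D.Index} {mu : η.ω}

/-- If a right invariant character `ψ` of `S` agrees with `ξ_{θ,μ}` where both are defined, then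
`μ(yJ) = 0` for every `1 + y ∈ S`. Elements `1 + yv` lie in the kernel of `ψ`, so that
`ε^{μ(yv)} = 1` as soon as `1 + yv ∈ G_η`; nilpotency starts the induction. -/
theorem apply_mul_eq_zero (hψ : IsRightInvariantCharacter S ψ) (hε : ε ≠ 1)
    (hmatch : ∀ u, ψ u ≠ 0 → η.xiExt ε mu u ≠ 0 → ψ u = η.xiExt ε mu u) {y : J}
    (hy : (⟨1, y⟩ : D.G) ∈ S) (v : J) : mu.1 (y * v) = 0 := by
  obtain ⟨n, hn⟩ := D.nilpotent
  -- descending induction on the power of `J` containing `y`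
  have key (d : ℕ) : ∀ (m : ℕ), m + d = n → ∀ (x : J) (s : List J), s.length = m →
      (⟨1, s.foldl (· * ·) x⟩ : D.G) ∈ S → ∀ v, mu.1 (s.foldl (· * ·) x * v) = 0 := by
    induction d with
    | zero =>
      intro m hm x s hs _ v
      rw [hn x s (by omega), zero_mul, map_zero]
    | succ d ih =>
      intro m hm x s hs hS v
      have h1 (v : J) : (⟨1, s.foldl (· * ·) x * v⟩ : D.G) ∈ S ∧
          ψ ⟨1, s.foldl (· * ·) x * v⟩ = 1 := by
        have := hψ.apply_commutator hS v
        have h2 : D.lact ⟨1, s.foldl (· * ·) x⟩ v - v = s.foldl (· * ·) x * v := by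
          simp [lact]
        rwa [h2] at this
      have h2 (v : J) : ε (mu.1 (s.foldl (· * ·) x * v)) = 1 := by
        have h3 : ∀ z, mu.1 (s.foldl (· * ·) x * v * z) = 0 := fun z => by
          have := ih (m + 1) (by omega) x (s ++ [v]) (by simp [hs])
          simp only [List.foldl_append, List.foldl_cons, List.foldl_nil] at this
          exact this (h1 v).1 z
        have h4 : η.xiExt ε mu ⟨1, s.foldl (· * ·) x * v⟩ =
            ε (mu.1 (s.foldl (· * ·) x * v)) := by
          rw [Index.xiExt, if_pos h3, Index.base, Index.thetaExt_of_mem _ (one_mem _)]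
          have : (⟨1, one_mem _⟩ : D.Hfix η.e) = 1 := rfl
          rw [this, _root_.map_one, Units.val_one, one_mul]
        rw [← h4, ← hmatch _ (by rw [(h1 v).2]; exact one_ne_zero)
          (by rw [h4]; exact addChar_ne_zero _ _), (h1 v).2]
      refine eq_zero_of_addChar_smul hε fun c => ?_
      rw [← smul_eq_mul, ← map_smul, ← mul_smul_comm]
      exact h2 _
  exact key n 0 (by omega) y [] rfl hy v

/-- If a right invariant character `ψ` of `S` agrees with `ξ_{θ,μ}` where both are defined, then
`μ` is invariant under left multiplication by `S`. -/
theorem apply_lact (hψ : IsRightInvariantCharacter S ψ) (hε : ε ≠ 1)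
    (hmatch : ∀ u, ψ u ≠ 0 → η.xiExt ε mu u ≠ 0 → ψ u = η.xiExt ε mu u) {u : D.G} (hu : u ∈ S)
    (v : J) : mu.1 (D.lact u v) = mu.1 v := by
  have h1 (v : J) : ε (mu.1 (D.lact u v - v)) = 1 := by
    obtain ⟨hw, hw1⟩ := hψ.apply_commutator hu v
    have h4 : η.xiExt ε mu ⟨1, D.lact u v - v⟩ = ε (mu.1 (D.lact u v - v)) := by
      rw [Index.xiExt, if_pos (hψ.apply_mul_eq_zero hε hmatch hw), Index.base,
        Index.thetaExt_of_mem _ (one_mem _)]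
      have : (⟨1, one_mem _⟩ : D.Hfix η.e) = 1 := rfl
      rw [this, _root_.map_one, Units.val_one, one_mul]
    rw [← h4, ← hmatch _ (by rw [hw1]; exact one_ne_zero)
      (by rw [h4]; exact addChar_ne_zero _ _), hw1]
  rw [← sub_eq_zero, ← map_sub]
  refine eq_zero_of_addChar_smul hε fun c => ?_
  rw [← smul_eq_mul, ← map_smul, smul_sub, ← map_smul]
  exact h1 _

end IsRightInvariantCharacter

/-! ### Counting lemmas -/

/-- The left and right kernels of `(x, z) ↦ λ(xz)` have the same order. -/
theorem card_leftKernel_eq [Finite J] {ε : AddChar k ℂ} (hε : ε ≠ 1) (lam : Module.Dual k J) :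
    Nat.card {x // ∀ z, lam (x * z) = 0} = Nat.card {z // ∀ x, lam (x * z) = 0} := by
  classical
  have : Fintype J := Fintype.ofFinite J
  have hJ : (Nat.card J : ℂ) ≠ 0 := Nat.cast_ne_zero.2 Nat.card_pos.ne'
  have key (φ : J → Module.Dual k J) : ∑ x, ∑ z, ε (φ x z) =
      (Nat.card {x // ∀ z, φ x z = 0} : ℂ) * Nat.card J := by
    have h (x : J) : φ x = 0 ↔ ∀ z, φ x z = 0 :=
      ⟨fun h z => LinearMap.congr_fun h z, fun h => LinearMap.ext h⟩
    simp only [sum_addChar_comp hε, h]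
    rw [← Finset.sum_filter, Finset.sum_const, nsmul_eq_mul, ← Fintype.card_subtype,
      Fintype.card_eq_nat_card]
  have h1 := key fun x => lam ∘ₗ LinearMap.mulLeft k x
  have h2 := key fun x => lam ∘ₗ LinearMap.mulRight k x
  rw [Finset.sum_comm] at h2
  have h3 := h1.symm.trans h2
  exact_mod_cast mul_right_cancel₀ hJ h3

theorem Index.card_Galpha (α : D.Index) (lam : α.ω) : Nat.card (Galpha α lam) =
    Nat.card (D.Hfix α.e) * Nat.card {x // ∀ z, lam.1 (x * z) = 0} := by
  rw [← Nat.card_prod]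
  exact Nat.card_congr
    { toFun := fun g => (⟨g.1.h, g.2.1⟩, ⟨g.1.x, g.2.2⟩)
      invFun := fun p => ⟨⟨p.1.1, p.2.1⟩, p.1.2, p.2.2⟩
      left_inv := fun _ => rfl
      right_inv := fun _ => rfl }

/-- An orbit count: over an invariant subset, the orders of the stabilizers add up to a multiple of
the order of the group. -/
theorem exists_sum_card_stabilizer {Γ X : Type*} [Group Γ] [Finite Γ] [Fintype X] [MulAction Γ X]
    (B : Set X) (hB : ∀ (γ : Γ), ∀ x ∈ B, γ • x ∈ B) [DecidablePred (· ∈ B)] :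
    ∃ n : ℕ, ∑ x, (if x ∈ B then Nat.card (MulAction.stabilizer Γ x) else 0) =
      n * Nat.card Γ := by
  classical
  let Y : SubMulAction Γ X := ⟨B, fun γ {x} hx => hB γ x hx⟩
  have : Fintype Γ := Fintype.ofFinite Γ
  have : Finite (Quotient (MulAction.orbitRel Γ Y)) := Quotient.finite _
  refine ⟨Nat.card (Quotient (MulAction.orbitRel Γ Y)), ?_⟩
  rw [← Nat.card_prod, ← Nat.card_congr (MulAction.sigmaFixedByEquivOrbitsProdGroup Γ Y)]
  have h1 : Nat.card (Σ γ : Γ, MulAction.fixedBy Y γ) =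
      Nat.card (Σ y : Y, MulAction.stabilizer Γ (y : X)) :=
    Nat.card_congr
      { toFun := fun p => ⟨p.2.1, p.1, congrArg Subtype.val p.2.2⟩
        invFun := fun p => ⟨p.2.1, p.1, Subtype.ext p.2.2⟩
        left_inv := fun _ => rfl
        right_inv := fun _ => rfl }
  rw [h1, Nat.card_sigma, ← Finset.sum_filter]
  exact Finset.sum_subtype _ (p := fun x => x ∈ B) (by simp) _

end Invariance


/-! ### Scalar products of linear characters -/

section Pairing

variable {k H J : Type*} [Field k] [CommGroup H] [NonUnitalRing J] [Module k J]
  [IsScalarTower k J J] [SMulCommClass k J J] {D : TriangularType k H J}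

namespace IsRightInvariantCharacter

variable {S K : Subgroup D.G} {ψ ξ : D.G → ℂ}

/-- The restriction of `ψ` to `S`, as a homomorphism. -/
noncomputable def toHom (hψ : IsRightInvariantCharacter S ψ) : S →* ℂ where
  toFun g := ψ g
  map_one' := by
    have h0 : ψ (1 : S) ≠ 0 := (hψ.ne_zero_iff _).2 (one_mem S)
    refine mul_left_cancel₀ h0 ?_
    rw [mul_one, ← hψ.map_mul _ (1 : S).2 _ (1 : S).2, Subgroup.coe_one, one_mul]
  map_mul' g g' := hψ.map_mul g g.2 g' g'.2

open Classical in
/-- Orthogonality of two linear characters of subgroups, extended by zero to the group. -/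
theorem sum_mul_conj [Fintype D.G] (hψ : IsRightInvariantCharacter S ψ)
    (hξ : IsRightInvariantCharacter K ξ) : ∑ u, ψ u * starRingEnd ℂ (ξ u) =
      if ∀ u, ψ u ≠ 0 → ξ u ≠ 0 → ψ u = ξ u then (Nat.card (S ⊓ K : Subgroup D.G) : ℂ) else 0 := by
  have : Fintype (S ⊓ K : Subgroup D.G) := Fintype.ofFinite _
  have h1 : ∀ u, u ∉ S ⊓ K → ψ u * starRingEnd ℂ (ξ u) = 0 := fun u hu => by
    by_contra h
    rw [mul_eq_zero, not_or, map_eq_zero] at h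
    exact hu ⟨(hψ.ne_zero_iff u).1 h.1, (hξ.ne_zero_iff u).1 h.2⟩
  rw [sum_eq_sum_subgroup (S ⊓ K) h1]
  let θ : (S ⊓ K : Subgroup D.G) →* ℂˣ :=
    (hψ.toHom.comp (Subgroup.inclusion inf_le_left)).toHomUnits
  let θ' : (S ⊓ K : Subgroup D.G) →* ℂˣ :=
    (hξ.toHom.comp (Subgroup.inclusion inf_le_right)).toHomUnits
  have h2 := sum_character_mul_conj θ θ'
  refine h2.trans (if_congr ⟨fun h u hu hu' => ?_, fun h => ?_⟩ rfl rfl)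
  · exact congrArg Units.val
      (DFunLike.congr_fun h ⟨u, (hψ.ne_zero_iff u).1 hu, (hξ.ne_zero_iff u).1 hu'⟩)
  · ext u
    exact h u ((hψ.ne_zero_iff _).2 u.2.1) ((hξ.ne_zero_iff _).2 u.2.2)

end IsRightInvariantCharacter

/-- Frobenius reciprocity for a supercharacter and a superclass function. -/
theorem scalarProduct_superchar_right [Finite H] [Finite J] (ε : AddChar k ℂ) (η : D.Index)
    (mu : η.ω) {f : D.G → ℂ} (hf : D.IsSuperclassFunction f) :
    scalarProduct f (superchar ε η mu) =
      (Nat.card (Galpha η mu) : ℂ)⁻¹ * ∑ u, f u * starRingEnd ℂ (η.xiExt ε mu u) := by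
  have hG : (Nat.card D.G : ℂ) ≠ 0 := Nat.cast_ne_zero.2 Nat.card_pos.ne'
  have h1 (v : D.G) : ∑ u, f u * starRingEnd ℂ (η.xiExt ε mu (v⁻¹ * u * v)) =
      ∑ u, f u * starRingEnd ℂ (η.xiExt ε mu u) := by
    rw [← Equiv.sum_comp (MulAut.conj v).toEquiv]
    refine Finset.sum_congr rfl fun u _ => ?_
    have h2 : f (v * (u * v⁻¹)) = f u := by rw [← mul_assoc, ← R_conj, hf]
    simp [h2, mul_assoc]
  have h2 : ∑ u, f u * starRingEnd ℂ (superchar ε η mu u) = (Nat.card (Galpha η mu) : ℂ)⁻¹ *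
      (Nat.card D.G * ∑ u, f u * starRingEnd ℂ (η.xiExt ε mu u)) := by
    calc _ = ∑ u, (Nat.card (Galpha η mu) : ℂ)⁻¹ *
          ∑ v, f u * starRingEnd ℂ (η.xiExt ε mu (v⁻¹ * u * v)) := by
          refine Finset.sum_congr rfl fun u _ => ?_
          rw [superchar_eq_sum_conj, map_mul, map_sum, map_inv₀, map_natCast, ← Finset.mul_sum]
          ring
      _ = _ := by
          rw [← Finset.mul_sum, Finset.sum_comm, Finset.sum_congr rfl fun v _ => h1 v,
            Finset.sum_const, nsmul_eq_mul, Finset.card_univ, Fintype.card_eq_nat_card]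
  rw [scalarProduct, h2, mul_left_comm, inv_mul_cancel_left₀ hG]

end Pairing

/-! ### Restriction to a subgroup of triangular type -/

section Restriction

variable {k H J : Type*} [Field k] [CommGroup H] [NonUnitalRing J] [Module k J]
  [IsScalarTower k J J] [SMulCommClass k J J] {D : TriangularType k H J}
  {H' : Subgroup H} {J' : NonUnitalSubalgebra k J}
  {hl : ∀ h ∈ H', ∀ x ∈ J', D.l h x ∈ J'} {hr : ∀ h ∈ H', ∀ x ∈ J', D.r h x ∈ J'}

theorem incl_injective : Function.Injective (incl : (D.restrict H' J' hl hr).G →* D.G) :=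
  fun _ _ h => G.ext (Subtype.ext (congrArg G.h h)) (Subtype.ext (congrArg G.x h))

theorem incl_pL_h (τ : (D.restrict H' J' hl hr).Gt) :
    (incl ((D.restrict H' J' hl hr).pL τ)).h = (incl ((D.restrict H' J' hl hr).pR τ)).h :=
  congrArg Subtype.val ((pL_h _ τ).trans (pR_h _ τ).symm)

theorem incl_R (τ : (D.restrict H' J' hl hr).Gt) (g : (D.restrict H' J' hl hr).G) :
    incl ((D.restrict H' J' hl hr).R τ g) =
      D.R (D.mkGt (incl ((D.restrict H' J' hl hr).pL τ)) (incl ((D.restrict H' J' hl hr).pR τ))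
        (incl_pL_h τ)) (incl g) := by
  refine G.ext rfl ?_
  rw [R_x, pL_mkGt, pR_mkGt, ← map_inv, ← map_mul, ← map_mul, ← map_mul]
  exact congrArg Subtype.val (R_x _ τ g)

theorem IsSuperclassFunction.comp_incl {f : D.G → ℂ} (hf : D.IsSuperclassFunction f) :
    (D.restrict H' J' hl hr).IsSuperclassFunction (f ∘ incl) := fun τ g => by
  rw [Function.comp_apply, incl_R, hf, Function.comp_apply]

/-- The linear character of `G' ∩ s G_α s⁻¹` obtained from `ξ_{θ,λ}` by conjugation with `s`,
extended by zero to `G'`. -/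
noncomputable def Index.xiConj (ε : AddChar k ℂ) (α : D.Index) (lam : α.ω) (s : D.G)
    (u : (D.restrict H' J' hl hr).G) : ℂ :=
  α.xiExt ε lam (s⁻¹ * incl u * s)

/-- The subgroup `G' ∩ s G_α s⁻¹` of `G'`. -/
noncomputable def Index.conjStab (α : D.Index) (lam : α.ω) (s : D.G) :
    Subgroup (D.restrict H' J' hl hr).G :=
  (Galpha α lam).comap ((MulAut.conj s⁻¹).toMonoidHom.comp incl)

theorem Index.mem_conjStab (α : D.Index) (lam : α.ω) (s : D.G)
    (u : (D.restrict H' J' hl hr).G) :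
    u ∈ α.conjStab lam s ↔ s⁻¹ * incl u * s ∈ Galpha α lam := by
  rw [conjStab, Subgroup.mem_comap]
  simp

theorem Index.isRightInvariantCharacter_xiConj [Finite J] {ε : AddChar k ℂ} (hε : ε ≠ 1)
    (α : D.Index) (lam : α.ω) (s : D.G) :
    IsRightInvariantCharacter (D := D.restrict H' J' hl hr) (α.conjStab lam s)
      (α.xiConj ε lam s) where
  ne_zero_iff u := by rw [xiConj, α.xiExt_ne_zero_iff ε lam, mem_conjStab]
  map_mul u hu v hv := by
    rw [mem_conjStab] at hu hv
    rw [xiConj, xiConj, xiConj, ← α.xiExt_mul ε lam hu hv, map_mul]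
    congr 1
    group
  map_R b u := by
    have hb : s⁻¹ * incl (b : (D.restrict H' J' hl hr).G) * s ∈ D.N := by
      change D.proj _ = 1
      have h1 : D.proj (incl (b : (D.restrict H' J' hl hr).G)) = 1 :=
        congrArg Subtype.val (show (b : (D.restrict H' J' hl hr).G).h = 1 from b.2)
      rw [map_mul, map_mul, map_inv, h1, mul_one, inv_mul_cancel]
    have h1 : s⁻¹ * incl ((D.restrict H' J' hl hr).R (rightTriple b) u) * s =
        D.R (rightTriple ⟨_, hb⟩) (s⁻¹ * incl u * s) := by
      have h2 (g : D.G) : s⁻¹ * g * s = D.R (D.mkGt s⁻¹ s⁻¹ rfl) g := by rw [R_conj, inv_inv]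
      rw [h2 (incl u), h2 (incl _), incl_R, ← R_mul, ← R_mul]
      congr 1
      exact Gt_ext (by simp) (by simp [mul_assoc])
    rw [xiConj, h1, α.xiExt_R_rightTriple hε, xiConj]

/-- The `s ∈ G` for which the character of `G' ∩ s G_α s⁻¹` agrees with the one of `G'_η` on the
intersection of these subgroups of `G'`. -/
def matchSet (ε : AddChar k ℂ) (α : D.Index) (lam : α.ω) (η : (D.restrict H' J' hl hr).Index)
    (mu : η.ω) : Set D.G :=
  {s | ∀ u, α.xiConj ε lam s u ≠ 0 → η.xiExt ε mu u ≠ 0 → α.xiConj ε lam s u = η.xiExt ε mu u}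

open Classical in
/-- The scalar product of a restricted supercharacter with a supercharacter of `G'`, by Mackey's
formula. -/
theorem scalarProduct_superchar_comp_incl [Finite H] [Finite J] {ε : AddChar k ℂ} (hε : ε ≠ 1)
    (α : D.Index) (lam : α.ω) (η : (D.restrict H' J' hl hr).Index) (mu : η.ω) :
    scalarProduct (superchar ε α lam ∘ incl) (superchar ε η mu) =
      ((Nat.card (Galpha η mu) : ℂ) * Nat.card (Galpha α lam))⁻¹ *
        ∑ s, if s ∈ matchSet ε α lam η mu then
          (Nat.card (α.conjStab lam s ⊓ Galpha η mu : Subgroup _) : ℂ) else 0 := by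
  rw [scalarProduct_superchar_right ε η mu (isSuperclassFunction_superchar hε α lam).comp_incl,
    mul_inv, mul_assoc]
  congr 1
  have h1 (s : D.G) := (α.isRightInvariantCharacter_xiConj (hl := hl) (hr := hr) hε lam s
    ).sum_mul_conj (η.isRightInvariantCharacter_xiExt hε mu)
  calc _ = ∑ u, (Nat.card (Galpha α lam) : ℂ)⁻¹ *
        ∑ s, α.xiConj ε lam s u * starRingEnd ℂ (η.xiExt ε mu u) := by
        refine Finset.sum_congr rfl fun u _ => ?_
        rw [Function.comp_apply, superchar_eq_sum_conj, mul_assoc, Finset.sum_mul]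
        rfl
    _ = _ := by
        rw [← Finset.mul_sum, Finset.sum_comm, Finset.sum_congr rfl fun s _ => h1 s]
        congr 1
        exact Finset.sum_congr rfl fun s _ => if_congr Iff.rfl rfl rfl

/-- The action of `Stab(μ) × G_α` on `G` by `((t, a, b), q) • s = (ta) s q⁻¹`. -/
noncomputable abbrev stabAction (α : D.Index) (lam : α.ω)
    (mu : Module.Dual k J') :
    MulAction ((D.restrict H' J' hl hr).stab mu × Galpha α lam) D.G where
  smul γ s := incl ((D.restrict H' J' hl hr).pL γ.1.1) * s * (γ.2 : D.G)⁻¹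
  one_smul s := by
    change incl ((D.restrict H' J' hl hr).pL 1) * s * (1 : D.G)⁻¹ = s
    simp
  mul_smul γ γ' s := by
    change incl ((D.restrict H' J' hl hr).pL (γ.1.1 * γ'.1.1)) * s *
      ((γ.2 : D.G) * γ'.2)⁻¹ = incl ((D.restrict H' J' hl hr).pL γ.1.1) *
      (incl ((D.restrict H' J' hl hr).pL γ'.1.1) * s * (γ'.2 : D.G)⁻¹) * (γ.2 : D.G)⁻¹
    rw [map_mul, map_mul]; group

/-- `matchSet` is invariant under the action `stabAction`. -/
theorem smul_mem_matchSet [Finite J] {ε : AddChar k ℂ} (hε : ε ≠ 1) {α : D.Index} {lam : α.ω}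
    {η : (D.restrict H' J' hl hr).Index} {mu : η.ω} {τ : (D.restrict H' J' hl hr).Gt}
    (hτ : τ ∈ (D.restrict H' J' hl hr).stab mu.1) {q : D.G} (hq : q ∈ Galpha α lam) {s : D.G}
    (hs : s ∈ matchSet ε α lam η mu) :
    incl ((D.restrict H' J' hl hr).pL τ) * s * q⁻¹ ∈ matchSet ε α lam η mu := by
  intro u
  set p := (D.restrict H' J' hl hr).pL τ
  have h1 : α.xiConj ε lam (incl p * s * q⁻¹) u = α.xiConj ε lam s (p⁻¹ * u * p) := by
    rw [Index.xiConj, Index.xiConj, ← α.xiExt_conj_of_mem lam hq (s⁻¹ * _ * s)]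
    congr 1
    rw [map_mul, map_mul, map_inv]; group
  rw [h1, ← η.xiExt_conj_of_mem_stab hε mu hτ u]
  exact hs _

section Stabilizer

variable {T : TriangularType k H J}

theorem rho_ract (τ : T.Gt) (x : J) : T.rho τ (T.ract (T.pR τ) x) = T.lact (T.pL τ) x :=
  T.ofJ_injective <| by rw [ofJ_rho, ract_eq, lact_eq, mul_assoc, mul_assoc, ofG_mul_inv, mul_one]

theorem ract_ract_inv (g : T.G) (x : J) : T.ract g (T.ract g⁻¹ x) = x := by
  rw [← Module.End.mul_apply, ← ract_mul, inv_mul_cancel, ract_one]; rfl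

theorem apply_ract_ofH_mul (lam : Module.Dual k J) {e : MonoidAlgebra k H} (hlam : lam ∈ T.JeDual e)
    {h : H} (hh : h ∈ T.Hfix e) (z x : J) : lam (T.ract (T.ofH h * ⟨1, z⟩) x) =
      lam x + lam (T.r h x * z) := by
  rw [ract_mul, Module.End.mul_apply]
  simp [ract, ofH, JeDual_r hlam hh]

/-- If `μ` is invariant under left multiplication by `ta`, then `(t, a, b)` stabilizes `μ` if and
only if `ta ∈ G_η` and `μ(J(b - 1)) = 0`. Regularity of the orbit puts `t` into `H(e)`. -/
theorem mem_stab_iff_of_lact [Finite H] [Finite J] {η : T.Index} {mu : η.ω} {τ : T.Gt}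
    (hτ : ∀ v, mu.1 (T.lact (T.pL τ) v) = mu.1 v) :
    τ ∈ T.stab mu.1 ↔ T.pL τ ∈ Galpha η mu ∧ ∀ x, mu.1 (x * (τ.b : T.G).x) = 0 := by
  have hb : T.pR τ = T.ofH τ.t * ⟨1, (τ.b : T.G).x⟩ := by
    change T.ofH τ.t * τ.b = _
    congr 1
    exact G.ext τ.b.2 rfl
  constructor
  · intro h
    have h1 (x : J) : mu.1 (T.ract (T.pR τ) x) = mu.1 x := by
      conv_lhs => rw [← show mu.1 ∘ₗ T.rho τ = mu.1 from h]
      rw [LinearMap.comp_apply, rho_ract, hτ]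
    have hh : (T.pL τ).h ∈ T.Hfix η.e := (η.regularAt mu.2).mem_Hfix_of_invariant η.idem
      ((T.pL_h τ).trans (T.pR_h τ).symm) hτ h1
    refine ⟨⟨hh, fun z => ?_⟩, fun x => ?_⟩
    · have h2 := hτ z
      simpa [lact, JeDual_l (η.subset mu.2) hh] using h2
    · rw [pL_h] at hh
      have h2 := h1 (T.r τ.t⁻¹ x)
      rw [hb, apply_ract_ofH_mul _ (η.subset mu.2) hh, add_eq_left, ← Module.End.mul_apply,
        ← map_mul, mul_inv_cancel, map_one] at h2
      exact h2
  · rintro ⟨⟨hh, -⟩, hz⟩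
    rw [mem_stab]
    ext x
    rw [pL_h] at hh
    have h1 (y : J) : mu.1 (T.ract (T.pR τ) y) = mu.1 y := by
      rw [hb, apply_ract_ofH_mul _ (η.subset mu.2) hh, hz, add_zero]
    rw [LinearMap.comp_apply, ← T.ract_ract_inv (T.pR τ) x, rho_ract, hτ, h1]

/-- The triple with `ta = g` and `b = 1 + z`. -/
noncomputable def tripleOf (g : T.G) (z : J) : T.Gt :=
  T.mkGt g (T.ofH g.h * ⟨1, z⟩) (show g.h = (T.ofH g.h * ⟨1, z⟩ : T.G).h from (mul_one _).symm)

@[simp] theorem pL_tripleOf (g : T.G) (z : J) : T.pL (tripleOf g z) = g := pL_mkGt _ _ _ _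

theorem b_tripleOf (g : T.G) (z : J) : ((tripleOf g z).b : T.G) = ⟨1, z⟩ :=
  inv_mul_cancel_left _ _

theorem tripleOf_pL (τ : T.Gt) : tripleOf (T.pL τ) (τ.b : T.G).x = τ := by
  refine Gt_ext (pL_tripleOf _ _) ?_
  refine (pR_mkGt _ _ _ _).trans ?_
  change T.ofH (T.pL τ).h * _ = T.ofH τ.t * τ.b
  rw [pL_h]
  congr 1
  exact G.ext (Eq.symm τ.b.2) rfl

/-- For a subgroup `S` fixing `μ` under left translation, the triples of `Stab(μ)` with `ta ∈ S`
are parametrized by `S ∩ G_η` and the `z` with `μ(Jz) = 0`. -/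
theorem card_stab_pL_mem [Finite H] [Finite J] {η : T.Index} {mu : η.ω} {S : Subgroup T.G}
    (hS : ∀ u ∈ S, ∀ v, mu.1 (T.lact u v) = mu.1 v) :
    Nat.card {τ : T.stab mu.1 // T.pL τ ∈ S} =
      Nat.card (S ⊓ Galpha η mu : Subgroup T.G) * Nat.card {z // ∀ x, mu.1 (x * z) = 0} := by
  rw [← Nat.card_prod]
  exact Nat.card_congr
    { toFun := fun τ =>
        have h := (mem_stab_iff_of_lact (hS _ τ.2)).1 τ.1.2
        (⟨T.pL τ.1, τ.2, h.1⟩, ⟨((τ.1 : T.Gt).b : T.G).x, h.2⟩)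
      invFun := fun p => ⟨⟨tripleOf p.1 p.2, (mem_stab_iff_of_lact (by
          rw [pL_tripleOf]; exact hS _ p.1.2.1)).2
            ⟨by rw [pL_tripleOf]; exact p.1.2.2, by rw [b_tripleOf]; exact p.2.2⟩⟩,
          by rw [pL_tripleOf]; exact p.1.2.1⟩
      left_inv := fun τ => Subtype.ext (Subtype.ext (tripleOf_pL _))
      right_inv := fun p => Prod.ext (Subtype.ext (pL_tripleOf _ _))
        (Subtype.ext (congrArg G.x (b_tripleOf _ _))) }

end Stabilizer

/-- The order of the stabilizer in `Stab(μ) × G_α` of an element `s` of `matchSet` is, up to a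
factor not depending on `s`, the term of `s` in Mackey's formula. -/
theorem card_stabilizer_of_mem_matchSet [Finite H] [Finite J] {ε : AddChar k ℂ} (hε : ε ≠ 1)
    {α : D.Index} {lam : α.ω} {η : (D.restrict H' J' hl hr).Index} {mu : η.ω} {s : D.G}
    (hs : s ∈ matchSet ε α lam η mu) :
    let _ := stabAction (hl := hl) (hr := hr) α lam mu.1
    Nat.card (MulAction.stabilizer ((D.restrict H' J' hl hr).stab mu.1 × Galpha α lam) s) =
      Nat.card (α.conjStab lam s ⊓ Galpha η mu : Subgroup _) *
        Nat.card {z // ∀ x, mu.1 (x * z) = 0} := by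
  intro inst
  rw [← card_stab_pL_mem (S := α.conjStab lam s) fun u hu v =>
    (α.isRightInvariantCharacter_xiConj hε lam s).apply_lact hε hs hu v]
  have hfix (γ : (D.restrict H' J' hl hr).stab mu.1 × Galpha α lam) :
      γ ∈ MulAction.stabilizer _ s ↔
        (γ.2 : D.G) = s⁻¹ * incl ((D.restrict H' J' hl hr).pL γ.1.1) * s := by
    change incl ((D.restrict H' J' hl hr).pL γ.1.1) * s * (γ.2 : D.G)⁻¹ = s ↔ _
    rw [mul_inv_eq_iff_eq_mul, eq_comm, ← eq_inv_mul_iff_mul_eq, mul_assoc]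
  exact Nat.card_congr
    { toFun := fun γ => ⟨γ.1.1, by
        rw [Index.mem_conjStab, ← (hfix γ).1 γ.2]; exact γ.1.2.2⟩
      invFun := fun τ => ⟨(τ.1, ⟨_, (α.mem_conjStab lam s _).1 τ.2⟩), (hfix _).2 rfl⟩
      left_inv := fun γ => Subtype.ext (Prod.ext rfl (Subtype.ext ((hfix _).1 γ.2).symm))
      right_inv := fun _ => rfl }

/-- The multiplicities of supercharacters of `G'` in restricted supercharacters of `G` are natural
numbers: they count the orbits of `Stab(μ) × G_α` on `matchSet`. -/
theorem exists_multiplicity [Finite k] [Finite H] [Finite J] {ε : AddChar k ℂ} (hε : ε ≠ 1)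
    (α : D.Index) (lam : α.ω) (η : (D.restrict H' J' hl hr).Index) (mu : η.ω) :
    ∃ n : ℕ, scalarProduct (superchar ε α lam ∘ incl) (superchar ε η mu) /
      scalarProduct (superchar ε η mu) (superchar ε η mu) = n := by
  classical
  let _ := stabAction (hl := hl) (hr := hr) α lam mu.1
  obtain ⟨n, hn⟩ := exists_sum_card_stabilizer
    (Γ := (D.restrict H' J' hl hr).stab mu.1 × Galpha α lam) (matchSet ε α lam η mu)
    fun γ s hs => smul_mem_matchSet hε γ.1.2 γ.2.2 hs
  refine ⟨n, ?_⟩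
  have h1 (s : D.G) : (if s ∈ matchSet ε α lam η mu then Nat.card (MulAction.stabilizer
      ((D.restrict H' J' hl hr).stab mu.1 × Galpha α lam) s) else 0) =
      (if s ∈ matchSet ε α lam η mu then
        Nat.card (α.conjStab lam s ⊓ Galpha η mu : Subgroup _) else 0) *
        Nat.card {z // ∀ x, mu.1 (x * z) = 0} := by
    split_ifs with hs
    · exact card_stabilizer_of_mem_matchSet hε hs
    · rw [zero_mul]
  rw [Finset.sum_congr rfl fun s _ => h1 s, ← Finset.sum_mul, Nat.card_prod] at hn
  have hn' := congrArg (Nat.cast : ℕ → ℂ) hn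
  push_cast at hn'
  rw [scalarProduct_superchar_comp_incl hε, η.scalarProduct_superchar_self hε mu]
  have hG : (Nat.card (Galpha η mu) : ℂ) = Nat.card ((D.restrict H' J' hl hr).Hfix η.e) *
      Nat.card {z // ∀ x, mu.1 (x * z) = 0} := by
    rw [η.card_Galpha mu, card_leftKernel_eq hε, Nat.cast_mul]
  have h2 : (Nat.card ((D.restrict H' J' hl hr).Hfix η.e) : ℂ) ≠ 0 :=
    Nat.cast_ne_zero.2 Nat.card_pos.ne'
  have h3 : (Nat.card ((D.restrict H' J' hl hr).stab mu.1) : ℂ) ≠ 0 :=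
    Nat.cast_ne_zero.2 Nat.card_pos.ne'
  have h4 : (Nat.card (Galpha α lam) : ℂ) ≠ 0 := Nat.cast_ne_zero.2 Nat.card_pos.ne'
  have h5 : (Nat.card {z // ∀ x, mu.1 (x * z) = 0} : ℂ) ≠ 0 := by
    have h6 : (Nat.card (Galpha η mu) : ℂ) ≠ 0 := Nat.cast_ne_zero.2 Nat.card_pos.ne'
    rw [hG] at h6
    exact right_ne_zero_of_mul h6
  rw [hG]
  field_simp
  rw [mul_comm, hn']
  ring

/-- Superinduction is adjoint to restriction on superclass functions. -/
theorem scalarProduct_superInd [Finite H] [Finite J] (φ : (D.restrict H' J' hl hr).G → ℂ)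
    {F : D.G → ℂ} (hF : D.IsSuperclassFunction F) :
    scalarProduct (superInd φ) F = scalarProduct φ (F ∘ incl) := by
  have hH : (Nat.card H : ℂ) ≠ 0 := Nat.cast_ne_zero.2 Nat.card_pos.ne'
  have hJ : (Nat.card J : ℂ) ≠ 0 := Nat.cast_ne_zero.2 Nat.card_pos.ne'
  have h1 : ∑ g, Function.extend (incl (D := D)) φ 0 g * starRingEnd ℂ (F g) =
      ∑ u, φ u * starRingEnd ℂ ((F ∘ incl) u) := by
    refine (Fintype.sum_of_injective incl incl_injective _ _ (fun g hg => ?_) fun u => ?_).symm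
    · rw [Function.extend_apply' _ _ _ hg, Pi.zero_apply, zero_mul]
    · rw [incl_injective.extend_apply]; rfl
  rw [scalarProduct, scalarProduct]
  simp only [superInd, mul_assoc]
  rw [← Finset.mul_sum, sum_orbitSum_mul_conj _ hF, h1, card_Gt, D.card_G]
  push_cast
  field_simp

theorem isSuperclassFunction_superInd [Finite H] [Finite J]
    (φ : (D.restrict H' J' hl hr).G → ℂ) : D.IsSuperclassFunction (superInd φ) :=
  isSuperclassFunction_orbitSum _ _

end Restriction

/-! ### Scalar squares and linear independence -/

section Norm

variable {k H J : Type*} [Field k] [CommGroup H] [NonUnitalRing J] [Module k J]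
  [IsScalarTower k J J] [SMulCommClass k J J] {D : TriangularType k H J}
  [Finite k] [Finite H] [Finite J]

/-- The scalar square of a supercharacter is a positive rational number. -/
theorem exists_rat_scalarProduct_superchar {ε : AddChar k ℂ} (hε : ε ≠ 1) (α : D.Index)
    (lam : α.ω) :
    ∃ q : ℚ, 0 < q ∧ scalarProduct (superchar ε α lam) (superchar ε α lam) = q := by
  have h1 : 0 < Nat.card (D.Hfix α.e) := Nat.card_pos
  have h2 : 0 < Nat.card (D.stab lam.1) := Nat.card_pos
  have h3 : 0 < Nat.card (Galpha α lam) := Nat.card_pos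
  refine ⟨Nat.card (D.Hfix α.e) * Nat.card (D.stab lam.1) / (Nat.card (Galpha α lam) : ℚ) ^ 2,
    by positivity, ?_⟩
  rw [α.scalarProduct_superchar_self hε lam]
  push_cast
  rfl

theorem linearIndependent_superchar {ε : AddChar k ℂ} (hε : ε ≠ 1) (rep : ∀ α : D.Index, α.ω) :
    LinearIndependent ℂ fun α => superchar ε α (rep α) := by
  refine linearIndependent_of_orthogonal
    (fun α β h => Index.scalarProduct_superchar_of_ne hε h _ _) fun α => ?_
  obtain ⟨q, hq, h⟩ := exists_rat_scalarProduct_superchar hε α (rep α)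
  rw [h]
  exact_mod_cast hq.ne'

end Norm

end TriangularType

open TriangularType

theorem mainTheorem4 {k H J : Type*} [Field k] [Finite k] [CommGroup H] [Finite H]
    [NonUnitalRing J] [Module k J] [IsScalarTower k J J] [SMulCommClass k J J] [Finite J]
    (D : TriangularType k H J) (ε : AddChar k ℂ) (hε : ε ≠ 1)
    (H' : Subgroup H) (J' : NonUnitalSubalgebra k J)
    (hl : ∀ h ∈ H', ∀ x ∈ J', D.l h x ∈ J') (hr : ∀ h ∈ H', ∀ x ∈ J', D.r h x ∈ J')
    (lam : ∀ α : D.Index, α.ω) (lam' : ∀ η : (D.restrict H' J' hl hr).Index, η.ω) :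
    let χ : D.Index → D.G → ℂ := fun α => TriangularType.superchar ε α (lam α)
    let φ : (D.restrict H' J' hl hr).Index → (D.restrict H' J' hl hr).G → ℂ :=
      fun η => TriangularType.superchar ε η (lam' η)
    LinearIndependent ℂ χ ∧ LinearIndependent ℂ φ ∧
    ∃ (m : D.Index → (D.restrict H' J' hl hr).Index → ℕ)
      (a : (D.restrict H' J' hl hr).Index → D.Index → ℚ),
      (∀ α, χ α ∘ TriangularType.incl = ∑ η, (m α η : ℂ) • φ η) ∧
      (∀ η, TriangularType.superInd (φ η) = ∑ α, (a η α : ℂ) • χ α) ∧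
      (∀ η α, 0 ≤ a η α) ∧
      ∀ η α, (a η α : ℂ) = m α η * TriangularType.scalarProduct (φ η) (φ η) /
        TriangularType.scalarProduct (χ α) (χ α) := by
  intro χ φ
  choose m hm using fun (α : D.Index) (η : (D.restrict H' J' hl hr).Index) =>
    exists_multiplicity hε α (lam α) η (lam' η)
  choose q hq hqχ using fun α : D.Index => exists_rat_scalarProduct_superchar hε α (lam α)
  choose q' hq' hqφ using fun η : (D.restrict H' J' hl hr).Index =>
    exists_rat_scalarProduct_superchar hε η (lam' η)
  have hres (α : D.Index) : χ α ∘ incl = ∑ η, (m α η : ℂ) • φ η := by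
    refine ((isSuperclassFunction_superchar hε α (lam α)).comp_incl.eq_sum hε lam').trans ?_
    exact Finset.sum_congr rfl fun η _ => by rw [hm]
  refine ⟨linearIndependent_superchar hε lam, linearIndependent_superchar hε lam', m,
    fun η α => m α η * q' η / q α, hres, fun η => ?_, fun η α => ?_, fun η α => ?_⟩
  · refine ((isSuperclassFunction_superInd (φ η)).eq_sum hε lam).trans ?_
    refine Finset.sum_congr rfl fun α _ => ?_
    congr 1
    have h1 : scalarProduct (φ η) (χ α ∘ incl) = m α η * q' η := by
      rw [← scalarProduct_conj, hres α, scalarProduct_sum_of_orthogonal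
        (fun i j hij => Index.scalarProduct_superchar_of_ne hε hij _ _), hqφ]
      simp
    rw [scalarProduct_superInd _ (isSuperclassFunction_superchar hε α (lam α)), h1, hqχ]
    push_cast
    rfl
  · have h1 := hq' η
    have h2 := hq α
    positivity
  · change _ = (m α η : ℂ) * scalarProduct (superchar ε η (lam' η)) (superchar ε η (lam' η)) /
      scalarProduct (superchar ε α (lam α)) (superchar ε α (lam α))
    rw [hqχ, hqφ]
    push_cast
    rfl
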